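/- **Setting.** Let $k$ be a commutative ring and $\mathscr T$ a small dg-category over $k$. A right dg-module over $\mathscr T$ is a dg-functor $\mathscr T^{op}\to C(k)$; these form a dg-category $\mathscr T^{op}\text{-Mod}$. Let $\widehat{\mathscr T}_{pe}$ be its full dg-subcategory of perfect modules, i.e. the h-projective modules which are compact (their morphisms into direct sums commute, up to homotopy, with the direct sums). With shifts and the triangles $M\xrightarrow{\varphi}N\to \mathrm{cone}(\varphi)\to M[1]$, the category $H^0(\widehat{\mathscr T}_{pe})$ is triangulated and $k$-linear. An $n$-fold dg-bimodule over $\mathscr T$ is a dg-module over $\mathscr T^{\otimes n}\otimes\mathscr T^{op}$. Tensor products are taken over $\mathscr T$ with the relations $x\cdot f\otimes\gamma=x\otimes f\cdot\gamma$. For a $2$-fold dg-bimodule $\Gamma$ write $\Gamma(X,Y)=\Gamma\otimes X\otimes Y$, and for a ($1$-fold) dg-bimodule $\Phi$ write $\Phi(X)=\Phi\otimes X$. Morphisms of multifold bimodules are written through the dg-natural families which they induce on right dg-modules $X,Y,Z,W$; $\mathrm{Hom}^{-1}$ denotes such families of degree $-1$, and $d$ is the differential of the complexes of morphisms. **Pseudo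 dg-tensor structures.** A pseudo dg-tensor structure on $\mathscr T$ consists of a $2$-fold dg-bimodule $\Gamma$, a right dg-module $U$, and closed morphisms of bimodules of degree $0$ $$\alpha_{X,Y,Z}:\Gamma(X,\Gamma(Y,Z))\to\Gamma(\Gamma(X,Y),Z),\quad \ell_X:\Gamma(U,X)\to X,\quad r_X:\Gamma(X,U)\to X,\quad c_{X,Y}:\Gamma(X,Y)\to\Gamma(Y,X),$$ which are quasi-isomorphisms for all $X,Y,Z\in\widehat{\mathscr T}_{pe}$, together with morphisms of degree $-1$ $\eta\in \mathrm{Hom}^{-1}(\Gamma(X,\Gamma(Y,\Gamma(Z,W))),\Gamma(\Gamma(\Gamma(X,Y),Z),W))$, $\mu\in \mathrm{Hom}^{-1}(\Gamma(X,\Gamma(U,Y)),\Gamma(X,Y))$, $\kappa\in\mathrm{Hom}^{-1}(\Gamma(X,U),X)$, $\lambda\in\mathrm{Hom}^{-1}(\Gamma(X,\Gamma(Y,Z)),\Gamma(\Gamma(Z,X),Y))$ such that 1. $\alpha_{\Gamma(X,Y),Z,W}\circ\alpha_{X,Y,\Gamma(Z,W)}-\Gamma(\alpha_{X,Y,Z},W)\circ\alpha_{X,\Gamma(Y,Z),W}\circ\Gamma(X,\alpha_{Y,Z,W})=d\eta$;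 2. $\Gamma(r_X,Y)\circ\alpha_{X,U,Y}-\Gamma(X,\ell_Y)=d\mu$; 3. $c_{Y,X}\circ c_{X,Y}$ is homotopic to the identity; 4. $\ell_X\circ c_{X,U}-r_X=d\kappa$; 5. $\Gamma(c_{X,Z},Y)\circ\alpha_{X,Z,Y}\circ\Gamma(X,c_{Y,Z})-\alpha_{Z,X,Y}\circ c_{\Gamma(X,Y),Z}\circ\alpha_{X,Y,Z}=d\lambda$. It is called perfect if $U\in\widehat{\mathscr T}_{pe}$ and $\Gamma(X,Y)\in\widehat{\mathscr T}_{pe}$ for all $X,Y\in\widehat{\mathscr T}_{pe}$. A perfect pseudo dg-tensor structure makes $H^0(\widehat{\mathscr T}_{pe})$ a tensor triangulated category $H^0(\widehat{\mathscr T}_{pe},\Gamma)$: the tensor product is $\Gamma(X,Y)$, the unit is $U$, and the classes of $\alpha^{-1},\ell,r,c$ are the associativity, unit and symmetry isomorphisms. Two perfect pseudo dg-tensor structures $\Gamma,\Lambda$ are tensor triangulated equivalent if there is a $k$-linear, exact, (strong) symmetric monoidal equivalence between $H^0(\widehat{\mathscr T}_{pe},\Gamma)$ and $H^0(\widehat{\mathscr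 T}_{pe},\Lambda)$. **Pseudo dg-tensor functors.** Let $\Gamma,\Lambda$ be perfect pseudo dg-tensor structures on $\mathscr T$ with units $U,U'$. A pseudo dg-tensor functor between $\Gamma$ and $\Lambda$ consists of a dg-bimodule $\Phi$ over $\mathscr T$ with $\Phi(X)\in\widehat{\mathscr T}_{pe}$ for $X\in\widehat{\mathscr T}_{pe}$, a closed morphism $u:U\to\Phi(U')$ of degree $0$ and a closed morphism of $2$-fold bimodules $f_{X,Y}:\Gamma(\Phi(X),\Phi(Y))\to\Phi(\Lambda(X,Y))$ of degree $0$, such that $u$ is a quasi-isomorphism and so is $f_{X,Y}$ for all $X,Y\in\widehat{\mathscr T}_{pe}$, together with morphisms $w\in\mathrm{Hom}^{-1}(\Gamma(U,\Phi(X)),\Phi(X))$, $e\in\mathrm{Hom}^{-1}(\Gamma(\Phi(X),\Phi(Y)),\Phi(\Lambda(Y,X)))$, $a\in\mathrm{Hom}^{-1}(\Gamma(\Phi(X),\Gamma(\Phi(Y),\Phi(Z))),\Phi(\Lambda(\Lambda(X,Y),Z)))$ such that 1. $\Phi(\ell^\Lambda_X)\circ f_{U',X}\circ\Gamma(u,\Phi(X))-\ell^\Gamma_{\Phi(X)}=dw$;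 2. $\Phi(c^\Lambda_{X,Y})\circ f_{X,Y}-f_{Y,X}\circ c^\Gamma_{\Phi(X),\Phi(Y)}=de$; 3. $f_{\Lambda(X,Y),Z}\circ\Gamma(f_{X,Y},\Phi(Z))\circ\alpha^\Gamma_{\Phi(X),\Phi(Y),\Phi(Z)}-\Phi(\alpha^\Lambda_{X,Y,Z})\circ f_{X,\Lambda(Y,Z)}\circ\Gamma(\Phi(X),f_{Y,Z})=da$. The bimodule $\Phi$ is invertible under the tensor product of bimodules if there is a dg-bimodule $\Phi'$ over $\mathscr T$, with $\Phi'(X)\in\widehat{\mathscr T}_{pe}$ for $X\in\widehat{\mathscr T}_{pe}$, such that $\Phi\otimes\Phi'$ and $\Phi'\otimes\Phi$ are both connected to the identity bimodule $(x,y)\mapsto\mathscr T(y,x)$ by zigzags of quasi-isomorphisms of bimodules. **Lemma.** Let $\Gamma$ and $\Lambda$ be perfect pseudo dg-tensor structures on $\mathscr T$. If there is a pseudo dg-tensor functor between $\Gamma$ and $\Lambda$ whose dg-bimodule $\Phi$ is invertible under the tensor product of bimodules, then $\Gamma$ and $\Lambda$ are tensor triangulated equivalent. -/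

import Mathlib

open CategoryTheory

universe v v₁ v₂ v₃ u

/-! ### Signs -/

/-- The sign `(-1)ⁿ`, as an element of the base ring. -/
def sg (k : Type u) [CommRing k] (n : ℤ) : k := ((n.negOnePow : ℤ) : k)

section Signs

variable (k : Type u) [CommRing k]

theorem sg_zero : sg k 0 = 1 := by simp [sg]

theorem sg_one : sg k 1 = -1 := by simp [sg]

theorem sg_neg_one : sg k (-1) = -1 := by simp [sg, Int.negOnePow_neg]

theorem sg_add (m n : ℤ) : sg k (m + n) = sg k m * sg k n := by
  simp [sg, Int.negOnePow_add]

theorem sg_mul_self (n : ℤ) : sg k n * sg k n = 1 := by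
  rw [← sg_add]
  simp [sg, ← two_mul]

end Signs

/-! ### Dg-categories -/

/-- A dg-category over `k`: a category enriched over cochain complexes of `k`-modules.
`Hom a b n` is the degree `n` part of the complex of morphisms, `d` its differential (of degree
`+1`), and `comp h g f` is the composite `g ∘ f`. -/
structure DGCat (k : Type u) [CommRing k] where
  Obj : Type v
  Hom : Obj → Obj → ℤ → Type u
  [addCommGroup : ∀ a b n, AddCommGroup (Hom a b n)]
  [module : ∀ a b n, Module k (Hom a b n)]
  d : ∀ {a b : Obj} (n m : ℤ), n + 1 = m → (Hom a b n →ₗ[k] Hom a b m)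
  d_d : ∀ {a b : Obj} (n m l : ℤ) (h : n + 1 = m) (h' : m + 1 = l) (f : Hom a b n),
    d m l h' (d n m h f) = 0
  id : ∀ a : Obj, Hom a a 0
  comp : ∀ {a b c : Obj} {p q r : ℤ}, p + q = r →
    (Hom b c p →ₗ[k] Hom a b q →ₗ[k] Hom a c r)
  id_comp : ∀ {a b : Obj} {n : ℤ} (h : 0 + n = n) (f : Hom a b n), comp h (id b) f = f
  comp_id : ∀ {a b : Obj} {n : ℤ} (h : n + 0 = n) (f : Hom a b n), comp h f (id a) = f
  assoc : ∀ {a b c e : Obj} {p q r pq qr s : ℤ} (h₁ : p + q = pq) (h₂ : pq + r = s)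
    (h₃ : q + r = qr) (h₄ : p + qr = s) (f : Hom c e p) (g : Hom b c q) (h : Hom a b r),
    comp h₂ (comp h₁ f g) h = comp h₄ f (comp h₃ g h)
  d_comp : ∀ {a b c : Obj} {p q r p' q' r' : ℤ} (h : p + q = r) (hp : p + 1 = p')
    (hq : q + 1 = q') (hr : r + 1 = r') (h₁ : p' + q = r') (h₂ : p + q' = r')
    (g : Hom b c p) (f : Hom a b q),
    d r r' hr (comp h g f) =
      comp h₁ (d p p' hp g) f + sg k p • comp h₂ g (d q q' hq f)

attribute [instance] DGCat.addCommGroup DGCat.module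

namespace DGCat

variable {k : Type u} [CommRing k]

/-- Composition of morphisms of degree `0`. -/
def comp₀ (C : DGCat.{v, u} k) {a b c : C.Obj} (g : C.Hom b c 0) (f : C.Hom a b 0) :
    C.Hom a c 0 :=
  C.comp (add_zero 0) g f

/-- `f` is a closed morphism of degree `0`. -/
def IsClosed₀ (C : DGCat.{v, u} k) {a b : C.Obj} (f : C.Hom a b 0) : Prop :=
  C.d 0 1 (zero_add 1) f = 0

/-- The boundary of a morphism of degree `-1`. -/
def bd (C : DGCat.{v, u} k) {a b : C.Obj} (η : C.Hom a b (-1)) : C.Hom a b 0 :=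
  C.d (-1) 0 (by norm_num) η

theorem closed_id (C : DGCat.{v, u} k) (a : C.Obj) : C.IsClosed₀ (C.id a) := by
  unfold IsClosed₀
  have h := C.d_comp (add_zero 0) (zero_add 1) (zero_add 1) (zero_add 1) (by norm_num)
    (by norm_num) (C.id a) (C.id a)
  rw [C.id_comp, C.comp_id, C.id_comp, sg_zero, one_smul] at h
  simpa using h

/-- The full dg-subcategory on the objects satisfying `P`. -/
def full (C : DGCat.{v, u} k) (P : C.Obj → Prop) : DGCat.{v, u} k where
  Obj := {a : C.Obj // P a}
  Hom a b n := C.Hom a.1 b.1 n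
  d := C.d
  d_d := C.d_d
  id a := C.id a.1
  comp := C.comp
  id_comp := C.id_comp
  comp_id := C.comp_id
  assoc := C.assoc
  d_comp := C.d_comp

/-! ### The homotopy category -/

/-- The closed morphisms of degree `0`. -/
def cycles (C : DGCat.{v, u} k) (a b : C.Obj) : Submodule k (C.Hom a b 0) :=
  LinearMap.ker (C.d 0 1 (zero_add 1))

/-- The morphisms of degree `0` which are boundaries, among the closed ones. -/
def boundaries (C : DGCat.{v, u} k) (a b : C.Obj) : Submodule k (C.cycles a b) :=
  (LinearMap.range (C.d (a := a) (b := b) (-1) 0 (by norm_num))).comap (C.cycles a b).subtype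

/-- The objects of the homotopy category `H⁰(C)`: the objects of `C`. -/
structure H0 (C : DGCat.{v, u} k) : Type v where
  of : C.Obj

namespace H0

variable {C : DGCat.{v, u} k}

/-- The morphisms of the homotopy category: `H⁰` of the complex of morphisms. -/
abbrev HomMod (C : DGCat.{v, u} k) (a b : C.Obj) : Type u := C.cycles a b ⧸ C.boundaries a b

/-- The class of a closed morphism of degree `0`. -/
def mkHom {a b : C.Obj} (f : C.Hom a b 0) (hf : C.IsClosed₀ f) : HomMod C a b :=
  Submodule.Quotient.mk ⟨f, hf⟩

theorem mkHom_surj {a b : C.Obj} (x : HomMod C a b) :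
    ∃ (f : C.Hom a b 0) (hf : C.IsClosed₀ f), x = mkHom f hf := by
  obtain ⟨⟨f, hf⟩, rfl⟩ := Submodule.Quotient.mk_surjective _ x
  exact ⟨f, hf, rfl⟩

theorem mkHom_eq_iff {a b : C.Obj} {f g : C.Hom a b 0} (hf : C.IsClosed₀ f)
    (hg : C.IsClosed₀ g) : mkHom f hf = mkHom g hg ↔ ∃ η, f - g = C.bd η := by
  unfold mkHom
  rw [Submodule.Quotient.eq]
  constructor
  · rintro ⟨η, hη⟩
    exact ⟨η, hη.symm⟩
  · rintro ⟨η, hη⟩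
    exact ⟨η, hη.symm⟩

theorem closed_comp {a b c : C.Obj} {g : C.Hom b c 0} {f : C.Hom a b 0}
    (hg : C.IsClosed₀ g) (hf : C.IsClosed₀ f) : C.IsClosed₀ (C.comp₀ g f) := by
  unfold IsClosed₀ comp₀ at *
  rw [C.d_comp (add_zero 0) (zero_add 1) (zero_add 1) (zero_add 1) (by norm_num) (by norm_num),
    hg, hf]
  simp

theorem bd_comp {a b c : C.Obj} (η : C.Hom b c (-1)) {f : C.Hom a b 0} (hf : C.IsClosed₀ f) :
    C.comp₀ (C.bd η) f = C.bd (C.comp (add_zero (-1)) η f) := by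
  unfold IsClosed₀ at hf
  unfold bd comp₀
  rw [C.d_comp (add_zero (-1)) (p' := 0) (by norm_num) (zero_add 1) (by norm_num) (add_zero 0)
    (by norm_num), hf]
  simp

theorem comp_bd {a b c : C.Obj} {g : C.Hom b c 0} (hg : C.IsClosed₀ g) (η : C.Hom a b (-1)) :
    C.comp₀ g (C.bd η) = C.bd (C.comp (zero_add (-1)) g η) := by
  unfold IsClosed₀ at hg
  unfold bd comp₀
  rw [C.d_comp (zero_add (-1)) (q' := 0) (zero_add 1) (by norm_num) (by norm_num) (by norm_num)
    (add_zero 0), hg]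
  simp [sg_zero]

/-- Composition of cycles, as a bilinear map. -/
def cyclesComp (C : DGCat.{v, u} k) (a b c : C.Obj) :
    C.cycles a b →ₗ[k] C.cycles b c →ₗ[k] C.cycles a c :=
  LinearMap.mk₂ k (fun f g => ⟨C.comp₀ g.1 f.1, closed_comp g.2 f.2⟩)
    (by intros; ext; simp [comp₀]) (by intros; ext; simp [comp₀])
    (by intros; ext; simp [comp₀]) (by intros; ext; simp [comp₀])

/-- Composition in the homotopy category. -/
def compMod (C : DGCat.{v, u} k) (a b c : C.Obj) :
    HomMod C a b →ₗ[k] HomMod C b c →ₗ[k] HomMod C a c :=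
  (C.boundaries a b).liftQ
    { toFun := fun f => (C.boundaries b c).mapQ (C.boundaries a c) (cyclesComp C a b c f) (by
        rintro g ⟨η, hη⟩
        refine ⟨C.comp (add_zero (-1)) η f.1, ?_⟩
        have h := bd_comp η f.2
        have h' : g.1 = C.bd η := hη.symm
        change C.bd _ = C.comp₀ g.1 f.1
        rw [h', h])
      map_add' := fun f f' => by ext g; simp
      map_smul' := fun c f => by ext g; simp } (by
    rintro f ⟨η, hη⟩
    rw [LinearMap.mem_ker]
    ext g
    have h' : f.1 = C.bd η := hη.symm
    refine (Submodule.Quotient.mk_eq_zero _).mpr ⟨C.comp (zero_add (-1)) g.1 η, ?_⟩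
    change C.bd _ = C.comp₀ g.1 f.1
    rw [h', comp_bd g.2])

theorem compMod_mk {a b c : C.Obj} (f : C.Hom a b 0) (hf : C.IsClosed₀ f)
    (g : C.Hom b c 0) (hg : C.IsClosed₀ g) :
    compMod C a b c (mkHom f hf) (mkHom g hg) = mkHom (C.comp₀ g f) (closed_comp hg hf) :=
  rfl

/-- The homotopy category `H⁰(C)` of a dg-category. -/
instance : Category.{u} (H0 C) where
  Hom a b := HomMod C a.of b.of
  id a := mkHom (C.id a.of) (C.closed_id a.of)
  comp f g := compMod C _ _ _ f g
  id_comp f := by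
    obtain ⟨f, hf, rfl⟩ := mkHom_surj f
    rw [compMod_mk]
    congr 1
    exact C.comp_id _ f
  comp_id f := by
    obtain ⟨f, hf, rfl⟩ := mkHom_surj f
    rw [compMod_mk]
    congr 1
    exact C.id_comp _ f
  assoc f g h := by
    obtain ⟨f, hf, rfl⟩ := mkHom_surj f
    obtain ⟨g, hg, rfl⟩ := mkHom_surj g
    obtain ⟨h, hh, rfl⟩ := mkHom_surj h
    simp only [compMod_mk]
    congr 1
    exact (C.assoc _ _ _ _ h g f).symm

theorem compMod_add {a b c : C.Obj} (f : HomMod C a b) (g g' : HomMod C b c) :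
    compMod C a b c f (g + g') = compMod C a b c f g + compMod C a b c f g' :=
  map_add _ _ _

theorem add_compMod {a b c : C.Obj} (f f' : HomMod C a b) (g : HomMod C b c) :
    compMod C a b c (f + f') g = compMod C a b c f g + compMod C a b c f' g := by
  rw [map_add, LinearMap.add_apply]

theorem compMod_smul {a b c : C.Obj} (f : HomMod C a b) (r : k) (g : HomMod C b c) :
    compMod C a b c f (r • g) = r • compMod C a b c f g :=
  map_smul _ _ _

theorem smul_compMod {a b c : C.Obj} (r : k) (f : HomMod C a b) (g : HomMod C b c) :
    compMod C a b c (r • f) g = r • compMod C a b c f g := by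
  rw [map_smul, LinearMap.smul_apply]

instance : Preadditive (H0 C) where
  homGroup a b := inferInstanceAs (AddCommGroup (HomMod C a.of b.of))
  add_comp _ _ _ f f' g := add_compMod (C := C) f f' g
  comp_add _ _ _ f g g' := compMod_add (C := C) f g g'

instance : Linear k (H0 C) where
  homModule a b := inferInstanceAs (Module k (HomMod C a.of b.of))
  smul_comp _ _ _ r f g := smul_compMod (C := C) r f g
  comp_smul _ _ _ f r g := compMod_smul (C := C) f r g

/-- The morphism of `H⁰(C)` given by a closed morphism of degree `0`. -/
def cl {a b : H0 C} (f : C.Hom a.of b.of 0) (hf : C.IsClosed₀ f) : a ⟶ b := mkHom f hf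

theorem cl_surj {a b : H0 C} (x : a ⟶ b) :
    ∃ (f : C.Hom a.of b.of 0) (hf : C.IsClosed₀ f), x = cl f hf :=
  mkHom_surj x

theorem cl_eq_iff {a b : H0 C} {f g : C.Hom a.of b.of 0} (hf : C.IsClosed₀ f)
    (hg : C.IsClosed₀ g) : (cl f hf : a ⟶ b) = cl g hg ↔ ∃ η, f - g = C.bd η :=
  mkHom_eq_iff hf hg

theorem cl_comp {a b c : H0 C} (f : C.Hom a.of b.of 0) (hf : C.IsClosed₀ f)
    (g : C.Hom b.of c.of 0) (hg : C.IsClosed₀ g) :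
    (cl f hf : a ⟶ b) ≫ (cl g hg : b ⟶ c) = cl (C.comp₀ g f) (closed_comp hg hf) :=
  rfl

theorem cl_id (a : H0 C) : 𝟙 a = cl (C.id a.of) (C.closed_id a.of) := rfl

end H0

end DGCat

/-! ### Dg-functors -/

/-- A dg-functor between dg-categories. -/
structure DGFunctor {k : Type u} [CommRing k] (A : DGCat.{v₁, u} k) (B : DGCat.{v₂, u} k) where
  obj : A.Obj → B.Obj
  map : ∀ {a b : A.Obj} {n : ℤ}, A.Hom a b n →ₗ[k] B.Hom (obj a) (obj b) n
  map_id : ∀ a : A.Obj, map (A.id a) = B.id (obj a)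
  map_comp : ∀ {a b c : A.Obj} {p q r : ℤ} (h : p + q = r) (g : A.Hom b c p) (f : A.Hom a b q),
    map (A.comp h g f) = B.comp h (map g) (map f)
  map_d : ∀ {a b : A.Obj} (n m : ℤ) (h : n + 1 = m) (f : A.Hom a b n),
    map (A.d n m h f) = B.d n m h (map f)

namespace DGFunctor

variable {k : Type u} [CommRing k]
variable {A : DGCat.{v₁, u} k} {B : DGCat.{v₂, u} k} {C : DGCat.{v₃, u} k}

/-- The identity dg-functor. -/
def idf (A : DGCat.{v₁, u} k) : DGFunctor A A where
  obj a := a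
  map := LinearMap.id
  map_id _ := rfl
  map_comp _ _ _ := rfl
  map_d _ _ _ _ := rfl

/-- The composite dg-functor: first `F`, then `G`. -/
def comp (F : DGFunctor A B) (G : DGFunctor B C) : DGFunctor A C where
  obj a := G.obj (F.obj a)
  map := G.map ∘ₗ F.map
  map_id a := by simp [F.map_id, G.map_id]
  map_comp h g f := by simp [F.map_comp, G.map_comp]
  map_d n m h f := by simp [F.map_d, G.map_d]

/-- A family of morphisms `F a → G a` of degree `n` is dg-natural if it commutes with all
homogeneous morphisms, up to the Koszul sign. -/
def IsNat (F G : DGFunctor A B) (n : ℤ) (θ : ∀ a, B.Hom (F.obj a) (G.obj a) n) : Prop :=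
  ∀ ⦃a b : A.Obj⦄ ⦃p r : ℤ⦄ (h : n + p = r) (h' : p + n = r) (f : A.Hom a b p),
    B.comp h (θ b) (F.map f) = sg k (n * p) • B.comp h' (G.map f) (θ a)

/-- A dg-functor restricted to full dg-subcategories. -/
def restrict (F : DGFunctor A B) (P : A.Obj → Prop) (Q : B.Obj → Prop)
    (h : ∀ a, P a → Q (F.obj a)) : DGFunctor (A.full P) (B.full Q) where
  obj a := ⟨F.obj a.1, h a.1 a.2⟩
  map := F.map
  map_id a := F.map_id a.1
  map_comp := F.map_comp
  map_d := F.map_d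

theorem closed_map (F : DGFunctor A B) {a b : A.Obj} {f : A.Hom a b 0} (hf : A.IsClosed₀ f) :
    B.IsClosed₀ (F.map f) := by
  unfold DGCat.IsClosed₀ at *
  rw [← F.map_d, hf, map_zero]

theorem map_comp₀ (F : DGFunctor A B) {a b c : A.Obj} (g : A.Hom b c 0) (f : A.Hom a b 0) :
    F.map (A.comp₀ g f) = B.comp₀ (F.map g) (F.map f) :=
  F.map_comp _ g f

theorem map_bd (F : DGFunctor A B) {a b : A.Obj} (η : A.Hom a b (-1)) :
    F.map (A.bd η) = B.bd (F.map η) :=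
  F.map_d _ _ _ η

/-- The functor `H⁰(F)`. -/
def mapH0 (F : DGFunctor A B) : A.H0 ⥤ B.H0 where
  obj a := ⟨F.obj a.of⟩
  map {a b} := (A.boundaries a.of b.of).mapQ (B.boundaries (F.obj a.of) (F.obj b.of))
    (F.map.restrict (fun _ hf => F.closed_map hf)) (by
      rintro f ⟨η, hη⟩
      refine ⟨F.map η, ?_⟩
      have h' : f.1 = A.bd η := hη.symm
      change B.bd _ = F.map f.1
      rw [h', F.map_bd])
  map_id a := by
    change DGCat.H0.mkHom _ _ = DGCat.H0.mkHom _ _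
    congr 1
    exact F.map_id _
  map_comp f g := by
    obtain ⟨f, hf, rfl⟩ := DGCat.H0.cl_surj f
    obtain ⟨g, hg, rfl⟩ := DGCat.H0.cl_surj g
    change DGCat.H0.mkHom _ _ = DGCat.H0.mkHom _ _
    congr 1
    exact F.map_comp₀ g f

theorem mapH0_cl (F : DGFunctor A B) {a b : A.H0} (f : A.Hom a.of b.of 0)
    (hf : A.IsClosed₀ f) :
    F.mapH0.map (DGCat.H0.cl f hf : a ⟶ b) = DGCat.H0.cl (F.map f) (F.closed_map hf) :=
  rfl

end DGFunctor

/-- A dg-bifunctor, i.e. a dg-functor `A ⊗ B → C`, where `A ⊗ B` has the pairs as objects and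
the tensor products of complexes as morphisms; it is given by its restrictions to each variable,
which commute up to the Koszul sign. -/
structure DGBifunctor {k : Type u} [CommRing k] (A : DGCat.{v₁, u} k) (B : DGCat.{v₂, u} k)
    (C : DGCat.{v₃, u} k) where
  obj : A.Obj → B.Obj → C.Obj
  mapL : ∀ {a a' : A.Obj} {n : ℤ} (b : B.Obj),
    A.Hom a a' n →ₗ[k] C.Hom (obj a b) (obj a' b) n
  mapR : ∀ {b b' : B.Obj} {n : ℤ} (a : A.Obj),
    B.Hom b b' n →ₗ[k] C.Hom (obj a b) (obj a b') n
  mapL_id : ∀ (a : A.Obj) (b : B.Obj), mapL b (A.id a) = C.id (obj a b)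
  mapR_id : ∀ (a : A.Obj) (b : B.Obj), mapR a (B.id b) = C.id (obj a b)
  mapL_comp : ∀ {a a' a'' : A.Obj} {p q r : ℤ} (b : B.Obj) (h : p + q = r)
    (g : A.Hom a' a'' p) (f : A.Hom a a' q),
    mapL b (A.comp h g f) = C.comp h (mapL b g) (mapL b f)
  mapR_comp : ∀ {b b' b'' : B.Obj} {p q r : ℤ} (a : A.Obj) (h : p + q = r)
    (g : B.Hom b' b'' p) (f : B.Hom b b' q),
    mapR a (B.comp h g f) = C.comp h (mapR a g) (mapR a f)
  mapL_d : ∀ {a a' : A.Obj} (b : B.Obj) (n m : ℤ) (h : n + 1 = m) (f : A.Hom a a' n),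
    mapL b (A.d n m h f) = C.d n m h (mapL b f)
  mapR_d : ∀ {b b' : B.Obj} (a : A.Obj) (n m : ℤ) (h : n + 1 = m) (f : B.Hom b b' n),
    mapR a (B.d n m h f) = C.d n m h (mapR a f)
  comm : ∀ {a a' : A.Obj} {b b' : B.Obj} {p q r : ℤ} (h : p + q = r) (h' : q + p = r)
    (f : A.Hom a a' p) (g : B.Hom b b' q),
    C.comp h (mapL b' f) (mapR a g) = sg k (p * q) • C.comp h' (mapR a' g) (mapL b f)

namespace DGBifunctor

variable {k : Type u} [CommRing k]
variable {A : DGCat.{v₁, u} k} {B : DGCat.{v₂, u} k} {C : DGCat.{v₃, u} k}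

/-- The dg-functor `F(-, b)`. -/
def left (F : DGBifunctor A B C) (b : B.Obj) : DGFunctor A C where
  obj a := F.obj a b
  map := F.mapL b
  map_id a := F.mapL_id a b
  map_comp h g f := F.mapL_comp b h g f
  map_d n m h f := F.mapL_d b n m h f

/-- The dg-functor `F(a, -)`. -/
def right (F : DGBifunctor A B C) (a : A.Obj) : DGFunctor B C where
  obj b := F.obj a b
  map := F.mapR a
  map_id b := F.mapR_id a b
  map_comp h g f := F.mapR_comp a h g f
  map_d n m h f := F.mapR_d a n m h f

end DGBifunctor

/-! ### Dg-modules -/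

/-- A right dg-module over `T`, i.e. a dg-functor `Tᵒᵖ → C(k)`. Here `X a` is the complex attached
to the object `a`, and `act h x f` is the right action `x · f` of a morphism `f : a ⟶ b` on an
element `x` of `X b`. -/
structure RMod {k : Type u} [CommRing k] (T : DGCat.{u, u} k) where
  X : T.Obj → ℤ → Type u
  [addCommGroup : ∀ a n, AddCommGroup (X a n)]
  [module : ∀ a n, Module k (X a n)]
  d : ∀ {a : T.Obj} (n m : ℤ), n + 1 = m → (X a n →ₗ[k] X a m)
  d_d : ∀ {a : T.Obj} (n m l : ℤ) (h : n + 1 = m) (h' : m + 1 = l) (x : X a n),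
    d m l h' (d n m h x) = 0
  act : ∀ {a b : T.Obj} {p q r : ℤ}, p + q = r → (X b p →ₗ[k] T.Hom a b q →ₗ[k] X a r)
  act_id : ∀ {a : T.Obj} {n : ℤ} (h : n + 0 = n) (x : X a n), act h x (T.id a) = x
  act_comp : ∀ {a b c : T.Obj} {p q r pq qr s : ℤ} (h₁ : p + q = pq) (h₂ : pq + r = s)
    (h₃ : q + r = qr) (h₄ : p + qr = s) (x : X c p) (g : T.Hom b c q) (f : T.Hom a b r),
    act h₂ (act h₁ x g) f = act h₄ x (T.comp h₃ g f)
  d_act : ∀ {a b : T.Obj} {p q r p' q' r' : ℤ} (h : p + q = r) (hp : p + 1 = p')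
    (hq : q + 1 = q') (hr : r + 1 = r') (h₁ : p' + q = r') (h₂ : p + q' = r')
    (x : X b p) (f : T.Hom a b q),
    d r r' hr (act h x f) = act h₁ (d p p' hp x) f + sg k p • act h₂ x (T.d q q' hq f)

attribute [instance] RMod.addCommGroup RMod.module

namespace RMod

variable {k : Type u} [CommRing k] {T : DGCat.{u, u} k}

/-- The pairs `(i, j)` with `n + i = j`. -/
abbrev DegIdx (n : ℤ) : Type := {p : ℤ × ℤ // n + p.1 = p.2}

/-- The morphisms of degree `n` between right dg-modules: families of `k`-linear maps of degree
`n` which commute with the right action of `T`. -/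
def homSub (M N : RMod T) (n : ℤ) :
    Submodule k (∀ (a : T.Obj) (s : DegIdx n), M.X a s.1.1 →ₗ[k] N.X a s.1.2) where
  carrier := {φ | ∀ (a b : T.Obj) (i j q r s : ℤ) (h : n + i = j) (h₁ : i + q = r)
    (h₂ : n + r = s) (h₃ : j + q = s) (x : M.X b i) (f : T.Hom a b q),
    φ a ⟨(r, s), h₂⟩ (M.act h₁ x f) = N.act h₃ (φ b ⟨(i, j), h⟩ x) f}
  add_mem' hφ hψ a b i j q r s h h₁ h₂ h₃ x f := by
    simp only [Pi.add_apply, LinearMap.add_apply, map_add]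
    rw [hφ a b i j q r s h h₁ h₂ h₃, hψ a b i j q r s h h₁ h₂ h₃]
  zero_mem' a b i j q r s h h₁ h₂ h₃ x f := by simp
  smul_mem' c φ hφ a b i j q r s h h₁ h₂ h₃ x f := by
    simp only [Pi.smul_apply, LinearMap.smul_apply, map_smul]
    rw [hφ a b i j q r s h h₁ h₂ h₃]

/-- The component `M(a)ⁱ → N(a)ʲ` of a morphism of degree `n = j - i`. -/
def app {M N : RMod T} {n : ℤ} (φ : homSub M N n) (a : T.Obj) (i j : ℤ) (h : n + i = j) :
    M.X a i →ₗ[k] N.X a j :=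
  φ.1 a ⟨(i, j), h⟩

theorem app_add {M N : RMod T} {n : ℤ} (φ ψ : homSub M N n) (a : T.Obj) (i j : ℤ)
    (h : n + i = j) (x : M.X a i) : app (φ + ψ) a i j h x = app φ a i j h x + app ψ a i j h x :=
  rfl

theorem app_smul {M N : RMod T} {n : ℤ} (c : k) (φ : homSub M N n) (a : T.Obj) (i j : ℤ)
    (h : n + i = j) (x : M.X a i) : app (c • φ) a i j h x = c • app φ a i j h x :=
  rfl

theorem app_zero {M N : RMod T} {n : ℤ} (a : T.Obj) (i j : ℤ) (h : n + i = j) (x : M.X a i) :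
    app (0 : homSub M N n) a i j h x = 0 :=
  rfl

theorem app_act {M N : RMod T} {n : ℤ} (φ : homSub M N n) (a b : T.Obj) (i j q r s : ℤ)
    (h : n + i = j) (h₁ : i + q = r) (h₂ : n + r = s) (h₃ : j + q = s) (x : M.X b i)
    (f : T.Hom a b q) :
    app φ a r s h₂ (M.act h₁ x f) = N.act h₃ (app φ b i j h x) f :=
  φ.2 a b i j q r s h h₁ h₂ h₃ x f

/-- The differential of the complex of morphisms: `φ ↦ d ∘ φ - (-1)ⁿ φ ∘ d`. -/
def homD (M N : RMod T) (n m : ℤ) (h : n + 1 = m) : homSub M N n →ₗ[k] homSub M N m where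
  toFun φ := ⟨fun a s =>
      N.d (s.1.2 - 1) s.1.2 (by omega) ∘ₗ app φ a s.1.1 (s.1.2 - 1) (by have := s.2; omega) -
        sg k n • (app φ a (s.1.1 + 1) s.1.2 (by have := s.2; omega) ∘ₗ
          M.d s.1.1 (s.1.1 + 1) rfl), by
    intro a b i j q r s h' h₁ h₂ h₃ x f
    simp only [LinearMap.sub_apply, LinearMap.comp_apply, LinearMap.smul_apply, map_sub, map_smul]
    rw [app_act φ a b i (j - 1) q r (s - 1) (by omega) h₁ (by omega) (by omega) x f,
      M.d_act h₁ rfl (q' := q + 1) rfl rfl (by omega) (by omega),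
      N.d_act (by omega) (by omega) (q' := q + 1) rfl (by omega) h₃ (by omega), map_add,
      app_act φ a b (i + 1) j q (r + 1) s (by omega) (by omega) (by omega) h₃, map_smul,
      app_act φ a b i (j - 1) (q + 1) (r + 1) s (by omega) (by omega) (by omega) (by omega)]
    have hs : sg k (j - 1) = sg k n * sg k i := by rw [← sg_add]; congr 1; omega
    rw [hs]
    simp only [smul_add, smul_smul]
    abel⟩
  map_add' φ ψ := by
    ext a s x
    simp [app_add, smul_add]
    abel
  map_smul' c φ := by
    ext a s x
    simp [app_smul, smul_sub, smul_smul, mul_comm]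

theorem homD_apply (M N : RMod T) {n m : ℤ} (h : n + 1 = m) (φ : homSub M N n) (a : T.Obj)
    (i j i' l : ℤ) (hj : m + i = j) (hi : i + 1 = i') (hl : n + i = l) (hlj : l + 1 = j)
    (hi' : n + i' = j) (x : M.X a i) :
    app (homD M N n m h φ) a i j hj x =
      N.d l j hlj (app φ a i l hl x) - sg k n • app φ a i' j hi' (M.d i i' hi x) := by
  obtain rfl : l = j - 1 := by omega
  subst hi
  rfl

/-- The composite `ψ ∘ φ` of morphisms of right dg-modules. -/
def homComp (M N L : RMod T) {p q r : ℤ} (h : p + q = r) :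
    homSub N L p →ₗ[k] homSub M N q →ₗ[k] homSub M L r :=
  LinearMap.mk₂ k
    (fun ψ φ => ⟨fun a s => app ψ a (q + s.1.1) s.1.2 (by have := s.2; omega) ∘ₗ
      app φ a s.1.1 (q + s.1.1) rfl, by
      intro a b i j q' r' s h' h₁ h₂ h₃ x f
      simp only [LinearMap.comp_apply]
      rw [app_act φ a b i (q + i) q' r' (q + r') rfl h₁ rfl (by omega),
        app_act ψ a b (q + i) j q' (q + r') s (by omega) (by omega) (by omega) h₃]⟩)
    (by intros; ext; simp [app_add]) (by intros; ext; simp [app_smul])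
    (by intros; ext; simp [app_add]) (by intros; ext; simp [app_smul])

theorem homComp_apply (M N L : RMod T) {p q r : ℤ} (h : p + q = r) (ψ : homSub N L p)
    (φ : homSub M N q) (a : T.Obj) (i j l : ℤ) (hj : r + i = j) (hl : q + i = l)
    (hlj : p + l = j) (x : M.X a i) :
    app (homComp M N L h ψ φ) a i j hj x = app ψ a l j hlj (app φ a i l hl x) := by
  subst hl
  rfl

/-- The identity morphism. -/
def homId (M : RMod T) : homSub M M 0 :=
  ⟨fun a s => (show s.1.1 = s.1.2 by have := s.2; omega) ▸ LinearMap.id, by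
    intro a b i j q r s h h₁ h₂ h₃ x f
    obtain rfl : i = j := by omega
    obtain rfl : r = s := by omega
    rfl⟩

theorem homId_apply (M : RMod T) (a : T.Obj) (i : ℤ) (h : 0 + i = i) (x : M.X a i) :
    app (homId M) a i i h x = x := rfl

theorem hom_ext {M N : RMod T} {n : ℤ} {φ ψ : homSub M N n}
    (h : ∀ a i j hj x, app φ a i j hj x = app ψ a i j hj x) : φ = ψ := by
  ext a ⟨⟨i, j⟩, hj⟩ x
  exact h a i j hj x

/-- The dg-category of right dg-modules over `T`. -/
@[reducible] def cat (T : DGCat.{u, u} k) : DGCat.{u + 1, u} k where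
  Obj := RMod T
  Hom M N n := homSub M N n
  d {M N} n m h := homD M N n m h
  d_d {M N} n m l h h' φ := by
    have hm : sg k m = -sg k n := by rw [← h, sg_add, sg_one]; ring
    refine hom_ext fun a i j hj x => ?_
    rw [homD_apply M N h' _ a i j (i + 1) (j - 1) hj rfl (by omega) (by omega) (by omega),
      homD_apply M N h φ a i (j - 1) (i + 1) (j - 2) (by omega) rfl (by omega) (by omega)
        (by omega),
      homD_apply M N h φ a (i + 1) j (i + 1 + 1) (j - 1) (by omega) rfl (by omega) (by omega)
        (by omega), M.d_d, map_sub, N.d_d, hm]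
    simp [app_zero]
  id M := homId M
  comp {M N L} p q r h := homComp M N L h
  id_comp {M N} n h φ := by
    refine hom_ext fun a i j hj x => ?_
    rw [homComp_apply M N N h _ _ a i j j hj (by omega) (by omega), homId_apply]
  comp_id {M N} n h φ := by
    refine hom_ext fun a i j hj x => ?_
    rw [homComp_apply M M N h _ _ a i j i hj (by omega) (by omega), homId_apply]
  assoc {M N L K} p q r pq qr s h₁ h₂ h₃ h₄ f g h := by
    refine hom_ext fun a i j hj x => ?_
    rw [homComp_apply _ _ _ h₂ _ _ a i j (r + i) hj rfl (by omega),
      homComp_apply _ _ _ h₁ _ _ a (r + i) j (q + (r + i)) (by omega) rfl (by omega),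
      homComp_apply _ _ _ h₄ _ _ a i j (q + (r + i)) hj (by omega) (by omega),
      homComp_apply _ _ _ h₃ _ _ a i (q + (r + i)) (r + i) (by omega) rfl (by omega)]
  d_comp {M N L} p q r p' q' r' h hp hq hr h₁ h₂ g f := by
    have hr' : sg k r = sg k p * sg k q := by rw [← h, sg_add]
    refine hom_ext fun a i j hj x => ?_
    rw [homD_apply _ _ hr _ a i j (i + 1) (j - 1) hj rfl (by omega) (by omega) (by omega),
      homComp_apply _ _ _ h _ _ a i (j - 1) (q + i) (by omega) rfl (by omega),
      homComp_apply _ _ _ h _ _ a (i + 1) j (q + i + 1) (by omega) (by omega) (by omega)]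
    rw [app_add, app_smul, homComp_apply _ _ _ h₁ _ _ a i j (q + i) hj rfl (by omega),
      homComp_apply _ _ _ h₂ _ _ a i j (q + i + 1) hj (by omega) (by omega),
      homD_apply _ _ hp g a (q + i) j (q + i + 1) (j - 1) (by omega) rfl (by omega) (by omega)
        (by omega),
      homD_apply _ _ hq f a i (q + i + 1) (i + 1) (q + i) (by omega) rfl (by omega) (by omega)
        (by omega), map_sub, map_smul, hr', smul_sub, smul_smul]
    abel

/-- The representable module `h_a = T(-, a)`. -/
@[reducible] def repr (a : T.Obj) : RMod T where
  X b n := T.Hom b a n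
  d := T.d
  d_d := T.d_d
  act h := T.comp h
  act_id := T.comp_id
  act_comp := T.assoc
  d_act := T.d_comp

end RMod

/-- A dg-bimodule (a `1`-fold dg-bimodule) over `T`: a dg-module over `T ⊗ Tᵒᵖ`, i.e. a dg-functor
from `T` to right dg-modules over `T`. -/
abbrev DGBimod {k : Type u} [CommRing k] (T : DGCat.{u, u} k) := DGFunctor T (RMod.cat T)

/-- A `2`-fold dg-bimodule over `T`: a dg-module over `T ⊗ T ⊗ Tᵒᵖ`, i.e. a dg-functor
from `T ⊗ T` to right dg-modules over `T`. -/
abbrev DGBimod₂ {k : Type u} [CommRing k] (T : DGCat.{u, u} k) := DGBifunctor T T (RMod.cat T)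

/-- The identity bimodule `(a, b) ↦ T(b, a)`, i.e. the Yoneda embedding. -/
def DGBimod.one {k : Type u} [CommRing k] (T : DGCat.{u, u} k) : DGBimod T where
  obj a := RMod.repr a
  map {a b} n :=
    { toFun := fun f => ⟨fun c s => T.comp s.2 f, fun _ _ _ _ _ _ _ h h₁ h₂ h₃ x g =>
        (T.assoc h h₃ h₁ h₂ f x g).symm⟩
      map_add' := fun f g => by ext; simp
      map_smul' := fun r f => by ext; simp }
  map_id a := by
    refine RMod.hom_ext fun c i j h x => ?_
    obtain rfl : i = j := by omega
    exact T.id_comp _ x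
  map_comp {a b c p q r} h g f := by
    refine RMod.hom_ext fun e i j hj x => ?_
    refine Eq.trans ?_ (RMod.homComp_apply _ _ _ h _ _ e i j (q + i) hj rfl (by omega) x).symm
    exact T.assoc _ _ _ _ g f x
  map_d {a b} n m h f := by
    refine RMod.hom_ext fun e i j hj x => ?_
    refine Eq.trans ?_ (RMod.homD_apply _ _ h _ e i j (i + 1) (j - 1) hj rfl (by omega) (by omega)
      (by omega) x).symm
    have h' := T.d_comp (p := n) (q := i) (r := j - 1) (by omega) h rfl (by omega) hj
      (by omega) f x
    exact eq_sub_of_add_eq h'.symm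

/-! ### The tensor product over `T` -/

namespace RMod

open scoped TensorProduct

variable {k : Type u} [CommRing k] {T : DGCat.{u, u} k}

/-- Indices `(t, i, j)` with `i + j = n`. -/
abbrev TIdx (T : DGCat.{u, u} k) (n : ℤ) : Type u :=
  {s : T.Obj × ℤ × ℤ // s.2.1 + s.2.2 = n}

/-- The degree `n` part of `⨁ₜ X(t) ⊗ₖ Φ(t)(z)`. -/
abbrev PreTens (X : RMod T) (Φ : DGBimod T) (z : T.Obj) (n : ℤ) : Type u :=
  DirectSum (TIdx T n) fun s => X.X s.1.1 s.1.2.1 ⊗[k] (Φ.obj s.1.1).X z s.1.2.2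

open Classical in
/-- The element `x ⊗ γ` of `⨁ₜ X(t) ⊗ₖ Φ(t)(z)`. -/
noncomputable def preMk (X : RMod T) (Φ : DGBimod T) {z : T.Obj} {n : ℤ} (t : T.Obj) (i j : ℤ)
    (h : i + j = n) : X.X t i →ₗ[k] (Φ.obj t).X z j →ₗ[k] PreTens X Φ z n :=
  (TensorProduct.mk k _ _).compr₂
    (DirectSum.lof k (TIdx T n) (fun s => X.X s.1.1 s.1.2.1 ⊗[k] (Φ.obj s.1.1).X z s.1.2.2)
      ⟨(t, i, j), h⟩)

/-- The relations `x · f ⊗ γ = x ⊗ f · γ`. -/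
def tensRel (X : RMod T) (Φ : DGBimod T) (z : T.Obj) (n : ℤ) : Submodule k (PreTens X Φ z n) :=
  Submodule.span k {w | ∃ (a b : T.Obj) (i q j r l : ℤ) (h₁ : i + q = r) (h₂ : q + j = l)
    (h₃ : r + j = n) (h₄ : i + l = n) (x : X.X b i) (f : T.Hom a b q) (γ : (Φ.obj a).X z j),
    w = preMk X Φ a r j h₃ (X.act h₁ x f) γ -
      preMk X Φ b i l h₄ x (app (Φ.map f) z j l h₂ γ)}

/-- The degree `n` part of the value at `z` of the tensor product of `X` and `Φ` over `T`: the
cokernel of `⨁ X(b) ⊗ T(a, b) ⊗ Φ(a)(z) → ⨁ X(t) ⊗ Φ(t)(z)`. -/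
abbrev TensX (X : RMod T) (Φ : DGBimod T) (z : T.Obj) (n : ℤ) : Type u :=
  PreTens X Φ z n ⧸ tensRel X Φ z n

/-- The element `x ⊗ γ` of the tensor product over `T`. -/
noncomputable def tmk (X : RMod T) (Φ : DGBimod T) {z : T.Obj} {n : ℤ} (t : T.Obj) (i j : ℤ)
    (h : i + j = n) : X.X t i →ₗ[k] (Φ.obj t).X z j →ₗ[k] TensX X Φ z n :=
  (preMk X Φ t i j h).compr₂ (tensRel X Φ z n).mkQ

theorem tmk_act (X : RMod T) (Φ : DGBimod T) {z : T.Obj} {n : ℤ} {a b : T.Obj} {i q j r l : ℤ}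
    (h₁ : i + q = r) (h₂ : q + j = l) (h₃ : r + j = n) (h₄ : i + l = n) (x : X.X b i)
    (f : T.Hom a b q) (γ : (Φ.obj a).X z j) :
    tmk X Φ a r j h₃ (X.act h₁ x f) γ = tmk X Φ b i l h₄ x (app (Φ.map f) z j l h₂ γ) :=
  (Submodule.Quotient.eq _).mpr
    (Submodule.subset_span ⟨a, b, i, q, j, r, l, h₁, h₂, h₃, h₄, x, f, γ, rfl⟩)

theorem tens_ext {X : RMod T} {Φ : DGBimod T} {z : T.Obj} {n : ℤ} {W : Type*} [AddCommGroup W]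
    [Module k W] {F G : TensX X Φ z n →ₗ[k] W}
    (H : ∀ t i j h x γ, F (tmk X Φ t i j h x γ) = G (tmk X Φ t i j h x γ)) : F = G := by
  classical
  refine Submodule.linearMap_qext _ (DirectSum.linearMap_ext _ fun s => ?_)
  obtain ⟨⟨t, i, j⟩, h⟩ := s
  refine TensorProduct.ext' fun x γ => ?_
  exact H t i j h x γ

open Classical in
/-- Linear maps out of the tensor product over `T` are balanced bilinear maps. -/
noncomputable def tensLift (X : RMod T) (Φ : DGBimod T) {z : T.Obj} {n : ℤ} {W : Type u}
    [AddCommGroup W] [Module k W]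
    (β : ∀ (t : T.Obj) (i j : ℤ), i + j = n → (X.X t i →ₗ[k] (Φ.obj t).X z j →ₗ[k] W))
    (hβ : ∀ (a b : T.Obj) (i q j r l : ℤ) (h₁ : i + q = r) (h₂ : q + j = l) (h₃ : r + j = n)
      (h₄ : i + l = n) (x : X.X b i) (f : T.Hom a b q) (γ : (Φ.obj a).X z j),
      β a r j h₃ (X.act h₁ x f) γ = β b i l h₄ x (app (Φ.map f) z j l h₂ γ)) :
    TensX X Φ z n →ₗ[k] W :=
  (tensRel X Φ z n).liftQ
    (DirectSum.toModule k (TIdx T n) W fun s => TensorProduct.lift (β s.1.1 s.1.2.1 s.1.2.2 s.2))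
    (by
      refine Submodule.span_le.mpr ?_
      rintro _ ⟨a, b, i, q, j, r, l, h₁, h₂, h₃, h₄, x, f, γ, rfl⟩
      simpa [preMk, sub_eq_zero] using hβ a b i q j r l h₁ h₂ h₃ h₄ x f γ)

theorem tensLift_tmk (X : RMod T) (Φ : DGBimod T) {z : T.Obj} {n : ℤ} {W : Type u}
    [AddCommGroup W] [Module k W]
    (β : ∀ (t : T.Obj) (i j : ℤ), i + j = n → (X.X t i →ₗ[k] (Φ.obj t).X z j →ₗ[k] W))
    (hβ) (t : T.Obj) (i j : ℤ) (h : i + j = n) (x : X.X t i) (γ : (Φ.obj t).X z j) :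
    tensLift X Φ β hβ (tmk X Φ t i j h x γ) = β t i j h x γ := by
  classical
  change DirectSum.toModule k (TIdx T n) W
    (fun s => TensorProduct.lift (β s.1.1 s.1.2.1 s.1.2.2 s.2))
    (DirectSum.lof k (TIdx T n) _ ⟨(t, i, j), h⟩ (x ⊗ₜ γ)) = _
  rw [DirectSum.toModule_lof, TensorProduct.lift.tmul]

theorem app_d {M N : RMod T} {n m : ℤ} (h : n + 1 = m) (φ : homSub M N n) (a : T.Obj)
    (i i' l j : ℤ) (hi : i + 1 = i') (hl : n + i = l) (hlj : l + 1 = j) (hi' : n + i' = j)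
    (hj : m + i = j) (x : M.X a i) :
    N.d l j hlj (app φ a i l hl x) =
      app (homD M N n m h φ) a i j hj x + sg k n • app φ a i' j hi' (M.d i i' hi x) := by
  rw [homD_apply M N h φ a i j i' l hj hi hl hlj hi']
  abel

theorem app_map_d (Φ : DGBimod T) {a b : T.Obj} {q q' : ℤ} (h : q + 1 = q') (f : T.Hom a b q)
    (z : T.Obj) (i i' l j : ℤ) (hi : i + 1 = i') (hl : q + i = l) (hlj : l + 1 = j)
    (hi' : q + i' = j) (hj : q' + i = j) (x : (Φ.obj a).X z i) :
    (Φ.obj b).d l j hlj (app (Φ.map f) z i l hl x) =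
      app (Φ.map (T.d q q' h f)) z i j hj x +
        sg k q • app (Φ.map f) z i' j hi' ((Φ.obj a).d i i' hi x) := by
  rw [Φ.map_d, app_d h (Φ.map f) z i i' l j hi hl hlj hi' hj]

/-- The differential `x ⊗ γ ↦ dx ⊗ γ + (-1)^|x| x ⊗ dγ`. -/
noncomputable def tensD (X : RMod T) (Φ : DGBimod T) {z : T.Obj} (n m : ℤ) (h : n + 1 = m) :
    TensX X Φ z n →ₗ[k] TensX X Φ z m :=
  tensLift X Φ
    (fun t i j hij => (tmk X Φ t (i + 1) j (by omega)) ∘ₗ X.d i (i + 1) rfl +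
      sg k i • (tmk X Φ t i (j + 1) (by omega)).compl₂ ((Φ.obj t).d j (j + 1) rfl))
    (by
      intro a b i q j r l h₁ h₂ h₃ h₄ x f γ
      simp only [LinearMap.add_apply, LinearMap.comp_apply, LinearMap.smul_apply,
        LinearMap.compl₂_apply]
      rw [X.d_act h₁ rfl rfl rfl (by omega) (by omega),
        app_map_d Φ (q' := q + 1) rfl f z j (j + 1) l (l + 1) rfl (by omega) rfl (by omega)
          (by omega), map_add, LinearMap.add_apply, map_smul, LinearMap.smul_apply, map_add,
        map_smul, tmk_act X Φ (l := l) (by omega) (by omega) (by omega) (by omega),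
        tmk_act X Φ (l := l + 1) (by omega) (by omega) (by omega) (by omega),
        tmk_act X Φ (l := l + 1) (by omega) (by omega) (by omega) (by omega),
        smul_add, smul_smul, ← sg_add, h₁]
      abel)

theorem tensD_tmk (X : RMod T) (Φ : DGBimod T) {z : T.Obj} {n m : ℤ} (h : n + 1 = m)
    (t : T.Obj) (i j i' j' : ℤ) (hij : i + j = n) (hi : i + 1 = i') (hj : j + 1 = j')
    (h₁ : i' + j = m) (h₂ : i + j' = m) (x : X.X t i) (γ : (Φ.obj t).X z j) :
    tensD X Φ n m h (tmk X Φ t i j hij x γ) =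
      tmk X Φ t i' j h₁ (X.d i i' hi x) γ +
        sg k i • tmk X Φ t i j' h₂ x ((Φ.obj t).d j j' hj γ) := by
  subst hi hj
  rw [tensD, tensLift_tmk]
  rfl

/-- The right action `(x ⊗ γ) · f = x ⊗ γ · f`. -/
noncomputable def tensAct (X : RMod T) (Φ : DGBimod T) {a b : T.Obj} {p q r : ℤ} (h : p + q = r) :
    TensX X Φ b p →ₗ[k] T.Hom a b q →ₗ[k] TensX X Φ a r :=
  tensLift X Φ
    (fun t i j hij => LinearMap.mk₂ k (fun x γ =>
        (tmk X Φ t i (j + q) (by omega) x) ∘ₗ ((Φ.obj t).act rfl γ))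
      (by intros; ext; simp) (by intros; ext; simp) (by intros; ext; simp)
      (by intros; ext; simp))
    (by
      intro c e i s j r' l h₁ h₂ h₃ h₄ x f γ
      ext g
      simp only [LinearMap.mk₂_apply, LinearMap.comp_apply]
      rw [tmk_act X Φ (l := l + q) (by omega) (by omega) (by omega) (by omega),
        app_act (Φ.map f) a b j l q (j + q) (l + q) (by omega) rfl (by omega) rfl])

theorem tensAct_tmk (X : RMod T) (Φ : DGBimod T) {a b : T.Obj} {p q r : ℤ} (h : p + q = r)
    (t : T.Obj) (i j l : ℤ) (hij : i + j = p) (hl : j + q = l) (hil : i + l = r)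
    (x : X.X t i) (γ : (Φ.obj t).X b j) (f : T.Hom a b q) :
    tensAct X Φ h (tmk X Φ t i j hij x γ) f = tmk X Φ t i l hil x ((Φ.obj t).act hl γ f) := by
  subst hl
  rw [tensAct, tensLift_tmk]
  rfl

/-- Two families of linear maps on the elements `x ⊗ γ` agree. -/
theorem tens_ind {X : RMod T} {Φ : DGBimod T} {z : T.Obj} {n : ℤ} {W : Type*} [AddCommGroup W]
    [Module k W] (F G : TensX X Φ z n →ₗ[k] W) (w : TensX X Φ z n)
    (H : ∀ t i j h x γ, F (tmk X Φ t i j h x γ) = G (tmk X Φ t i j h x γ)) : F w = G w := by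
  rw [tens_ext H]

/-- The tensor product over `T` of the right module `X` and the bimodule `Φ`. -/
noncomputable def tens (X : RMod T) (Φ : DGBimod T) : RMod T where
  X := TensX X Φ
  d := tensD X Φ
  d_d {a} n m l h h' w := by
    refine tens_ind (tensD X Φ m l h' ∘ₗ tensD X Φ n m h) 0 w fun t i j hij x γ => ?_
    rw [LinearMap.comp_apply, tensD_tmk X Φ h t i j (i + 1) (j + 1) hij rfl rfl (by omega)
      (by omega), map_add, map_smul,
      tensD_tmk X Φ h' t (i + 1) j (i + 1 + 1) (j + 1) (by omega) rfl rfl (by omega) (by omega),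
      tensD_tmk X Φ h' t i (j + 1) (i + 1) (j + 1 + 1) (by omega) rfl rfl (by omega) (by omega),
      X.d_d, (Φ.obj t).d_d, sg_add, sg_one]
    simp
  act h := tensAct X Φ h
  act_id {a} n h w := by
    refine tens_ind ((tensAct X Φ h).flip (T.id a)) LinearMap.id w fun t i j hij x γ => ?_
    rw [LinearMap.flip_apply, tensAct_tmk X Φ h t i j j hij (by omega) hij, (Φ.obj t).act_id]
    rfl
  act_comp {a b c} p q r pq qr s h₁ h₂ h₃ h₄ w g f := by
    refine tens_ind ((tensAct X Φ h₂).flip f ∘ₗ (tensAct X Φ h₁).flip g)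
      ((tensAct X Φ h₄).flip (T.comp h₃ g f)) w fun t i j hij x γ => ?_
    simp only [LinearMap.comp_apply, LinearMap.flip_apply]
    rw [tensAct_tmk X Φ h₁ t i j (j + q) hij rfl (by omega),
      tensAct_tmk X Φ h₂ t i (j + q) (j + q + r) (by omega) rfl (by omega),
      tensAct_tmk X Φ h₄ t i j (j + q + r) (by omega) (by omega) (by omega),
      (Φ.obj t).act_comp rfl rfl h₃ (by omega)]
  d_act {a b} p q r p' q' r' h hp hq hr h₁ h₂ w f := by
    refine tens_ind (tensD X Φ r r' hr ∘ₗ (tensAct X Φ h).flip f)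
      ((tensAct X Φ h₁).flip f ∘ₗ tensD X Φ p p' hp +
        sg k p • (tensAct X Φ h₂).flip (T.d q q' hq f)) w fun t i j hij x γ => ?_
    simp only [LinearMap.comp_apply, LinearMap.flip_apply, LinearMap.add_apply,
      LinearMap.smul_apply]
    rw [tensAct_tmk X Φ h t i j (j + q) hij rfl (by omega),
      tensD_tmk X Φ hr t i (j + q) (i + 1) (j + q + 1) (by omega) rfl rfl (by omega) (by omega),
      tensD_tmk X Φ hp t i j (i + 1) (j + 1) (by omega) rfl rfl (by omega) (by omega),
      map_add, LinearMap.add_apply, map_smul, LinearMap.smul_apply,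
      tensAct_tmk X Φ h₁ t (i + 1) j (j + q) (by omega) rfl (by omega),
      tensAct_tmk X Φ h₁ t i (j + 1) (j + q + 1) (by omega) (by omega) (by omega),
      tensAct_tmk X Φ h₂ t i j (j + q + 1) (by omega) (by omega) (by omega),
      (Φ.obj t).d_act rfl rfl hq rfl (by omega) (by omega), map_add, map_smul, smul_add,
      smul_smul, ← sg_add, hij]
    abel

/-- The element `x ⊗ γ` of the tensor product, as a bilinear map. -/
noncomputable def el (X : RMod T) (Φ : DGBimod T) {z : T.Obj} {n : ℤ} (t : T.Obj) (i j : ℤ)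
    (h : i + j = n) : X.X t i →ₗ[k] (Φ.obj t).X z j →ₗ[k] (tens X Φ).X z n :=
  tmk X Φ t i j h

theorem el_act (X : RMod T) (Φ : DGBimod T) {z : T.Obj} {n : ℤ} {a b : T.Obj} {i q j r l : ℤ}
    (h₁ : i + q = r) (h₂ : q + j = l) (h₃ : r + j = n) (h₄ : i + l = n) (x : X.X b i)
    (f : T.Hom a b q) (γ : (Φ.obj a).X z j) :
    el X Φ a r j h₃ (X.act h₁ x f) γ = el X Φ b i l h₄ x (app (Φ.map f) z j l h₂ γ) :=
  tmk_act X Φ h₁ h₂ h₃ h₄ x f γ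

theorem d_el (X : RMod T) (Φ : DGBimod T) {z : T.Obj} {n m : ℤ} (h : n + 1 = m)
    (t : T.Obj) (i j i' j' : ℤ) (hij : i + j = n) (hi : i + 1 = i') (hj : j + 1 = j')
    (h₁ : i' + j = m) (h₂ : i + j' = m) (x : X.X t i) (γ : (Φ.obj t).X z j) :
    (tens X Φ).d n m h (el X Φ t i j hij x γ) =
      el X Φ t i' j h₁ (X.d i i' hi x) γ +
        sg k i • el X Φ t i j' h₂ x ((Φ.obj t).d j j' hj γ) :=
  tensD_tmk X Φ h t i j i' j' hij hi hj h₁ h₂ x γ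

theorem act_el (X : RMod T) (Φ : DGBimod T) {a b : T.Obj} {p q r : ℤ} (h : p + q = r)
    (t : T.Obj) (i j l : ℤ) (hij : i + j = p) (hl : j + q = l) (hil : i + l = r)
    (x : X.X t i) (γ : (Φ.obj t).X b j) (f : T.Hom a b q) :
    (tens X Φ).act h (el X Φ t i j hij x γ) f = el X Φ t i l hil x ((Φ.obj t).act hl γ f) :=
  tensAct_tmk X Φ h t i j l hij hl hil x γ f

/-- Two linear maps on a tensor product agree if they agree on the elements `x ⊗ γ`. -/
theorem el_ind {X : RMod T} {Φ : DGBimod T} {z : T.Obj} {n : ℤ} {W : Type*} [AddCommGroup W]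
    [Module k W] (F G : (tens X Φ).X z n →ₗ[k] W) (w : (tens X Φ).X z n)
    (H : ∀ t i j h x γ, F (el X Φ t i j h x γ) = G (el X Φ t i j h x γ)) : F w = G w :=
  tens_ind (X := X) (Φ := Φ) F G w H

/-- Two morphisms out of a tensor product agree if they agree on the elements `x ⊗ γ`. -/
theorem tens_hom_ext {X M : RMod T} {Φ : DGBimod T} {n : ℤ} {F G : homSub (tens X Φ) M n}
    (H : ∀ z p q h t i j hij x γ,
      app F z p q h (el X Φ t i j hij x γ) = app G z p q h (el X Φ t i j hij x γ)) : F = G :=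
  hom_ext fun z p q h w => el_ind (app F z p q h) (app G z p q h) w
    fun t i j hij x γ => H z p q h t i j hij x γ

/-- The components of `x ⊗ γ ↦ φ(x) ⊗ γ`. -/
noncomputable def tensMapLX {X Y : RMod T} (Φ : DGBimod T) {n : ℤ} (φ : homSub X Y n)
    (z : T.Obj) (p q : ℤ) (h : n + p = q) : TensX X Φ z p →ₗ[k] TensX Y Φ z q :=
  tensLift X Φ
    (fun t i j hij => (tmk Y Φ t (n + i) j (by omega)) ∘ₗ app φ t i (n + i) rfl)
    (by
      intro a b i s j r l h₁ h₂ h₃ h₄ x f γ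
      simp only [LinearMap.comp_apply]
      rw [app_act φ a b i (n + i) s r (n + r) rfl h₁ rfl (by omega), tmk_act])

theorem tensMapLX_tmk {X Y : RMod T} (Φ : DGBimod T) {n : ℤ} (φ : homSub X Y n)
    (z : T.Obj) (p q : ℤ) (h : n + p = q) (t : T.Obj) (i j l : ℤ) (hij : i + j = p)
    (hl : n + i = l) (hlj : l + j = q) (x : X.X t i) (γ : (Φ.obj t).X z j) :
    tensMapLX Φ φ z p q h (tmk X Φ t i j hij x γ) =
      tmk Y Φ t l j hlj (app φ t i l hl x) γ := by
  subst hl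
  rw [tensMapLX, tensLift_tmk]
  rfl

/-- `φ ⊗ Φ`: the morphism `x ⊗ γ ↦ φ(x) ⊗ γ`. -/
noncomputable def tensMapL {X Y : RMod T} (Φ : DGBimod T) {n : ℤ} :
    homSub X Y n →ₗ[k] homSub (tens X Φ) (tens Y Φ) n where
  toFun φ := ⟨fun z s => tensMapLX Φ φ z s.1.1 s.1.2 s.2, by
      intro a b i j q r s h h₁ h₂ h₃ w f
      refine tens_ind (tensMapLX Φ φ a r s h₂ ∘ₗ (tensAct X Φ h₁).flip f)
        ((tensAct Y Φ h₃).flip f ∘ₗ tensMapLX Φ φ b i j h) w fun t i' j' hij x γ => ?_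
      simp only [LinearMap.comp_apply, LinearMap.flip_apply]
      rw [tensAct_tmk X Φ h₁ t i' j' (j' + q) hij rfl (by omega),
        tensMapLX_tmk Φ φ a r s h₂ t i' (j' + q) (n + i') (by omega) rfl (by omega),
        tensMapLX_tmk Φ φ b i j h t i' j' (n + i') (by omega) rfl (by omega),
        tensAct_tmk Y Φ h₃ t (n + i') j' (j' + q) (by omega) rfl (by omega)]⟩
  map_add' φ ψ := by
    refine hom_ext fun a i j hj w => ?_
    refine tens_ind (tensMapLX Φ (φ + ψ) a i j hj)
      (tensMapLX Φ φ a i j hj + tensMapLX Φ ψ a i j hj) w fun t i' j' hij x γ => ?_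
    rw [LinearMap.add_apply,
      tensMapLX_tmk Φ _ a i j hj t i' j' (n + i') (by omega) rfl (by omega),
      tensMapLX_tmk Φ _ a i j hj t i' j' (n + i') (by omega) rfl (by omega),
      tensMapLX_tmk Φ _ a i j hj t i' j' (n + i') (by omega) rfl (by omega), app_add, map_add,
      LinearMap.add_apply]
  map_smul' c φ := by
    refine hom_ext fun a i j hj w => ?_
    refine tens_ind (tensMapLX Φ (c • φ) a i j hj)
      (c • tensMapLX Φ φ a i j hj) w fun t i' j' hij x γ => ?_
    rw [LinearMap.smul_apply,
      tensMapLX_tmk Φ _ a i j hj t i' j' (n + i') (by omega) rfl (by omega),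
      tensMapLX_tmk Φ _ a i j hj t i' j' (n + i') (by omega) rfl (by omega), app_smul, map_smul,
      LinearMap.smul_apply]

theorem app_tensMapL {X Y : RMod T} (Φ : DGBimod T) {n : ℤ} (φ : homSub X Y n)
    (z : T.Obj) (p q : ℤ) (h : n + p = q) (t : T.Obj) (i j l : ℤ) (hij : i + j = p)
    (hl : n + i = l) (hlj : l + j = q) (x : X.X t i) (γ : (Φ.obj t).X z j) :
    app (tensMapL Φ φ) z p q h (el X Φ t i j hij x γ) =
      el Y Φ t l j hlj (app φ t i l hl x) γ :=
  tensMapLX_tmk Φ φ z p q h t i j l hij hl hlj x γ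

/-- The dg-functor `X ↦ X ⊗ Φ` on right dg-modules. -/
noncomputable def tensFunctor (Φ : DGBimod T) : DGFunctor (cat T) (cat T) where
  obj X := tens X Φ
  map := tensMapL Φ
  map_id X := by
    refine tens_hom_ext fun z p q h t i j hij x γ => ?_
    obtain rfl : p = q := by omega
    refine (app_tensMapL Φ _ z p p h t i j i hij (by omega) hij x γ).trans ?_
    rw [homId_apply, homId_apply]
  map_comp {X Y Z} p q r h g f := by
    refine tens_hom_ext fun z s s' hs t i j hij x γ => ?_
    rw [homComp_apply _ _ _ h _ _ z s s' (q + s) hs rfl (by omega),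
      app_tensMapL Φ _ z s s' hs t i j (r + i) hij rfl (by omega),
      app_tensMapL Φ _ z s (q + s) rfl t i j (q + i) hij rfl (by omega),
      app_tensMapL Φ _ z (q + s) s' (by omega) t (q + i) j (r + i) (by omega) (by omega)
        (by omega),
      homComp_apply _ _ _ h _ _ t i (r + i) (q + i) rfl rfl (by omega)]
  map_d {X Y} n m h f := by
    refine tens_hom_ext fun z s s' hs t i j hij x γ => ?_
    rw [homD_apply _ _ h _ z s s' (s + 1) (n + s) hs rfl rfl (by omega) (by omega),
      app_tensMapL Φ _ z s s' hs t i j (m + i) hij rfl (by omega),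
      app_tensMapL Φ _ z s (n + s) rfl t i j (n + i) hij rfl (by omega),
      d_el Y Φ (by omega) t (n + i) j (m + i) (j + 1) (by omega) (by omega) rfl (by omega)
        (by omega),
      d_el X Φ rfl t i j (i + 1) (j + 1) hij rfl rfl (by omega) (by omega),
      map_add, map_smul,
      app_tensMapL Φ f z (s + 1) s' (by omega) t (i + 1) j (m + i) (by omega) (by omega)
        (by omega),
      app_tensMapL Φ f z (s + 1) s' (by omega) t i (j + 1) (n + i) (by omega) rfl (by omega),
      homD_apply _ _ h f t i (m + i) (i + 1) (n + i) rfl rfl rfl (by omega) (by omega), map_sub,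
      map_smul, LinearMap.sub_apply, LinearMap.smul_apply, sg_add, smul_add, smul_smul]
    abel

/-- The components of `x ⊗ γ ↦ (-1)^(n|x|) x ⊗ θ(γ)`. -/
noncomputable def tensMapRX (X : RMod T) {Φ Ψ : DGBimod T} {n : ℤ}
    (θ : ∀ a, (cat T).Hom (Φ.obj a) (Ψ.obj a) n) (hθ : Φ.IsNat Ψ n θ)
    (z : T.Obj) (p q : ℤ) (h : n + p = q) : TensX X Φ z p →ₗ[k] TensX X Ψ z q :=
  tensLift X Φ
    (fun t i j hij => sg k (n * i) •
      (tmk X Ψ t i (n + j) (by omega)).compl₂ (app (θ t) z j (n + j) rfl))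
    (by
      intro a b i s j r l h₁ h₂ h₃ h₄ x f γ
      simp only [LinearMap.smul_apply, LinearMap.compl₂_apply]
      have H := hθ (p := s) (r := n + s) rfl (by omega) f
      have H' : app (θ b) z l (n + l) rfl (app (Φ.map f) z j l h₂ γ) = sg k (n * s) •
          app (Ψ.map f) z (n + j) (n + l) (by omega) (app (θ a) z j (n + j) rfl γ) := by
        rw [← homComp_apply (Φ.obj a) (Φ.obj b) (Ψ.obj b) (r := n + s) rfl (θ b) (Φ.map f) z j
          (n + l) l (by omega) h₂ rfl γ,
          ← homComp_apply (Φ.obj a) (Ψ.obj a) (Ψ.obj b) (r := n + s) (by omega) (Ψ.map f) (θ a) z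
            j (n + l) (n + j) (by omega) rfl (by omega) γ, ← app_smul]
        exact congrArg (fun u => app u z j (n + l) _ γ) H
      rw [H', tmk_act X Ψ h₁ (l := n + l) (by omega) (by omega) (by omega), map_smul, smul_smul,
        ← sg_add, ← mul_add, h₁])

theorem tensMapRX_tmk (X : RMod T) {Φ Ψ : DGBimod T} {n : ℤ}
    (θ : ∀ a, (cat T).Hom (Φ.obj a) (Ψ.obj a) n) (hθ : Φ.IsNat Ψ n θ)
    (z : T.Obj) (p q : ℤ) (h : n + p = q) (t : T.Obj) (i j l : ℤ) (hij : i + j = p)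
    (hl : n + j = l) (hil : i + l = q) (x : X.X t i) (γ : (Φ.obj t).X z j) :
    tensMapRX X θ hθ z p q h (tmk X Φ t i j hij x γ) =
      sg k (n * i) • tmk X Ψ t i l hil x (app (θ t) z j l hl γ) := by
  subst hl
  rw [tensMapRX, tensLift_tmk]
  rfl

/-- `X ⊗ θ`: the morphism `x ⊗ γ ↦ (-1)^(|θ||x|) x ⊗ θ(γ)`. -/
noncomputable def tensMapR (X : RMod T) {Φ Ψ : DGBimod T} {n : ℤ}
    (θ : ∀ a, (cat T).Hom (Φ.obj a) (Ψ.obj a) n) (hθ : Φ.IsNat Ψ n θ) :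
    homSub (tens X Φ) (tens X Ψ) n :=
  ⟨fun z s => tensMapRX X θ hθ z s.1.1 s.1.2 s.2, by
      intro a b i j q r s h h₁ h₂ h₃ w f
      refine tens_ind (tensMapRX X θ hθ a r s h₂ ∘ₗ (tensAct X Φ h₁).flip f)
        ((tensAct X Ψ h₃).flip f ∘ₗ tensMapRX X θ hθ b i j h) w fun t i' j' hij x γ => ?_
      simp only [LinearMap.comp_apply, LinearMap.flip_apply]
      rw [tensAct_tmk X Φ h₁ t i' j' (j' + q) hij rfl (by omega),
        tensMapRX_tmk X θ hθ a r s h₂ t i' (j' + q) (n + j' + q) (by omega) (by omega) (by omega),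
        tensMapRX_tmk X θ hθ b i j h t i' j' (n + j') (by omega) rfl (by omega), map_smul,
        LinearMap.smul_apply,
        tensAct_tmk X Ψ h₃ t i' (n + j') (n + j' + q) (by omega) rfl (by omega),
        app_act (θ t) a b j' (n + j') q (j' + q) (n + j' + q) rfl rfl (by omega) rfl]⟩

theorem app_tensMapR (X : RMod T) {Φ Ψ : DGBimod T} {n : ℤ}
    (θ : ∀ a, (cat T).Hom (Φ.obj a) (Ψ.obj a) n) (hθ : Φ.IsNat Ψ n θ)
    (z : T.Obj) (p q : ℤ) (h : n + p = q) (t : T.Obj) (i j l : ℤ) (hij : i + j = p)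
    (hl : n + j = l) (hil : i + l = q) (x : X.X t i) (γ : (Φ.obj t).X z j) :
    app (tensMapR X θ hθ) z p q h (el X Φ t i j hij x γ) =
      sg k (n * i) • el X Ψ t i l hil x (app (θ t) z j l hl γ) :=
  tensMapRX_tmk X θ hθ z p q h t i j l hij hl hil x γ

end RMod

namespace RMod

variable {k : Type u} [CommRing k] {T : DGCat.{u, u} k}

theorem tensMapR_add (X : RMod T) {Φ Ψ : DGBimod T} {n : ℤ}
    (θ θ' κ : ∀ a, (cat T).Hom (Φ.obj a) (Ψ.obj a) n) (hθ : Φ.IsNat Ψ n θ)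
    (hθ' : Φ.IsNat Ψ n θ') (hκ : Φ.IsNat Ψ n κ) (H : ∀ a, κ a = θ a + θ' a) :
    tensMapR X κ hκ = tensMapR X θ hθ + tensMapR X θ' hθ' := by
  obtain rfl := funext H
  refine tens_hom_ext fun z s s' hs t i j hij x γ => ?_
  rw [app_add, app_tensMapR X _ _ z s s' hs t i j (n + j) hij rfl (by omega),
    app_tensMapR X _ _ z s s' hs t i j (n + j) hij rfl (by omega),
    app_tensMapR X _ _ z s s' hs t i j (n + j) hij rfl (by omega), app_add, map_add, smul_add]

theorem tensMapR_smul (X : RMod T) {Φ Ψ : DGBimod T} {n : ℤ} (c : k)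
    (θ κ : ∀ a, (cat T).Hom (Φ.obj a) (Ψ.obj a) n) (hθ : Φ.IsNat Ψ n θ)
    (hκ : Φ.IsNat Ψ n κ) (H : ∀ a, κ a = c • θ a) :
    tensMapR X κ hκ = c • tensMapR X θ hθ := by
  obtain rfl := funext H
  refine tens_hom_ext fun z s s' hs t i j hij x γ => ?_
  rw [app_smul, app_tensMapR X _ _ z s s' hs t i j (n + j) hij rfl (by omega),
    app_tensMapR X _ _ z s s' hs t i j (n + j) hij rfl (by omega), app_smul, map_smul, smul_comm]

theorem tensMapR_id (X : RMod T) (Φ : DGBimod T)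
    (κ : ∀ a, (cat T).Hom (Φ.obj a) (Φ.obj a) 0) (hκ : Φ.IsNat Φ 0 κ)
    (H : ∀ a, κ a = homId (Φ.obj a)) : tensMapR X κ hκ = homId (tens X Φ) := by
  obtain rfl := funext H
  refine tens_hom_ext fun z p q h t i j hij x γ => ?_
  obtain rfl : p = q := by omega
  rw [app_tensMapR X _ _ z p p h t i j j hij (by omega) hij, homId_apply, homId_apply, zero_mul,
    sg_zero, one_smul]

theorem tensMapR_comp (X : RMod T) {Φ Ψ Ω : DGBimod T} {p q r : ℤ} (h : p + q = r)
    (θ' : ∀ a, (cat T).Hom (Ψ.obj a) (Ω.obj a) p) (hθ' : Ψ.IsNat Ω p θ')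
    (θ : ∀ a, (cat T).Hom (Φ.obj a) (Ψ.obj a) q) (hθ : Φ.IsNat Ψ q θ)
    (κ : ∀ a, (cat T).Hom (Φ.obj a) (Ω.obj a) r) (hκ : Φ.IsNat Ω r κ)
    (H : ∀ a, κ a = homComp _ _ _ h (θ' a) (θ a)) :
    tensMapR X κ hκ = homComp _ _ _ h (tensMapR X θ' hθ') (tensMapR X θ hθ) := by
  obtain rfl := funext H
  refine tens_hom_ext fun z s s' hs t i j hij x γ => ?_
  rw [homComp_apply _ _ _ h _ _ z s s' (q + s) hs rfl (by omega),
    app_tensMapR X _ _ z s s' hs t i j (r + j) hij rfl (by omega),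
    app_tensMapR X _ _ z s (q + s) rfl t i j (q + j) hij rfl (by omega), map_smul,
    app_tensMapR X _ _ z (q + s) s' (by omega) t i (q + j) (r + j) (by omega) (by omega)
      (by omega),
    homComp_apply _ _ _ h _ _ z j (r + j) (q + j) rfl rfl (by omega), smul_smul, ← sg_add]
  congr 2
  rw [← h]
  ring

theorem tensMapR_d (X : RMod T) {Φ Ψ : DGBimod T} {n m : ℤ} (h : n + 1 = m)
    (θ : ∀ a, (cat T).Hom (Φ.obj a) (Ψ.obj a) n) (hθ : Φ.IsNat Ψ n θ)
    (κ : ∀ a, (cat T).Hom (Φ.obj a) (Ψ.obj a) m) (hκ : Φ.IsNat Ψ m κ)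
    (H : ∀ a, κ a = homD _ _ n m h (θ a)) :
    tensMapR X κ hκ = homD _ _ n m h (tensMapR X θ hθ) := by
  obtain rfl := funext H
  refine tens_hom_ext fun z s s' hs t i j hij x γ => ?_
  rw [homD_apply _ _ h _ z s s' (s + 1) (n + s) hs rfl rfl (by omega) (by omega),
    app_tensMapR X _ _ z s s' hs t i j (m + j) hij rfl (by omega),
    app_tensMapR X _ _ z s (n + s) rfl t i j (n + j) hij rfl (by omega), map_smul,
    d_el X Ψ (by omega) t i (n + j) (i + 1) (m + j) (by omega) rfl (by omega) (by omega)
      (by omega),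
    d_el X Φ rfl t i j (i + 1) (j + 1) hij rfl rfl (by omega) (by omega), map_add, map_smul,
    app_tensMapR X _ _ z (s + 1) s' (by omega) t (i + 1) j (n + j) (by omega) rfl (by omega),
    app_tensMapR X _ _ z (s + 1) s' (by omega) t i (j + 1) (m + j) (by omega) (by omega)
      (by omega),
    homD_apply _ _ h (θ t) z j (m + j) (j + 1) (n + j) rfl rfl rfl (by omega) (by omega), map_sub,
    map_smul]
  have e₁ : sg k (m * i) = sg k (n * i) * sg k i := by
    rw [← sg_add, ← h]; congr 1; ring
  have e₂ : sg k (n * (i + 1)) = sg k (n * i) * sg k n := by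
    rw [← sg_add]; congr 1; ring
  have e₃ : sg k n * (sg k (n * i) * sg k n) = sg k (n * i) := by
    rw [mul_left_comm, sg_mul_self, mul_one]
  have e₄ : sg k n * (sg k i * sg k (n * i)) = sg k (n * i) * sg k i * sg k n := by ring
  rw [e₁, e₂]
  simp only [smul_add, smul_sub, smul_smul]
  rw [e₃, e₄]
  abel

theorem tensMapL_tensMapR {X Y : RMod T} {Φ Ψ : DGBimod T} {p q r : ℤ} (h : p + q = r)
    (h' : q + p = r) (φ : homSub X Y p) (θ : ∀ a, (cat T).Hom (Φ.obj a) (Ψ.obj a) q)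
    (hθ : Φ.IsNat Ψ q θ) :
    homComp _ _ _ h (tensMapL Ψ φ) (tensMapR X θ hθ) =
      sg k (p * q) • homComp _ _ _ h' (tensMapR Y θ hθ) (tensMapL Φ φ) := by
  refine tens_hom_ext fun z s s' hs t i j hij x γ => ?_
  rw [app_smul, homComp_apply _ _ _ h _ _ z s s' (q + s) hs rfl (by omega),
    homComp_apply _ _ _ h' _ _ z s s' (p + s) hs rfl (by omega),
    app_tensMapR X _ _ z s (q + s) rfl t i j (q + j) hij rfl (by omega), map_smul,
    app_tensMapL Ψ φ z (q + s) s' (by omega) t i (q + j) (p + i) (by omega) rfl (by omega),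
    app_tensMapL Φ φ z s (p + s) rfl t i j (p + i) hij rfl (by omega),
    app_tensMapR Y _ _ z (p + s) s' (by omega) t (p + i) j (q + j) (by omega) rfl (by omega),
    smul_smul]
  congr 1
  have e : sg k (q * (p + i)) = sg k (p * q) * sg k (q * i) := by
    rw [← sg_add]; congr 1; ring
  rw [e, ← mul_assoc, sg_mul_self, one_mul]

end RMod

namespace DGBimod₂

open RMod

variable {k : Type u} [CommRing k] {T : DGCat.{u, u} k}

/-- The action of `f : a ⟶ a'` on the first left variable, as a morphism of bimodules. -/
def actL (Γ : DGBimod₂ T) {a a' : T.Obj} {n : ℤ} (f : T.Hom a a' n) (b : T.Obj) :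
    (cat T).Hom ((Γ.right a).obj b) ((Γ.right a').obj b) n :=
  Γ.mapL b f

theorem isNat_actL (Γ : DGBimod₂ T) {a a' : T.Obj} {n : ℤ} (f : T.Hom a a' n) :
    (Γ.right a).IsNat (Γ.right a') n (actL Γ f) :=
  fun _ _ _ _ h h' g => Γ.comm h h' f g

/-- The bimodule obtained by tensoring the second left variable of `Γ` with `Y`. -/
noncomputable def contract (Γ : DGBimod₂ T) (Y : RMod T) : DGBimod T where
  obj a := tens Y (Γ.right a)
  map :=
    { toFun := fun f => tensMapR Y (actL Γ f) (isNat_actL Γ f)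
      map_add' := fun f g => tensMapR_add Y _ _ _ (isNat_actL Γ f) (isNat_actL Γ g)
        (isNat_actL Γ _) fun b => map_add (Γ.mapL b) f g
      map_smul' := fun c f => tensMapR_smul Y c _ _ (isNat_actL Γ f) (isNat_actL Γ _)
        fun b => map_smul (Γ.mapL b) c f }
  map_id a := tensMapR_id Y _ _ (isNat_actL Γ _) fun b => Γ.mapL_id a b
  map_comp h g f := tensMapR_comp Y h _ (isNat_actL Γ g) _ (isNat_actL Γ f) _ (isNat_actL Γ _)
    fun b => Γ.mapL_comp b h g f
  map_d n m h f := tensMapR_d Y h _ (isNat_actL Γ f) _ (isNat_actL Γ _)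
    fun b => Γ.mapL_d b n m h f

/-- The morphism of bimodules induced by `ψ : Y → Y'`. -/
noncomputable def contractMap (Γ : DGBimod₂ T) {Y Y' : RMod T} {n : ℤ} (ψ : homSub Y Y' n)
    (a : T.Obj) : (cat T).Hom ((contract Γ Y).obj a) ((contract Γ Y').obj a) n :=
  tensMapL (Γ.right a) ψ

theorem isNat_contractMap (Γ : DGBimod₂ T) {Y Y' : RMod T} {n : ℤ} (ψ : homSub Y Y' n) :
    (contract Γ Y).IsNat (contract Γ Y') n (contractMap Γ ψ) :=
  fun _ _ _ _ h h' f => tensMapL_tensMapR h h' ψ (actL Γ f) (isNat_actL Γ f)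

/-- The dg-bifunctor `(X, Y) ↦ Γ ⊗ X ⊗ Y` on right dg-modules. -/
noncomputable def ext (Γ : DGBimod₂ T) : DGBifunctor (cat T) (cat T) (cat T) where
  obj X Y := tens X (contract Γ Y)
  mapL Y := tensMapL (contract Γ Y)
  mapR X :=
    { toFun := fun ψ => tensMapR X (contractMap Γ ψ) (isNat_contractMap Γ ψ)
      map_add' := fun f g => tensMapR_add X _ _ _ (isNat_contractMap Γ f)
        (isNat_contractMap Γ g) (isNat_contractMap Γ _) fun b => map_add (tensMapL (Γ.right b)) f g
      map_smul' := fun c f => tensMapR_smul X c _ _ (isNat_contractMap Γ f)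
        (isNat_contractMap Γ _) fun b => map_smul (tensMapL (Γ.right b)) c f }
  mapL_id X Y := (tensFunctor (contract Γ Y)).map_id X
  mapL_comp Y h g f := (tensFunctor (contract Γ Y)).map_comp h g f
  mapL_d Y n m h f := (tensFunctor (contract Γ Y)).map_d n m h f
  mapR_id X Y := tensMapR_id X _ _ (isNat_contractMap Γ _)
    fun b => (tensFunctor (Γ.right b)).map_id Y
  mapR_comp X h g f := tensMapR_comp X h _ (isNat_contractMap Γ g) _ (isNat_contractMap Γ f) _
    (isNat_contractMap Γ _) fun b => (tensFunctor (Γ.right b)).map_comp h g f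
  mapR_d X n m h f := tensMapR_d X h _ (isNat_contractMap Γ f) _ (isNat_contractMap Γ _)
    fun b => (tensFunctor (Γ.right b)).map_d n m h f
  comm h h' f g := tensMapL_tensMapR h h' f _ (isNat_contractMap Γ g)

end DGBimod₂

/-! ### Quasi-isomorphisms, h-projective and perfect modules -/

namespace RMod

variable {k : Type u} [CommRing k] {T : DGCat.{u, u} k}

/-- `M` is acyclic: the complex `M(a)` is exact for every object `a`. -/
def IsAcyclic (M : RMod T) : Prop :=
  ∀ (a : T.Obj) (n m l : ℤ) (h : n + 1 = m) (h' : m + 1 = l) (x : M.X a m),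
    M.d m l h' x = 0 → ∃ y : M.X a n, M.d n m h y = x

/-- A morphism of degree `0` is a quasi-isomorphism if it induces bijections on the cohomology of
the complexes attached to every object. -/
def IsQuasiIso {M N : RMod T} (φ : homSub M N 0) : Prop :=
  ∀ (a : T.Obj) (n m l : ℤ) (h : n + 1 = m) (h' : m + 1 = l),
    (∀ x : M.X a m, M.d m l h' x = 0 →
      (∃ y : N.X a n, N.d n m h y = app φ a m m (zero_add m) x) →
      ∃ z : M.X a n, M.d n m h z = x) ∧
    (∀ y : N.X a m, N.d m l h' y = 0 →
      ∃ (x : M.X a m) (z : N.X a n), M.d m l h' x = 0 ∧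
        y = app φ a m m (zero_add m) x + N.d n m h z)

/-- `P` is h-projective: the complex of morphisms from `P` to any acyclic module is exact. -/
def IsHProj (P : RMod T) : Prop :=
  ∀ N : RMod T, N.IsAcyclic → ∀ (n m l : ℤ) (h : n + 1 = m) (h' : m + 1 = l)
    (φ : (cat T).Hom P N m), (cat T).d m l h' φ = 0 →
      ∃ ψ : (cat T).Hom P N n, (cat T).d n m h ψ = φ

/-- The direct sum of a family of right dg-modules. -/
@[reducible] noncomputable def dsum {ι : Type u} (N : ι → RMod T) : RMod T where
  X a n := Π₀ s, (N s).X a n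
  d n m h := DFinsupp.mapRange.linearMap fun s => (N s).d n m h
  d_d n m l h h' x := by
    ext s
    simp [(N s).d_d]
  act h := LinearMap.mk₂ k (fun x f => DFinsupp.mapRange.linearMap (fun s => ((N s).act h).flip f) x)
    (by intros; ext; simp) (by intros; ext; simp) (by intros; ext; simp) (by intros; ext; simp)
  act_id h x := by
    ext s
    simp [(N s).act_id]
  act_comp h₁ h₂ h₃ h₄ x g f := by
    ext s
    simp [(N s).act_comp h₁ h₂ h₃ h₄]
  d_act h hp hq hr h₁ h₂ x f := by
    ext s
    simp [(N s).d_act h hp hq hr h₁ h₂]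

/-- `P` is compact: up to homotopy, every closed morphism from `P` to a direct sum
takes its values in a finite subsum. In other words, the maps
`⨁ₛ Hⁿ(Hom(P, Nₛ)) → Hⁿ(Hom(P, ⨁ₛ Nₛ))`, which are always injective, are bijective. -/
def IsCompact (P : RMod T) : Prop :=
  ∀ (ι : Type u) (N : ι → RMod T) (n m l : ℤ) (h : n + 1 = m) (h' : m + 1 = l)
    (φ : (cat T).Hom P (dsum N) m), (cat T).d m l h' φ = 0 →
      ∃ (S : Finset ι) (ψ : (cat T).Hom P (dsum N) m) (χ : (cat T).Hom P (dsum N) n),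
        (cat T).d m l h' ψ = 0 ∧
        (∀ a i j hj x, ∀ s ∉ S, (app ψ a i j hj x) s = 0) ∧
        φ = ψ + (cat T).d n m h χ

/-- Perfect modules: the h-projective modules which are compact. They model the objects of
`T̂_pe`, since h-projective modules compute the derived category. -/
def IsPerfect (P : RMod T) : Prop := P.IsHProj ∧ P.IsCompact

/-! ### Shifts and cones -/

/-- Transport along an equality of degrees. -/
def cst (M : RMod T) {a : T.Obj} {i j : ℤ} (h : i = j) : M.X a i →ₗ[k] M.X a j :=
  h ▸ LinearMap.id

theorem cst_rfl (M : RMod T) {a : T.Obj} {i : ℤ} (h : i = i) (x : M.X a i) : M.cst h x = x := rfl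

theorem cst_act (M : RMod T) {a b : T.Obj} {i i' q r r' : ℤ} (h : r = r') (hi : i = i')
    (h₁ : i + q = r) (h₂ : i' + q = r') (x : M.X b i) (f : T.Hom a b q) :
    M.cst h (M.act h₁ x f) = M.act h₂ (M.cst hi x) f := by
  subst h hi
  rfl

theorem d_cst (M : RMod T) {a : T.Obj} {i i' j j' : ℤ} (hi : i = i') (hj : j = j')
    (h : i + 1 = j) (h' : i' + 1 = j') (x : M.X a i) :
    M.d i' j' h' (M.cst hi x) = M.cst hj (M.d i j h x) := by
  subst hi hj
  rfl

/-- The shift `M[1]`. -/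
@[reducible] def shift (M : RMod T) : RMod T where
  X a n := M.X a (n + 1)
  d n m h := -M.d (n + 1) (m + 1) (by omega)
  d_d n m l h h' x := by simp [M.d_d]
  act {a b p q r} h := M.act (show p + 1 + q = r + 1 by omega)
  act_id h x := M.act_id _ x
  act_comp h₁ h₂ h₃ h₄ x g f := M.act_comp _ _ h₃ _ x g f
  d_act {a b p q r p' q' r'} h hp hq hr h₁ h₂ x f := by
    have e : sg k (p + 1) = -sg k p := by rw [sg_add, sg_one]; ring
    rw [LinearMap.neg_apply, M.d_act (p' := p' + 1) (q' := q') (r' := r' + 1) (by omega)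
      (by omega) hq (by omega) (by omega) (by omega), e]
    simp [add_comm]

/-- The shift functor `M ↦ M[1]`, `φ ↦ (-1)^|φ| φ`. -/
def shiftFunctor (T : DGCat.{u, u} k) : DGFunctor (cat T) (cat T) where
  obj M := M.shift
  map {M N} n :=
    { toFun := fun φ => ⟨fun a s => sg k n • app φ a (s.1.1 + 1) (s.1.2 + 1)
          (by have := s.2; omega), by
        intro a b i j q r s h h₁ h₂ h₃ x f
        have := app_act φ a b (i + 1) (j + 1) q (r + 1) (s + 1) (by omega) (by omega) (by omega)
          (by omega) x f
        refine (congrArg (fun y => sg k n • y) this).trans ?_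
        change _ = N.act _ (sg k n • _) f
        rw [map_smul, LinearMap.smul_apply]⟩
      map_add' := fun φ ψ => by
        refine hom_ext fun a i j hj x => ?_
        exact smul_add (sg k n) _ _
      map_smul' := fun c φ => by
        refine hom_ext fun a i j hj x => ?_
        exact smul_comm (α := N.X a (j + 1)) (sg k n) c _ }
  map_id M := by
    refine hom_ext fun a i j hj x => ?_
    obtain rfl : i = j := by omega
    change sg k 0 • app (homId M) a (i + 1) (i + 1) (by omega) x = _
    rw [sg_zero, one_smul]
    rfl
  map_comp {M N L} p q r h g f := by
    refine hom_ext fun a i j hj x => ?_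
    rw [homComp_apply _ _ _ h _ _ a i j (q + i) hj rfl (by omega)]
    change sg k r • app _ a (i + 1) (j + 1) _ x =
      sg k p • app g a (q + i + 1) (j + 1) _ (sg k q • app f a (i + 1) (q + i + 1) _ x)
    rw [homComp_apply _ _ _ h _ _ a (i + 1) (j + 1) (q + i + 1) (by omega) (by omega) (by omega),
      map_smul, smul_smul, ← sg_add, h]
  map_d {M N} n m h f := by
    refine hom_ext fun a i j hj x => ?_
    rw [homD_apply _ _ h _ a i j (i + 1) (n + i) hj rfl rfl (by omega) (by omega)]
    change sg k m • app _ a (i + 1) (j + 1) _ x =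
      -N.d (n + i + 1) (j + 1) _ (sg k n • app f a (i + 1) (n + i + 1) _ x) -
        sg k n • (sg k n • app f a (i + 1 + 1) (j + 1) _ (-M.d (i + 1) (i + 1 + 1) _ x))
    have e : sg k m = -sg k n := by rw [← h, sg_add, sg_one]; ring
    rw [homD_apply _ _ h _ a (i + 1) (j + 1) (i + 1 + 1) (n + i + 1) (by omega) rfl (by omega)
      (by omega) (by omega), e, map_smul, map_neg, smul_smul, smul_sub, smul_smul, neg_mul]
    simp only [neg_smul, smul_neg, sg_mul_self]

/-- The tautological closed isomorphism `M[1] → M` of degree `1`. -/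
def unshift (M : RMod T) : (cat T).Hom M.shift M 1 :=
  ⟨fun _ s => M.cst (show s.1.1 + 1 = s.1.2 by have := s.2; omega),
    fun _ _ i j _ r s h h₁ h₂ h₃ x f =>
      M.cst_act (show r + 1 = s by omega) (show i + 1 = j by omega) _ _ x f⟩

/-- The inverse of the tautological isomorphism `M[1] → M`. -/
def toShift (M : RMod T) : (cat T).Hom M M.shift (-1) :=
  ⟨fun _ s => M.cst (show s.1.1 = s.1.2 + 1 by have := s.2; omega),
    fun _ _ i j _ r s h h₁ h₂ h₃ x f =>
      M.cst_act (show r = s + 1 by omega) (show i = j + 1 by omega) _ _ x f⟩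

theorem d_unshift (M : RMod T) : (cat T).d 1 2 (by norm_num) M.unshift = 0 := by
  refine hom_ext fun a i j hj x => ?_
  rw [homD_apply _ _ _ _ a i j (i + 1) (i + 1) hj rfl (by omega) (by omega) (by omega), sg_one]
  change M.d (i + 1) j (by omega) (M.cst (rfl : i + 1 = i + 1) x) -
    (-1 : k) • M.cst (show i + 1 + 1 = j by omega) (-M.d (i + 1) (i + 1 + 1) rfl x) = 0
  rw [map_neg, M.d_cst (rfl : i + 1 = i + 1) (show i + 1 + 1 = j by omega) rfl]
  simp

theorem d_toShift (M : RMod T) : (cat T).d (-1) 0 (by norm_num) M.toShift = 0 := by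
  refine hom_ext fun a i j hj x => ?_
  rw [homD_apply _ _ _ _ a i j (i + 1) (i - 1) hj rfl (by omega) (by omega) (by omega),
    sg_neg_one]
  change -M.d (i - 1 + 1) (j + 1) (by omega) (M.cst (show i = i - 1 + 1 by omega) x) -
    (-1 : k) • M.cst (show i + 1 = j + 1 by omega) (M.d i (i + 1) rfl x) = 0
  rw [M.d_cst (show i = i - 1 + 1 by omega) (show i + 1 = j + 1 by omega) rfl]
  simp

theorem toShift_unshift (M : RMod T) :
    (cat T).comp (show (-1 : ℤ) + 1 = 0 by norm_num) M.toShift M.unshift =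
      (cat T).id M.shift := by
  refine hom_ext fun a i j hj x => ?_
  obtain rfl : i = j := by omega
  rw [homComp_apply _ _ _ _ _ _ a i i (i + 1) hj (by omega) (by omega)]
  rfl

theorem comp_toShift_unshift (M N : RMod T) {n m : ℤ} (h : n + -1 = m) (h' : m + 1 = n)
    (φ : (cat T).Hom M.shift N n) :
    (cat T).comp h' ((cat T).comp h φ M.toShift) M.unshift = φ := by
  rw [(cat T).assoc h h' (by norm_num) (add_zero n), toShift_unshift, (cat T).comp_id]

theorem IsPerfect.shift {P : RMod T} (hP : P.IsPerfect) : P.shift.IsPerfect := by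
  have key : ∀ (N : RMod T) (m l m' l' : ℤ) (h' : m + 1 = l) (h'' : m' + 1 = l')
      (hm : m + -1 = m') (φ : (cat T).Hom P.shift N m), (cat T).d m l h' φ = 0 →
      (cat T).d m' l' h'' ((cat T).comp hm φ P.toShift) = 0 := by
    intro N m l m' l' h' h'' hm φ hφ
    rw [(cat T).d_comp hm h' (q' := 0) (by norm_num) h'' (by omega) (by omega), hφ, d_toShift]
    simp
  have key' : ∀ (N : RMod T) (n m n' m' : ℤ) (h : n + 1 = m) (h'' : n' + 1 = m')
      (hm : n' + 1 = n) (hm' : m' + 1 = m) (ψ : (cat T).Hom P N n'),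
      (cat T).d n m h ((cat T).comp hm ψ P.unshift) =
        (cat T).comp hm' ((cat T).d n' m' h'' ψ) P.unshift := by
    intro N n m n' m' h h'' hm hm' ψ
    rw [(cat T).d_comp hm h'' (q' := 2) (by norm_num) h hm' (by omega), d_unshift]
    simp
  refine ⟨fun N hN n m l h h' φ hφ => ?_, fun ι N n m l h h' φ hφ => ?_⟩
  · obtain ⟨ψ, hψ⟩ := hP.1 N hN (n - 1) (m - 1) (l - 1) (by omega) (by omega) _
      (key N m l (m - 1) (l - 1) h' (by omega) (by omega) φ hφ)
    refine ⟨(cat T).comp (by omega) ψ P.unshift, ?_⟩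
    rw [key' N n m (n - 1) (m - 1) h (by omega) (by omega) (by omega), hψ, comp_toShift_unshift]
  · obtain ⟨S, ψ, χ, h₁, h₂, h₃⟩ := hP.2 ι N (n - 1) (m - 1) (l - 1) (by omega) (by omega) _
      (key (dsum N) m l (m - 1) (l - 1) h' (by omega) (by omega) φ hφ)
    refine ⟨S, (cat T).comp (by omega) ψ P.unshift, (cat T).comp (by omega) χ P.unshift, ?_, ?_, ?_⟩
    · rw [key' (dsum N) m l (m - 1) (l - 1) h' (by omega) (by omega) (by omega), h₁, map_zero,
        LinearMap.zero_apply]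
    · intro a i j hj x s hs
      rw [homComp_apply _ _ _ _ _ _ a i j (1 + i) hj rfl (by omega)]
      exact h₂ _ _ _ _ _ s hs
    · rw [key' (dsum N) n m (n - 1) (m - 1) h (by omega) (by omega) (by omega),
        ← LinearMap.add_apply, ← map_add, ← h₃, comp_toShift_unshift]

/-- The cone of a closed morphism `φ : M → N` of degree `0`: the module `N ⊕ M[1]` with
differential `(y, x) ↦ (dy + φ(x), -dx)`. -/
@[reducible] def cone {M N : RMod T} (φ : homSub M N 0) (hφ : (cat T).IsClosed₀ φ) : RMod T where
  X a n := N.X a n × M.X a (n + 1)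
  d {a} n m h := LinearMap.prod
    (N.d n m h ∘ₗ LinearMap.fst k _ _ + app φ a (n + 1) m (by omega) ∘ₗ LinearMap.snd k _ _)
    (-(M.d (n + 1) (m + 1) (by omega) ∘ₗ LinearMap.snd k _ _))
  d_d {a} n m l h h' := by
    rintro ⟨y, x⟩
    have e := homD_apply M N (zero_add 1) φ a (n + 1) l
      (m + 1) m (by omega) (by omega) (by omega) h' (by omega) x
    have e' : homD M N 0 1 (zero_add 1) φ = 0 := hφ
    rw [e', app_zero, sg_zero, one_smul, eq_comm, sub_eq_zero] at e
    ext <;> simp [N.d_d, M.d_d, e]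
  act {a b p q r} h := LinearMap.mk₂ k
    (fun w f => (N.act h w.1 f, M.act (show p + 1 + q = r + 1 by omega) w.2 f))
    (by intros; ext <;> simp) (by intros; ext <;> simp) (by intros; ext <;> simp)
    (by intros; ext <;> simp)
  act_id h x := by ext <;> simp [N.act_id, M.act_id]
  act_comp h₁ h₂ h₃ h₄ x g f := by
    refine Prod.ext ?_ ?_
    · exact N.act_comp h₁ h₂ h₃ h₄ x.1 g f
    · exact M.act_comp _ _ h₃ _ x.2 g f
  d_act {a b p q r p' q' r'} h hp hq hr h₁ h₂ x f := by
    have e : sg k (p + 1) = -sg k p := by rw [sg_add, sg_one]; ring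
    refine Prod.ext ?_ ?_
    · simp [N.d_act h hp hq hr h₁ h₂, app_act φ a b (p + 1) p' q (r + 1) r' (by omega) (by omega)
        (by omega) h₁]
      abel
    · simp [M.d_act (p := p + 1) (r := r + 1) (p' := p' + 1) (q' := q') (r' := r' + 1) (by omega)
        (by omega) hq (by omega) (by omega) (by omega), e]
      abel

section Cone

variable {M N : RMod T} (φ : homSub M N 0) (hφ : (cat T).IsClosed₀ φ)

/-- The inclusion `N → cone φ`. -/
def coneIn : (cat T).Hom N (cone φ hφ) 0 :=
  ⟨fun a s => LinearMap.prod (N.cst (show s.1.1 = s.1.2 by have := s.2; omega)) 0, by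
    intro a b i j q r s h h₁ h₂ h₃ x f
    obtain rfl : i = j := by omega
    obtain rfl : r = s := by omega
    refine Prod.ext rfl ?_
    change (0 : M.X a (r + 1)) = M.act _ 0 f
    simp⟩

/-- The projection `cone φ → M[1]`. -/
def conePr : (cat T).Hom (cone φ hφ) M.shift 0 :=
  ⟨fun a s => M.cst (show s.1.1 + 1 = s.1.2 + 1 by have := s.2; omega) ∘ₗ LinearMap.snd k _ _, by
    intro a b i j q r s h h₁ h₂ h₃ x f
    obtain rfl : i = j := by omega
    obtain rfl : r = s := by omega
    rfl⟩

/-- The projection `cone φ → N`, which is not closed. -/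
def coneFst : (cat T).Hom (cone φ hφ) N 0 :=
  ⟨fun a s => N.cst (show s.1.1 = s.1.2 by have := s.2; omega) ∘ₗ LinearMap.fst k _ _, by
    intro a b i j q r s h h₁ h₂ h₃ x f
    obtain rfl : i = j := by omega
    obtain rfl : r = s := by omega
    rfl⟩

theorem closed_coneIn : (cat T).IsClosed₀ (coneIn φ hφ) := by
  refine hom_ext fun a i j hj x => ?_
  rw [homD_apply _ _ _ _ a i j (i + 1) i hj rfl (by omega) (by omega) (by omega), sg_zero,
    one_smul]
  obtain rfl : i + 1 = j := by omega
  refine Prod.ext ?_ ?_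
  · change N.d i (i + 1) _ x + app φ a (i + 1) (i + 1) _ 0 - N.d i (i + 1) _ x = 0
    simp
  · change -M.d (i + 1) (i + 1 + 1) _ 0 - 0 = 0
    simp

theorem closed_conePr : (cat T).IsClosed₀ (conePr φ hφ) := by
  refine hom_ext fun a i j hj x => ?_
  rw [homD_apply _ _ _ _ a i j (i + 1) i hj rfl (by omega) (by omega) (by omega), sg_zero,
    one_smul]
  obtain rfl : i + 1 = j := by omega
  change -M.d (i + 1) (i + 1 + 1) _ x.2 - -M.d (i + 1) (i + 1 + 1) _ x.2 = 0
  simp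

theorem d_coneFst : (cat T).d 0 1 (zero_add 1) (coneFst φ hφ) =
    -(cat T).comp (zero_add 1) φ ((cat T).comp (add_zero 1) M.unshift (conePr φ hφ)) := by
  refine hom_ext fun a i j hj x => ?_
  rw [homD_apply _ _ _ _ a i j (i + 1) i hj rfl (by omega) (by omega) (by omega), sg_zero,
    one_smul]
  obtain rfl : i + 1 = j := by omega
  change N.d i (i + 1) _ x.1 - (N.d i (i + 1) _ x.1 + app φ a (i + 1) (i + 1) _ x.2) =
    -app _ a i (i + 1) _ x
  rw [homComp_apply _ _ _ _ _ _ a i (i + 1) (i + 1) _ (by omega) (by omega),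
    homComp_apply _ _ _ _ _ _ a i (i + 1) i _ (by omega) (by omega)]
  change _ = -app φ a (i + 1) (i + 1) _ x.2
  simp

theorem coneFst_coneIn : (cat T).comp₀ (coneFst φ hφ) (coneIn φ hφ) = (cat T).id N := by
  refine hom_ext fun a i j hj x => ?_
  obtain rfl : i = j := by omega
  unfold DGCat.comp₀
  rw [homComp_apply _ _ _ _ _ _ a i i i hj (by omega) (by omega)]
  rfl

theorem conePr_coneIn : (cat T).comp₀ (conePr φ hφ) (coneIn φ hφ) = 0 := by
  refine hom_ext fun a i j hj x => ?_
  obtain rfl : i = j := by omega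
  unfold DGCat.comp₀
  rw [homComp_apply _ _ _ _ _ _ a i i i hj (by omega) (by omega)]
  rfl

end Cone

theorem app_d₀ {M N : RMod T} {φ : homSub M N 0} (hφ : (cat T).IsClosed₀ φ) (a : T.Obj)
    (n m : ℤ) (h : n + 1 = m) (x : M.X a n) :
    N.d n m h (app φ a n n (zero_add n) x) = app φ a m m (zero_add m) (M.d n m h x) := by
  have e := homD_apply M N (zero_add 1) φ a n m m n (by omega) h (by omega) h (by omega) x
  have e' : homD M N 0 1 (zero_add 1) φ = 0 := hφ
  rw [e', app_zero, sg_zero, one_smul, eq_comm, sub_eq_zero] at e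
  exact e

theorem IsQuasiIso.acyclic_cone {M N : RMod T} {φ : homSub M N 0} (hφ : (cat T).IsClosed₀ φ)
    (H : IsQuasiIso φ) : (cone φ hφ).IsAcyclic := by
  rintro a n m l rfl rfl ⟨y, x⟩ hyx
  have h₁ : N.d (n + 1) (n + 1 + 1) rfl y +
      app φ a (n + 1 + 1) (n + 1 + 1) (zero_add _) x = 0 := congrArg Prod.fst hyx
  have h₂ : -M.d (n + 1 + 1) (n + 1 + 1 + 1) rfl x = 0 := congrArg Prod.snd hyx
  obtain ⟨z, hz⟩ := (H a (n + 1) (n + 1 + 1) (n + 1 + 1 + 1) rfl rfl).1 x (neg_eq_zero.mp h₂)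
    ⟨-y, by rw [map_neg]; exact neg_eq_of_add_eq_zero_right h₁⟩
  obtain ⟨w, v, hw, hv⟩ := (H a n (n + 1) (n + 1 + 1) rfl rfl).2
    (y + app φ a (n + 1) (n + 1) (zero_add _) z) (by
      rw [map_add, app_d₀ hφ, hz, h₁])
  refine ⟨(v, w - z), Prod.ext ?_ ?_⟩
  · change N.d n (n + 1) rfl v + app φ a (n + 1) (n + 1) (zero_add _) (w - z) = y
    rw [map_sub, ← sub_eq_of_eq_add hv.symm.symm]
    abel_nf
  · change -M.d (n + 1) (n + 1 + 1) rfl (w - z) = x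
    rw [map_sub, hw, hz]
    simp

theorem app_comp₀ {M N L : RMod T} (ψ : homSub N L 0) (φ : homSub M N 0) (a : T.Obj) (n : ℤ)
    (h : 0 + n = n) (x : M.X a n) :
    app ((cat T).comp₀ ψ φ) a n n h x = app ψ a n n h (app φ a n n h x) :=
  homComp_apply M N L (add_zero 0) ψ φ a n n n h h h x

/-- A quasi-isomorphism to an h-projective module has a right inverse up to homotopy. -/
theorem IsQuasiIso.exists_right_inv {M N : RMod T} {φ : homSub M N 0}
    (hφ : (cat T).IsClosed₀ φ) (H : IsQuasiIso φ) (hN : N.IsHProj) :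
    ∃ g : (cat T).Hom N M 0, (cat T).IsClosed₀ g ∧
      ∃ s, (cat T).comp₀ φ g - (cat T).id N = (cat T).bd s := by
  obtain ⟨η, hη⟩ := hN _ (H.acyclic_cone hφ) (-1) 0 1 (by norm_num) (zero_add 1) _
    (closed_coneIn φ hφ)
  have hq : (cat T).d 1 2 (by norm_num)
      ((cat T).comp (add_zero 1) M.unshift (conePr φ hφ)) = 0 := by
    have h := closed_conePr φ hφ
    unfold DGCat.IsClosed₀ at h
    rw [(cat T).d_comp (add_zero 1) (p' := 2) (q' := 1) (by norm_num) (zero_add 1) (by norm_num)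
      (by norm_num) (by norm_num), d_unshift, h]
    simp
  refine ⟨(cat T).comp (show (1 : ℤ) + -1 = 0 by norm_num)
    ((cat T).comp (add_zero 1) M.unshift (conePr φ hφ)) η, ?_,
    -(cat T).comp (zero_add (-1)) (coneFst φ hφ) η, ?_⟩
  · unfold DGCat.IsClosed₀
    rw [(cat T).d_comp _ (p' := 2) (q' := 0) (by norm_num) (by norm_num) (zero_add 1)
      (by norm_num) (add_zero 1), hq, hη, (cat T).assoc (add_zero 1) (add_zero 1) (add_zero 0)
      (add_zero 1)]
    have h := conePr_coneIn φ hφ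
    unfold DGCat.comp₀ at h
    rw [h]
    simp
  · have h := coneFst_coneIn φ hφ
    unfold DGCat.comp₀ at h
    unfold DGCat.bd DGCat.comp₀
    rw [map_neg, (cat T).d_comp (zero_add (-1)) (p' := 1) (q' := 0) (zero_add 1) (by norm_num)
      (by norm_num) (by norm_num) (add_zero 0), hη, h, d_coneFst, sg_zero, one_smul, map_neg,
      LinearMap.neg_apply,
      (cat T).assoc (zero_add 1) (show (1 : ℤ) + -1 = 0 by norm_num) (show (1 : ℤ) + -1 = 0 by norm_num)
        (add_zero 0)]
    abel

/-- A quasi-isomorphism between h-projective modules is a homotopy equivalence. -/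
theorem IsQuasiIso.exists_inv {M N : RMod T} {φ : homSub M N 0}
    (hφ : (cat T).IsClosed₀ φ) (H : IsQuasiIso φ) (hM : M.IsHProj) (hN : N.IsHProj) :
    ∃ g : (cat T).Hom N M 0, (cat T).IsClosed₀ g ∧
      (∃ s, (cat T).comp₀ φ g - (cat T).id N = (cat T).bd s) ∧
      ∃ s, (cat T).comp₀ g φ - (cat T).id M = (cat T).bd s := by
  obtain ⟨g, hg, s, hs⟩ := H.exists_right_inv hφ hN
  have E : ∀ (a : T.Obj) (n m : ℤ) (h : n + 1 = m) (y : N.X a m) (l : ℤ) (h' : m + 1 = l),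
      N.d m l h' y = 0 → ∃ v : N.X a n,
        app φ a m m (zero_add m) (app g a m m (zero_add m) y) - y = N.d n m h v := by
    intro a n m h y l h' hy
    have e := congrArg (fun u => app u a m m (zero_add m) y) hs
    refine ⟨app s a m n (by omega) y, ?_⟩
    have e' : app ((cat T).bd s) a m m (zero_add m) y = N.d n m h (app s a m n (by omega) y) := by
      unfold DGCat.bd
      rw [homD_apply _ _ _ s a m m l n (zero_add m) h' (by omega) h (by omega), hy]
      simp
    rw [← e', ← hs, ← app_comp₀]
    rfl
  have Hg : IsQuasiIso g := by
    intro a n m l h h'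
    refine ⟨fun y hy hz => ?_, fun x hx => ?_⟩
    · obtain ⟨z, hz⟩ := hz
      obtain ⟨v, hv⟩ := E a n m h y l h' hy
      refine ⟨app φ a n n (zero_add n) z - v, ?_⟩
      rw [map_sub, app_d₀ hφ, hz, ← hv]
      abel
    · obtain ⟨v, hv⟩ := E a n m h (app φ a m m (zero_add m) x) l h' (by
        rw [app_d₀ hφ, hx, map_zero])
      rw [← map_sub] at hv
      obtain ⟨z, hz⟩ := (H a n m l h h').1 _ (by
        rw [map_sub, hx, app_d₀ hg, app_d₀ hφ, hx, map_zero, map_zero, sub_zero]) ⟨v, hv.symm⟩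
      refine ⟨app φ a m m (zero_add m) x, -z, by rw [app_d₀ hφ, hx, map_zero], ?_⟩
      rw [map_neg, hz]
      abel
  obtain ⟨g', hg', s', hs'⟩ := Hg.exists_right_inv hg hM
  refine ⟨g, hg, ⟨s, hs⟩, ?_⟩
  have c₁ := (DGCat.H0.cl_eq_iff (C := cat T) (a := ⟨N⟩) (b := ⟨N⟩)
    (DGCat.H0.closed_comp hφ hg) ((cat T).closed_id N)).mpr ⟨s, hs⟩
  have c₂ := (DGCat.H0.cl_eq_iff (C := cat T) (a := ⟨M⟩) (b := ⟨M⟩)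
    (DGCat.H0.closed_comp hg hg') ((cat T).closed_id M)).mpr ⟨s', hs'⟩
  refine (DGCat.H0.cl_eq_iff (C := cat T) (a := ⟨M⟩) (b := ⟨M⟩)
    (DGCat.H0.closed_comp hg hφ) ((cat T).closed_id M)).mp ?_
  let A : (cat T).H0 := ⟨M⟩
  let B : (cat T).H0 := ⟨N⟩
  let f₀ : A ⟶ B := DGCat.H0.cl φ hφ
  let g₀ : B ⟶ A := DGCat.H0.cl g hg
  let g₁ : A ⟶ B := DGCat.H0.cl g' hg'
  have d₁ : g₀ ≫ f₀ = 𝟙 B := c₁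
  have d₂ : g₁ ≫ g₀ = 𝟙 A := c₂
  have d₃ : f₀ = g₁ := by
    calc f₀ = (g₁ ≫ g₀) ≫ f₀ := by rw [d₂, Category.id_comp]
      _ = g₁ := by rw [Category.assoc, d₁, Category.comp_id]
  change f₀ ≫ g₀ = 𝟙 A
  rw [d₃, d₂]

end RMod

/-- The inclusion of a full dg-subcategory. -/
def DGFunctor.fullIncl {k : Type u} [CommRing k] (C : DGCat.{v, u} k) (P : C.Obj → Prop) :
    DGFunctor (C.full P) C where
  obj a := a.1
  map := LinearMap.id
  map_id _ := rfl
  map_comp _ _ _ := rfl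
  map_d _ _ _ _ := rfl

/-! ### Perfect modules and their homotopy category -/

namespace RMod

variable {k : Type u} [CommRing k]

/-- The dg-category `T̂_pe` of perfect right dg-modules over `T`. -/
abbrev pe (T : DGCat.{u, u} k) : DGCat.{u + 1, u} k := (cat T).full IsPerfect

variable {T : DGCat.{u, u} k}

/-- The shift `M ↦ M[1]` on `H⁰(T̂_pe)`. -/
def shiftPe (T : DGCat.{u, u} k) : (pe T).H0 ⥤ (pe T).H0 :=
  ((shiftFunctor T).restrict IsPerfect IsPerfect fun _ h => h.shift).mapH0

/-- The inclusion of `H⁰(T̂_pe)` in the homotopy category of all right dg-modules. -/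
def incl (T : DGCat.{u, u} k) : (pe T).H0 ⥤ (cat T).H0 :=
  (DGFunctor.fullIncl (cat T) IsPerfect).mapH0

/-- The triangle `X → Y → Z → X[1]` of perfect modules is distinguished: in the homotopy category
of dg-modules it is isomorphic to a triangle `M → N → cone φ → M[1]` of a closed morphism `φ`. -/
def IsDistinguished {X Y Z : (pe T).H0} (f : X ⟶ Y) (g : Y ⟶ Z) (h : Z ⟶ (shiftPe T).obj X) :
    Prop :=
  ∃ (M N : RMod T) (φ : (cat T).Hom M N 0) (hφ : (cat T).IsClosed₀ φ)
    (a : (⟨X.of.1⟩ : (cat T).H0) ≅ ⟨M⟩) (b : (⟨Y.of.1⟩ : (cat T).H0) ≅ ⟨N⟩)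
    (c : (⟨Z.of.1⟩ : (cat T).H0) ≅ ⟨cone φ hφ⟩),
    (incl T).map f ≫ b.hom = a.hom ≫ DGCat.H0.cl φ hφ ∧
    (incl T).map g ≫ c.hom = b.hom ≫ DGCat.H0.cl (coneIn φ hφ) (closed_coneIn φ hφ) ∧
    (incl T).map h ≫ (shiftFunctor T).mapH0.map a.hom =
      c.hom ≫ DGCat.H0.cl (conePr φ hφ) (closed_conePr φ hφ)

/-- A functor between homotopy categories of perfect modules is exact if it commutes with the
shifts, up to a natural isomorphism, and preserves the distinguished triangles. -/
def IsExact (F : (pe T).H0 ⥤ (pe T).H0) : Prop :=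
  ∃ ξ : shiftPe T ⋙ F ≅ F ⋙ shiftPe T,
    ∀ {X Y Z : (pe T).H0} (f : X ⟶ Y) (g : Y ⟶ Z) (h : Z ⟶ (shiftPe T).obj X),
      IsDistinguished f g h → IsDistinguished (F.map f) (F.map g) (F.map h ≫ ξ.hom.app X)

end RMod

/-! ### Pseudo dg-tensor structures -/

/-- The unit, the structure morphisms and the homotopies of a pseudo dg-tensor structure whose
tensor product is the dg-bifunctor `E` on `C`. All the families are dg-natural in every variable;
for `E` the extension of a `2`-fold dg-bimodule over `T` to right dg-modules, the dg-natural families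
are the same as the morphisms of the corresponding multifold dg-bimodules over `T`. -/
structure TensorData {k : Type u} [CommRing k] {C : DGCat.{v, u} k} (E : DGBifunctor C C C) where
  /-- The unit. -/
  U : C.Obj
  /-- The associativity morphism `α : E(X, E(Y, Z)) → E(E(X, Y), Z)`. -/
  α : ∀ X Y Z : C.Obj, C.Hom (E.obj X (E.obj Y Z)) (E.obj (E.obj X Y) Z) 0
  /-- The left unit morphism `ℓ : E(U, X) → X`. -/
  ℓ : ∀ X : C.Obj, C.Hom (E.obj U X) X 0
  /-- The right unit morphism `r : E(X, U) → X`. -/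
  r : ∀ X : C.Obj, C.Hom (E.obj X U) X 0
  /-- The symmetry morphism `c : E(X, Y) → E(Y, X)`. -/
  c : ∀ X Y : C.Obj, C.Hom (E.obj X Y) (E.obj Y X) 0
  α_nat₁ : ∀ Y Z, (E.left (E.obj Y Z)).IsNat ((E.left Y).comp (E.left Z)) 0 fun X => α X Y Z
  α_nat₂ : ∀ X Z, ((E.left Z).comp (E.right X)).IsNat ((E.right X).comp (E.left Z)) 0
    fun Y => α X Y Z
  α_nat₃ : ∀ X Y, ((E.right Y).comp (E.right X)).IsNat (E.right (E.obj X Y)) 0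
    fun Z => α X Y Z
  ℓ_nat : (E.right U).IsNat (DGFunctor.idf C) 0 ℓ
  r_nat : (E.left U).IsNat (DGFunctor.idf C) 0 r
  c_nat₁ : ∀ Y, (E.left Y).IsNat (E.right Y) 0 fun X => c X Y
  c_nat₂ : ∀ X, (E.right X).IsNat (E.left X) 0 fun Y => c X Y
  α_closed : ∀ X Y Z, C.IsClosed₀ (α X Y Z)
  ℓ_closed : ∀ X, C.IsClosed₀ (ℓ X)
  r_closed : ∀ X, C.IsClosed₀ (r X)
  c_closed : ∀ X Y, C.IsClosed₀ (c X Y)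
  /-- The associativity homotopy. -/
  η : ∀ X Y Z W : C.Obj, C.Hom (E.obj X (E.obj Y (E.obj Z W)))
    (E.obj (E.obj (E.obj X Y) Z) W) (-1)
  η_nat₁ : ∀ Y Z W, (E.left (E.obj Y (E.obj Z W))).IsNat
    (((E.left Y).comp (E.left Z)).comp (E.left W)) (-1) fun X => η X Y Z W
  η_nat₂ : ∀ X Z W, ((E.left (E.obj Z W)).comp (E.right X)).IsNat
    (((E.right X).comp (E.left Z)).comp (E.left W)) (-1) fun Y => η X Y Z W
  η_nat₃ : ∀ X Y W, (((E.left W).comp (E.right Y)).comp (E.right X)).IsNat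
    ((E.right (E.obj X Y)).comp (E.left W)) (-1) fun Z => η X Y Z W
  η_nat₄ : ∀ X Y Z, (((E.right Z).comp (E.right Y)).comp (E.right X)).IsNat
    (E.right (E.obj (E.obj X Y) Z)) (-1) fun W => η X Y Z W
  /-- The pentagon commutes up to `η`. -/
  pentagon : ∀ X Y Z W,
    C.comp₀ (α (E.obj X Y) Z W) (α X Y (E.obj Z W)) -
      C.comp₀ (E.mapL W (α X Y Z)) (C.comp₀ (α X (E.obj Y Z) W) (E.mapR X (α Y Z W))) =
      C.bd (η X Y Z W)
  /-- The unit homotopy. -/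
  μ : ∀ X Y : C.Obj, C.Hom (E.obj X (E.obj U Y)) (E.obj X Y) (-1)
  μ_nat₁ : ∀ Y, (E.left (E.obj U Y)).IsNat (E.left Y) (-1) fun X => μ X Y
  μ_nat₂ : ∀ X, ((E.right U).comp (E.right X)).IsNat (E.right X) (-1) fun Y => μ X Y
  /-- The triangle for the unit commutes up to `μ`. -/
  triangle : ∀ X Y,
    C.comp₀ (E.mapL Y (r X)) (α X U Y) - E.mapR X (ℓ Y) = C.bd (μ X Y)
  /-- The composite of the two symmetries is the identity in the homotopy category. -/
  symmetry : ∀ X Y, ∃ σ, C.comp₀ (c Y X) (c X Y) - C.id (E.obj X Y) = C.bd σ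
  /-- The homotopy for the symmetry of the unit. -/
  κ : ∀ X : C.Obj, C.Hom (E.obj X U) X (-1)
  κ_nat : (E.left U).IsNat (DGFunctor.idf C) (-1) κ
  /-- The two unit morphisms agree up to `κ`. -/
  unit_symmetry : ∀ X, C.comp₀ (ℓ X) (c X U) - r X = C.bd (κ X)
  /-- The homotopy for the compatibility of associativity and symmetry. -/
  lam : ∀ X Y Z : C.Obj, C.Hom (E.obj X (E.obj Y Z)) (E.obj (E.obj Z X) Y) (-1)
  lam_nat₁ : ∀ Y Z, (E.left (E.obj Y Z)).IsNat ((E.right Z).comp (E.left Y)) (-1)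
    fun X => lam X Y Z
  lam_nat₂ : ∀ X Z, ((E.left Z).comp (E.right X)).IsNat (E.right (E.obj Z X)) (-1)
    fun Y => lam X Y Z
  lam_nat₃ : ∀ X Y, ((E.right Y).comp (E.right X)).IsNat ((E.left X).comp (E.left Y)) (-1)
    fun Z => lam X Y Z
  /-- The hexagon commutes up to `lam`. -/
  hexagon : ∀ X Y Z,
    C.comp₀ (E.mapL Y (c X Z)) (C.comp₀ (α X Z Y) (E.mapR X (c Y Z))) -
      C.comp₀ (α Z X Y) (C.comp₀ (c (E.obj X Y) Z) (α X Y Z)) = C.bd (lam X Y Z)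

/-- A pseudo dg-tensor structure in `T`: a `2`-fold dg-bimodule `Γ` with a unit, structure morphisms
and homotopies, such that the structure morphisms become invertible on perfect modules in the
homotopy category of complexes localised at quasi-isomorphisms. -/
structure PseudoDGTensor {k : Type u} [CommRing k] (T : DGCat.{u, u} k) where
  /-- The `2`-fold dg-bimodule `Γ`. -/
  bimod : DGBimod₂ T
  /-- The unit, the structure morphisms and the homotopies. -/
  str : TensorData bimod.ext
  α_qis : ∀ X Y Z, X.IsPerfect → Y.IsPerfect → Z.IsPerfect → RMod.IsQuasiIso (str.α X Y Z)
  ℓ_qis : ∀ X, X.IsPerfect → RMod.IsQuasiIso (str.ℓ X)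
  r_qis : ∀ X, X.IsPerfect → RMod.IsQuasiIso (str.r X)
  c_qis : ∀ X Y, X.IsPerfect → Y.IsPerfect → RMod.IsQuasiIso (str.c X Y)

/-- A pseudo dg-tensor structure is perfect if its unit and the modules `Γ ⊗ X ⊗ Y`, for
perfect `X` and `Y`, are perfect. -/
structure PseudoDGTensor.IsPerfect {k : Type u} [CommRing k] {T : DGCat.{u, u} k}
    (G : PseudoDGTensor T) : Prop where
  unit : G.str.U.IsPerfect
  tensor : ∀ X Y : RMod T, X.IsPerfect → Y.IsPerfect → (G.bimod.ext.obj X Y).IsPerfect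

/-! ### The induced tensor triangulated category -/

namespace DGCat.H0

variable {k : Type u} [CommRing k] {C : DGCat.{v, u} k}

theorem cl_congr {a b : H0 C} {f g : C.Hom a.of b.of 0} (hf : C.IsClosed₀ f)
    (hg : C.IsClosed₀ g) (h : f = g) : (cl f hf : a ⟶ b) = cl g hg := by
  subst h
  rfl

theorem cl_eq_of {a b : H0 C} {f g : C.Hom a.of b.of 0} (hf : C.IsClosed₀ f)
    (hg : C.IsClosed₀ g) (η : C.Hom a.of b.of (-1)) (h : f - g = C.bd η) :
    (cl f hf : a ⟶ b) = cl g hg :=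
  (cl_eq_iff hf hg).mpr ⟨η, h⟩

/-- A closed morphism with an inverse up to homotopy is an isomorphism in the homotopy category. -/
theorem isIso_cl {a b : H0 C} (f : C.Hom a.of b.of 0) (hf : C.IsClosed₀ f)
    (h : ∃ g : C.Hom b.of a.of 0, C.IsClosed₀ g ∧
      (∃ s, C.comp₀ f g - C.id b.of = C.bd s) ∧ ∃ s, C.comp₀ g f - C.id a.of = C.bd s) :
    IsIso (cl f hf : a ⟶ b) := by
  obtain ⟨g, hg, h₁, h₂⟩ := h
  refine ⟨cl g hg, ?_, ?_⟩
  · rw [cl_comp, cl_id]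
    exact (cl_eq_iff _ _).mpr h₂
  · rw [cl_comp, cl_id]
    exact (cl_eq_iff _ _).mpr h₁

end DGCat.H0

theorem DGFunctor.IsNat.comp₀_eq {k : Type u} [CommRing k] {A : DGCat.{v₁, u} k}
    {B : DGCat.{v₂, u} k} {F G : DGFunctor A B} {θ : ∀ a, B.Hom (F.obj a) (G.obj a) 0}
    (h : F.IsNat G 0 θ) {a b : A.Obj} (f : A.Hom a b 0) :
    B.comp₀ (θ b) (F.map f) = B.comp₀ (G.map f) (θ a) := by
  have e := h (p := 0) (r := 0) (add_zero 0) (add_zero 0) f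
  rwa [zero_mul, sg_zero, one_smul] at e

/-- The stability and invertibility conditions under which the data `D` induces a symmetric monoidal
structure on the homotopy category of the full dg-subcategory on `P`. -/
structure TensorData.IsStable {k : Type u} [CommRing k] {C : DGCat.{v, u} k}
    {E : DGBifunctor C C C} (D : TensorData E) (P : C.Obj → Prop) : Prop where
  unit : P D.U
  tensor : ∀ X Y, P X → P Y → P (E.obj X Y)
  α_iso : ∀ X Y Z, P X → P Y → P Z → ∃ g, C.IsClosed₀ g ∧
    (∃ s, C.comp₀ (D.α X Y Z) g - C.id _ = C.bd s) ∧ ∃ s, C.comp₀ g (D.α X Y Z) - C.id _ = C.bd s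
  ℓ_iso : ∀ X, P X → ∃ g, C.IsClosed₀ g ∧
    (∃ s, C.comp₀ (D.ℓ X) g - C.id _ = C.bd s) ∧ ∃ s, C.comp₀ g (D.ℓ X) - C.id _ = C.bd s
  r_iso : ∀ X, P X → ∃ g, C.IsClosed₀ g ∧
    (∃ s, C.comp₀ (D.r X) g - C.id _ = C.bd s) ∧ ∃ s, C.comp₀ g (D.r X) - C.id _ = C.bd s

namespace TensorData

open DGCat

variable {k : Type u} [CommRing k] {C : DGCat.{v, u} k} {E : DGBifunctor C C C}
  (D : TensorData E) {P : C.Obj → Prop} (S : D.IsStable P)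

/-- The homotopy category of the full dg-subcategory on `P`, with the symmetric monoidal structure
induced by `D`. -/
def TT (_ : D.IsStable P) : Type v := (C.full P).H0

variable {D}

instance : Category.{u} (TT D S) := inferInstanceAs (Category (C.full P).H0)

instance : Preadditive (TT D S) := inferInstanceAs (Preadditive (C.full P).H0)

instance : Linear k (TT D S) := inferInstanceAs (Linear k (C.full P).H0)

variable {S}

/-- The tensor product of two objects. -/
def ten (X Y : TT D S) : TT D S := ⟨⟨E.obj X.of.1 Y.of.1, S.tensor _ _ X.of.2 Y.of.2⟩⟩

/-- The unit object. -/
def un : TT D S := ⟨⟨D.U, S.unit⟩⟩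

/-- The functor `E(X, -)` on the homotopy category. -/
def whL (X : TT D S) {Y Z : TT D S} (f : Y ⟶ Z) : ten X Y ⟶ ten X Z :=
  ((E.right X.of.1).restrict P P fun Y h => S.tensor X.of.1 Y X.of.2 h).mapH0.map f

/-- The functor `E(-, Y)` on the homotopy category. -/
def whR {X Z : TT D S} (f : X ⟶ Z) (Y : TT D S) : ten X Y ⟶ ten Z Y :=
  ((E.left Y.of.1).restrict P P fun X h => S.tensor X Y.of.1 h Y.of.2).mapH0.map f

/-- The class of `α`. -/
def clα (X Y Z : TT D S) : ten X (ten Y Z) ⟶ ten (ten X Y) Z :=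
  H0.cl (C := C.full P) (D.α X.of.1 Y.of.1 Z.of.1) (D.α_closed _ _ _)

/-- The class of `ℓ`. -/
def clℓ (X : TT D S) : ten un X ⟶ X :=
  H0.cl (C := C.full P) (D.ℓ X.of.1) (D.ℓ_closed _)

/-- The class of `r`. -/
def clr (X : TT D S) : ten X un ⟶ X :=
  H0.cl (C := C.full P) (D.r X.of.1) (D.r_closed _)

/-- The class of `c`. -/
def clc (X Y : TT D S) : ten X Y ⟶ ten Y X :=
  H0.cl (C := C.full P) (D.c X.of.1 Y.of.1) (D.c_closed _ _)

instance isIso_clα (X Y Z : TT D S) : IsIso (clα X Y Z) :=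
  H0.isIso_cl (C := C.full P) _ _ (S.α_iso _ _ _ X.of.2 Y.of.2 Z.of.2)

instance isIso_clℓ (X : TT D S) : IsIso (clℓ X) :=
  H0.isIso_cl (C := C.full P) _ _ (S.ℓ_iso _ X.of.2)

instance isIso_clr (X : TT D S) : IsIso (clr X) :=
  H0.isIso_cl (C := C.full P) _ _ (S.r_iso _ X.of.2)

theorem whL_id (X Y : TT D S) : whL X (𝟙 Y) = 𝟙 (ten X Y) := CategoryTheory.Functor.map_id _ _

theorem whR_id (X Y : TT D S) : whR (𝟙 X) Y = 𝟙 (ten X Y) := CategoryTheory.Functor.map_id _ _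

theorem whL_comp (X : TT D S) {Y Z W : TT D S} (f : Y ⟶ Z) (g : Z ⟶ W) :
    whL X (f ≫ g) = whL X f ≫ whL X g := Functor.map_comp _ _ _

theorem whR_comp {Y Z W : TT D S} (f : Y ⟶ Z) (g : Z ⟶ W) (X : TT D S) :
    whR (f ≫ g) X = whR f X ≫ whR g X := Functor.map_comp _ _ _

instance isIso_whL (X : TT D S) {Y Z : TT D S} (f : Y ⟶ Z) [IsIso f] : IsIso (whL X f) :=
  ⟨whL X (inv f), by rw [← whL_comp, IsIso.hom_inv_id, whL_id],
    by rw [← whL_comp, IsIso.inv_hom_id, whL_id]⟩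

instance isIso_whR {Y Z : TT D S} (f : Y ⟶ Z) [IsIso f] (X : TT D S) : IsIso (whR f X) :=
  ⟨whR (inv f) X, by rw [← whR_comp, IsIso.hom_inv_id, whR_id],
    by rw [← whR_comp, IsIso.inv_hom_id, whR_id]⟩

theorem whL_inv (X : TT D S) {Y Z : TT D S} (f : Y ⟶ Z) [IsIso f] :
    whL X (inv f) = inv (whL X f) :=
  IsIso.eq_inv_of_hom_inv_id (by rw [← whL_comp, IsIso.hom_inv_id, whL_id])

theorem whR_inv {Y Z : TT D S} (f : Y ⟶ Z) [IsIso f] (X : TT D S) :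
    whR (inv f) X = inv (whR f X) :=
  IsIso.eq_inv_of_hom_inv_id (by rw [← whR_comp, IsIso.hom_inv_id, whR_id])

theorem wh_exchange {W X Y Z : TT D S} (f : W ⟶ X) (g : Y ⟶ Z) :
    whL W g ≫ whR f Z = whR f Y ≫ whL X g := by
  obtain ⟨f, hf, rfl⟩ := H0.cl_surj (C := C.full P) f
  obtain ⟨g, hg, rfl⟩ := H0.cl_surj (C := C.full P) g
  refine H0.cl_congr (C := C.full P) _ _ ?_
  have e := E.comm (add_zero 0) (add_zero 0) f g
  rwa [zero_mul, sg_zero, one_smul] at e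

theorem clα_nat₁ {X X' : TT D S} (f : X ⟶ X') (Y Z : TT D S) :
    whR f (ten Y Z) ≫ clα X' Y Z = clα X Y Z ≫ whR (whR f Y) Z := by
  obtain ⟨f, hf, rfl⟩ := H0.cl_surj (C := C.full P) f
  exact H0.cl_congr (C := C.full P) _ _ ((D.α_nat₁ Y.of.1 Z.of.1).comp₀_eq f)

theorem clα_nat₂ {Y Y' : TT D S} (X : TT D S) (f : Y ⟶ Y') (Z : TT D S) :
    whL X (whR f Z) ≫ clα X Y' Z = clα X Y Z ≫ whR (whL X f) Z := by
  obtain ⟨f, hf, rfl⟩ := H0.cl_surj (C := C.full P) f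
  exact H0.cl_congr (C := C.full P) _ _ ((D.α_nat₂ X.of.1 Z.of.1).comp₀_eq f)

theorem clα_nat₃ {Z Z' : TT D S} (X Y : TT D S) (f : Z ⟶ Z') :
    whL X (whL Y f) ≫ clα X Y Z' = clα X Y Z ≫ whL (ten X Y) f := by
  obtain ⟨f, hf, rfl⟩ := H0.cl_surj (C := C.full P) f
  exact H0.cl_congr (C := C.full P) _ _ ((D.α_nat₃ X.of.1 Y.of.1).comp₀_eq f)

theorem clℓ_nat {X Y : TT D S} (f : X ⟶ Y) : whL un f ≫ clℓ Y = clℓ X ≫ f := by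
  obtain ⟨f, hf, rfl⟩ := H0.cl_surj (C := C.full P) f
  exact H0.cl_congr (C := C.full P) _ _ (D.ℓ_nat.comp₀_eq f)

theorem clr_nat {X Y : TT D S} (f : X ⟶ Y) : whR f un ≫ clr Y = clr X ≫ f := by
  obtain ⟨f, hf, rfl⟩ := H0.cl_surj (C := C.full P) f
  exact H0.cl_congr (C := C.full P) _ _ (D.r_nat.comp₀_eq f)

theorem clc_nat₁ {X Y : TT D S} (f : X ⟶ Y) (Z : TT D S) :
    whR f Z ≫ clc Y Z = clc X Z ≫ whL Z f := by
  obtain ⟨f, hf, rfl⟩ := H0.cl_surj (C := C.full P) f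
  exact H0.cl_congr (C := C.full P) _ _ ((D.c_nat₁ Z.of.1).comp₀_eq f)

theorem clc_nat₂ (X : TT D S) {Y Z : TT D S} (f : Y ⟶ Z) :
    whL X f ≫ clc X Z = clc X Y ≫ whR f X := by
  obtain ⟨f, hf, rfl⟩ := H0.cl_surj (C := C.full P) f
  exact H0.cl_congr (C := C.full P) _ _ ((D.c_nat₂ X.of.1).comp₀_eq f)

theorem cl_pentagon (X Y Z W : TT D S) :
    clα X Y (ten Z W) ≫ clα (ten X Y) Z W =
      (whL X (clα Y Z W) ≫ clα X (ten Y Z) W) ≫ whR (clα X Y Z) W :=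
  H0.cl_eq_of (C := C.full P) _ _ _ (D.pentagon X.of.1 Y.of.1 Z.of.1 W.of.1)

theorem cl_triangle (X Y : TT D S) : clα X un Y ≫ whR (clr X) Y = whL X (clℓ Y) :=
  H0.cl_eq_of (C := C.full P) _ _ _ (D.triangle X.of.1 Y.of.1)

theorem cl_symmetry (X Y : TT D S) : clc X Y ≫ clc Y X = 𝟙 (ten X Y) := by
  obtain ⟨σ, h⟩ := D.symmetry X.of.1 Y.of.1
  exact H0.cl_eq_of (C := C.full P) _ _ σ h

theorem cl_hexagon (X Y Z : TT D S) :
    (whL X (clc Y Z) ≫ clα X Z Y) ≫ whR (clc X Z) Y =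
      (clα X Y Z ≫ clc (ten X Y) Z) ≫ clα Z X Y :=
  H0.cl_eq_of (C := C.full P) _ _ _ (D.hexagon X.of.1 Y.of.1 Z.of.1)

theorem cl_pentagon' (W X Y Z : TT D S) :
    whR (inv (clα W X Y)) Z ≫ inv (clα W (ten X Y) Z) ≫ whL W (inv (clα X Y Z)) =
      inv (clα (ten W X) Y Z) ≫ inv (clα W X (ten Y Z)) := by
  rw [whR_inv, whL_inv, ← IsIso.inv_comp, ← IsIso.inv_comp, ← IsIso.inv_comp]
  exact IsIso.inv_eq_inv.mpr (cl_pentagon W X Y Z).symm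

theorem cl_assoc_nat {X₁ X₂ X₃ Y₁ Y₂ Y₃ : TT D S} (f₁ : X₁ ⟶ Y₁) (f₂ : X₂ ⟶ Y₂)
    (f₃ : X₃ ⟶ Y₃) :
    (whR (whR f₁ X₂ ≫ whL Y₁ f₂) X₃ ≫ whL (ten Y₁ Y₂) f₃) ≫ inv (clα Y₁ Y₂ Y₃) =
      inv (clα X₁ X₂ X₃) ≫ whR f₁ (ten X₂ X₃) ≫ whL Y₁ (whR f₂ X₃ ≫ whL Y₂ f₃) := by
  rw [IsIso.eq_inv_comp, ← Category.assoc, IsIso.comp_inv_eq, whR_comp, whL_comp]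
  simp only [Category.assoc]
  rw [clα_nat₃, reassoc_of% (clα_nat₂ Y₁ f₂ X₃), reassoc_of% (clα_nat₁ f₁ X₂ X₃)]

theorem cl_hexagon' (X Y Z : TT D S) :
    inv (clα X Y Z) ≫ clc X (ten Y Z) ≫ inv (clα Y Z X) =
      whR (clc X Y) Z ≫ inv (clα Y X Z) ≫ whL Y (clc X Z) := by
  have i : ∀ A B : TT D S, IsIso (clc A B) :=
    fun A B => ⟨clc B A, cl_symmetry A B, cl_symmetry B A⟩
  have h : ∀ A B : TT D S, clc A B = inv (clc B A) :=
    fun A B => IsIso.eq_inv_of_hom_inv_id (cl_symmetry B A)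
  rw [h X (ten Y Z), h X Y, h X Z, whR_inv, whL_inv, ← IsIso.inv_comp, ← IsIso.inv_comp,
    ← IsIso.inv_comp, ← IsIso.inv_comp]
  exact IsIso.inv_eq_inv.mpr (cl_hexagon Y Z X).symm

/-- The monoidal structure: `X ⊗ Y = E(X, Y)`, the associator is the inverse of the class of `α`,
the unitors are the classes of `ℓ` and `r`. -/
noncomputable instance instMonoidalTT : MonoidalCategory (TT D S) where
  tensorObj := ten
  whiskerLeft X _ _ f := whL X f
  whiskerRight f Y := whR f Y
  tensorHom {X₁ Y₁ X₂ Y₂} f g := whR f X₂ ≫ whL Y₁ g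
  tensorUnit := un
  associator X Y Z := (asIso (clα X Y Z)).symm
  leftUnitor X := asIso (clℓ X)
  rightUnitor X := asIso (clr X)
  tensorHom_def _ _ := rfl
  id_tensorHom_id X Y := by rw [whL_id, whR_id, Category.comp_id]
  tensorHom_comp_tensorHom {X₁ Y₁ Z₁ X₂ Y₂ Z₂} f₁ f₂ g₁ g₂ := by
    rw [whR_comp, whL_comp, Category.assoc, Category.assoc,
      reassoc_of% (wh_exchange g₁ f₂)]
  whiskerLeft_id X Y := whL_id X Y
  id_whiskerRight X Y := whR_id X Y
  associator_naturality f₁ f₂ f₃ := cl_assoc_nat f₁ f₂ f₃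
  leftUnitor_naturality f := clℓ_nat f
  rightUnitor_naturality f := clr_nat f
  pentagon W X Y Z := cl_pentagon' W X Y Z
  triangle X Y := (IsIso.inv_comp_eq _).mpr (cl_triangle X Y).symm

/-- The symmetry is the class of `c`. -/
noncomputable instance instSymmetricTT : SymmetricCategory (TT D S) where
  braiding X Y := ⟨clc X Y, clc Y X, cl_symmetry X Y, cl_symmetry Y X⟩
  braiding_naturality_right X _ _ f := clc_nat₂ X f
  braiding_naturality_left f Z := clc_nat₁ f Z
  hexagon_forward X Y Z := cl_hexagon' X Y Z
  hexagon_reverse X Y Z :=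
    ((Category.assoc _ _ _).symm.trans (cl_hexagon X Y Z).symm).trans (Category.assoc _ _ _)
  symmetry X Y := cl_symmetry X Y

end TensorData

namespace PseudoDGTensor

variable {k : Type u} [CommRing k] {T : DGCat.{u, u} k}

theorem IsPerfect.isStable {G : PseudoDGTensor T} (hG : G.IsPerfect) :
    G.str.IsStable RMod.IsPerfect where
  unit := hG.unit
  tensor := hG.tensor
  α_iso X Y Z hX hY hZ := (G.α_qis X Y Z hX hY hZ).exists_inv (G.str.α_closed X Y Z)
    (hG.tensor _ _ hX (hG.tensor _ _ hY hZ)).1 (hG.tensor _ _ (hG.tensor _ _ hX hY) hZ).1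
  ℓ_iso X hX := (G.ℓ_qis X hX).exists_inv (G.str.ℓ_closed X) (hG.tensor _ _ hG.unit hX).1 hX.1
  r_iso X hX := (G.r_qis X hX).exists_inv (G.str.r_closed X) (hG.tensor _ _ hX hG.unit).1 hX.1

/-- The tensor triangulated category induced by a perfect pseudo dg-tensor structure: the homotopy
category `H⁰(T̂_pe)`, with its shift and distinguished triangles, and with the symmetric monoidal
structure given by `Γ ⊗ X ⊗ Y`, `U` and the classes of `α`, `ℓ`, `r`, `c`. -/
abbrev TTCat (G : PseudoDGTensor T) (hG : G.IsPerfect) : Type (u + 1) :=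
  TensorData.TT G.str hG.isStable

/-- Two perfect pseudo dg-tensor structures are tensor triangulated equivalent if the tensor
triangulated categories which they induce are equivalent: there is a `k`-linear exact symmetric
monoidal equivalence between them. -/
def TensorTriangulatedEquivalent (G L : PseudoDGTensor T) (hG : G.IsPerfect)
    (hL : L.IsPerfect) : Prop :=
  ∃ F : TTCat G hG ⥤ TTCat L hL,
    F.IsEquivalence ∧ F.Additive ∧ F.Linear k ∧ RMod.IsExact (T := T) F ∧ Nonempty F.Braided

end PseudoDGTensor

/-! ### Pseudo dg-tensor functors -/

/-- The structure morphisms and homotopies of a pseudo dg-tensor functor whose underlying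
dg-functor is `F`. -/
structure TensorFunctorData {k : Type u} [CommRing k] {C : DGCat.{v, u} k}
    {E E' : DGBifunctor C C C} (D : TensorData E) (D' : TensorData E') (F : DGFunctor C C) where
  /-- The morphism `u : U → F(U')`. -/
  u : C.Hom D.U (F.obj D'.U) 0
  /-- The morphism `f : E(F(X), F(Y)) → F(E'(X, Y))`. -/
  f : ∀ X Y : C.Obj, C.Hom (E.obj (F.obj X) (F.obj Y)) (F.obj (E'.obj X Y)) 0
  f_nat₁ : ∀ Y, (F.comp (E.left (F.obj Y))).IsNat ((E'.left Y).comp F) 0 fun X => f X Y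
  f_nat₂ : ∀ X, (F.comp (E.right (F.obj X))).IsNat ((E'.right X).comp F) 0 fun Y => f X Y
  u_closed : C.IsClosed₀ u
  f_closed : ∀ X Y, C.IsClosed₀ (f X Y)
  /-- The homotopy for the units. -/
  w : ∀ X : C.Obj, C.Hom (E.obj D.U (F.obj X)) (F.obj X) (-1)
  w_nat : (F.comp (E.right D.U)).IsNat F (-1) w
  /-- `f` and `u` are compatible with the left unit morphisms, up to `w`. -/
  unit : ∀ X, C.comp₀ (F.map (D'.ℓ X)) (C.comp₀ (f D'.U X) (E.mapL (F.obj X) u)) -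
    D.ℓ (F.obj X) = C.bd (w X)
  /-- The homotopy for the symmetries. -/
  e : ∀ X Y : C.Obj, C.Hom (E.obj (F.obj X) (F.obj Y)) (F.obj (E'.obj Y X)) (-1)
  e_nat₁ : ∀ Y, (F.comp (E.left (F.obj Y))).IsNat ((E'.right Y).comp F) (-1) fun X => e X Y
  e_nat₂ : ∀ X, (F.comp (E.right (F.obj X))).IsNat ((E'.left X).comp F) (-1) fun Y => e X Y
  /-- `f` is compatible with the symmetries, up to `e`. -/
  symmetry : ∀ X Y, C.comp₀ (F.map (D'.c X Y)) (f X Y) -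
    C.comp₀ (f Y X) (D.c (F.obj X) (F.obj Y)) = C.bd (e X Y)
  /-- The homotopy for the associativity morphisms. -/
  a : ∀ X Y Z : C.Obj, C.Hom (E.obj (F.obj X) (E.obj (F.obj Y) (F.obj Z)))
    (F.obj (E'.obj (E'.obj X Y) Z)) (-1)
  a_nat₁ : ∀ Y Z, (F.comp (E.left (E.obj (F.obj Y) (F.obj Z)))).IsNat
    (((E'.left Y).comp (E'.left Z)).comp F) (-1) fun X => a X Y Z
  a_nat₂ : ∀ X Z, ((F.comp (E.left (F.obj Z))).comp (E.right (F.obj X))).IsNat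
    (((E'.right X).comp (E'.left Z)).comp F) (-1) fun Y => a X Y Z
  a_nat₃ : ∀ X Y, ((F.comp (E.right (F.obj Y))).comp (E.right (F.obj X))).IsNat
    ((E'.right (E'.obj X Y)).comp F) (-1) fun Z => a X Y Z
  /-- `f` is compatible with the associativity morphisms, up to `a`. -/
  assoc : ∀ X Y Z,
    C.comp₀ (f (E'.obj X Y) Z) (C.comp₀ (E.mapL (F.obj Z) (f X Y))
        (D.α (F.obj X) (F.obj Y) (F.obj Z))) -
      C.comp₀ (F.map (D'.α X Y Z)) (C.comp₀ (f X (E'.obj Y Z))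
        (E.mapR (F.obj X) (f Y Z))) = C.bd (a X Y Z)

/-- A pseudo dg-tensor functor between `Γ` and `Λ`: a dg-bimodule `Φ` over `T_pe`, with morphisms
`u : U → Φ ⊗ U'` and `f : Γ(Φ ⊗ X, Φ ⊗ Y) → Φ ⊗ Λ(X, Y)` which become invertible in the homotopy
category, and which satisfy the coherence conditions up to given homotopies. Here `Φ ⊗ X` is the
tensor product over `T` of the right module `X` with the bimodule `Φ`. -/
structure PseudoDGTensorFunctor {k : Type u} [CommRing k] {T : DGCat.{u, u} k}
    (G L : PseudoDGTensor T) where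
  /-- The dg-bimodule `Φ`. -/
  bimod : DGBimod T
  perfect : ∀ X : RMod T, X.IsPerfect → (RMod.tens X bimod).IsPerfect
  /-- The structure morphisms and the homotopies. -/
  str : TensorFunctorData G.str L.str (RMod.tensFunctor bimod)
  u_qis : RMod.IsQuasiIso str.u
  f_qis : ∀ X Y, X.IsPerfect → Y.IsPerfect → RMod.IsQuasiIso (str.f X Y)

namespace DGBimod

variable {k : Type u} [CommRing k] {T : DGCat.{u, u} k}

/-- There is a quasi-isomorphism of bimodules from `Φ` to `Ψ`. -/
def HasQuasiIso (Φ Ψ : DGBimod T) : Prop :=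
  ∃ θ : ∀ a, (RMod.cat T).Hom (Φ.obj a) (Ψ.obj a) 0,
    Φ.IsNat Ψ 0 θ ∧ ∀ a, (RMod.cat T).IsClosed₀ (θ a) ∧ RMod.IsQuasiIso (θ a)

/-- The tensor product over `T` of the bimodules `Φ` and `Ψ`; one has
`X ⊗ (Φ ⊗ Ψ) = (X ⊗ Φ) ⊗ Ψ` for every right module `X`. -/
noncomputable def tensor (Φ Ψ : DGBimod T) : DGBimod T := Φ.comp (RMod.tensFunctor Ψ)

/-- `Φ` is invertible under the tensor product of bimodules: there is a bimodule `Φ'` over `T_pe`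
such that `Φ ⊗ Φ'` and `Φ' ⊗ Φ` are isomorphic to the identity bimodule in the derived category of
bimodules, i.e. connected to it by zigzags of quasi-isomorphisms. -/
def IsInvertible (Φ : DGBimod T) : Prop :=
  ∃ Φ' : DGBimod T, (∀ X : RMod T, X.IsPerfect → (RMod.tens X Φ').IsPerfect) ∧
    Relation.EqvGen HasQuasiIso (Φ.tensor Φ') (DGBimod.one T) ∧
    Relation.EqvGen HasQuasiIso (Φ'.tensor Φ) (DGBimod.one T)

end DGBimod

/-! The functor `X ↦ X ⊗ Φ` goes from the category of `Λ` to that of `Γ`, since `f` has the form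
`Γ(Φ(X), Φ(Y)) → Φ(Λ(X, Y))`. On `H⁰` the homotopies `w`, `e`, `a` turn the coherence conditions
into equations, and `u` and `f`, being quasi-isomorphisms between h-projective modules, become
invertible. Hence the functor is symmetric monoidal. Right unitality is not part of the data; it
follows from left unitality and the symmetry (`cl_unit_right`).

The main work is to show that an inverse bimodule `Φ'` gives a quasi-inverse on `H⁰(T̂_pe)`. The
bimodules inside a zigzag from `Φ ⊗ Φ'` to the identity bimodule need not send perfect modules to
perfect, or even h-projective, modules, so the arrows of the zigzag need not become invertible in
the homotopy category. They are therefore compared through the functors `P ↦ [P, X ⊗ Ψ]`, with `P`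
and `X` perfect. A quasi-isomorphism induces a bijection on `[P, -]` for `P` h-projective
(`IsHProj.bijective_comp_cl`), and a quasi-isomorphism of bimodules stays one after tensoring with
an h-projective `X` (`IsHProj.isQuasiIso_tensMapR`). So these functors do not change along the
zigzag, up to isomorphism. At the two ends, associativity of the tensor product and `X ⊗ T ≅ X`
identify them with those of `(X ⊗ Φ) ⊗ Φ'` and of `X`, and full faithfulness of Yoneda turns the
result into an isomorphism of endofunctors (`nonempty_peFunctor_comp_iso`).

The second fact says that h-projective modules are h-flat (`IsHProj.tens_acyclic`). Let `E` be the
character module of `k`, an injective cogenerator. Linear maps `(X ⊗ C)(z) → E` are the same as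
morphisms from `X` to `a ↦ Hom(C(a)(z), E)`. If every `C(a)` is acyclic, the latter module is
acyclic by injectivity, so every closed morphism from `X` to it is a boundary; since `E` separates
points, `X ⊗ C` is acyclic. This is applied to the cone of a morphism of bimodules.

Exactness holds for every dg-functor preserving perfect modules. A cone is an object with four maps
subject to equations (`DGCat.ConeData`); dg-functors preserve such data, and the data determine the
object up to isomorphism. Shifts are handled in the same way through the closed isomorphism `M[1] →
M` of degree `1`.

The equivalence asked for goes from `Γ` to `Λ`, so it is `X ↦ X ⊗ Φ'`: exact and `k`-linear because
it comes from a dg-functor, and symmetric monoidal as the inverse of a symmetric monoidal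
equivalence. -/

namespace DGFunctor

/-! ### Linearity of `H⁰` and natural transformations from dg-natural families. -/

variable {k : Type u} [CommRing k] {A : DGCat.{v₁, u} k} {B : DGCat.{v₂, u} k}

instance mapH0_additive (F : DGFunctor A B) : F.mapH0.Additive where
  map_add {a b x y} := map_add ((A.boundaries a.of b.of).mapQ
    (B.boundaries (F.obj a.of) (F.obj b.of)) (F.map.restrict fun _ hf => F.closed_map hf) _) x y

instance mapH0_linear (F : DGFunctor A B) : F.mapH0.Linear k where
  map_smul {a b} x r := map_smul ((A.boundaries a.of b.of).mapQ
    (B.boundaries (F.obj a.of) (F.obj b.of)) (F.map.restrict fun _ hf => F.closed_map hf) _) r x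

/-- The natural transformation of homotopy functors induced by a closed dg-natural family of
degree `0`. -/
def natH0 {F G : DGFunctor A B} {θ : ∀ a, B.Hom (F.obj a) (G.obj a) 0} (hθ : F.IsNat G 0 θ)
    (hc : ∀ a, B.IsClosed₀ (θ a)) : F.mapH0 ⟶ G.mapH0 where
  app a := DGCat.H0.cl (θ a.of) (hc a.of)
  naturality a b x := by
    obtain ⟨x, hx, rfl⟩ := DGCat.H0.cl_surj x
    exact DGCat.H0.cl_congr _ _ (hθ.comp₀_eq x)

end DGFunctor

/-! ### Cones in a dg-category -/

/-- The structure of a cone of `φ : M → N` on the object `K`: a decomposition of `K` as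
`N ⊕ M[1]` whose differential is twisted by `φ`. -/
structure DGCat.ConeData {k : Type u} [CommRing k] (C : DGCat.{v, u} k) {M N : C.Obj}
    (φ : C.Hom M N 0) (K : C.Obj) where
  i : C.Hom N K 0
  j : C.Hom M K (-1)
  p : C.Hom K N 0
  q : C.Hom K M 1
  d_i : C.d 0 1 (zero_add 1) i = 0
  d_j : C.d (-1) 0 (by norm_num) j = C.comp (add_zero 0) i φ
  d_p : C.d 0 1 (zero_add 1) p = -C.comp (zero_add 1) φ q
  d_q : C.d 1 2 (by norm_num) q = 0
  p_i : C.comp (add_zero 0) p i = C.id N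
  p_j : C.comp (zero_add (-1)) p j = 0
  q_i : C.comp (add_zero 1) q i = 0
  q_j : C.comp (show (1 : ℤ) + -1 = 0 by norm_num) q j = C.id M
  sum : C.comp (add_zero 0) i p + C.comp (show (-1 : ℤ) + 1 = 0 by norm_num) j q = C.id K

namespace DGCat.ConeData

variable {k : Type u} [CommRing k] {C : DGCat.{v₁, u} k} {B : DGCat.{v₂, u} k}

/-- The image of a cone under a dg-functor. -/
def map (F : DGFunctor C B) {M N K : C.Obj} {φ : C.Hom M N 0} (c : C.ConeData φ K) :
    B.ConeData (F.map φ) (F.obj K) where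
  i := F.map c.i
  j := F.map c.j
  p := F.map c.p
  q := F.map c.q
  d_i := by rw [← F.map_d, c.d_i, map_zero]
  d_j := by rw [← F.map_d, c.d_j, F.map_comp]
  d_p := by rw [← F.map_d, c.d_p, map_neg, F.map_comp]
  d_q := by rw [← F.map_d, c.d_q, map_zero]
  p_i := by rw [← F.map_comp, c.p_i, F.map_id]
  p_j := by rw [← F.map_comp, c.p_j, map_zero]
  q_i := by rw [← F.map_comp, c.q_i, map_zero]
  q_j := by rw [← F.map_comp, c.q_j, F.map_id]
  sum := by rw [← F.map_comp, ← F.map_comp, ← map_add, c.sum, F.map_id]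

variable {M N K K' : C.Obj} {φ : C.Hom M N 0}

/-- The comparison morphism between two cones. -/
def compare (c : C.ConeData φ K) (c' : C.ConeData φ K') : C.Hom K K' 0 :=
  C.comp (add_zero 0) c'.i c.p + C.comp (show (-1 : ℤ) + 1 = 0 by norm_num) c'.j c.q

/-- The two summands are not closed separately: the differential of `p` contributes `-i' φ q`, that
of `j'` contributes `i' φ q`, and these cancel. -/
theorem closed_compare (c : C.ConeData φ K) (c' : C.ConeData φ K') :
    C.IsClosed₀ (c.compare c') := by
  unfold IsClosed₀ compare
  rw [map_add, C.d_comp (add_zero 0) (zero_add 1) (zero_add 1) (zero_add 1) (by norm_num)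
    (by norm_num), C.d_comp (p' := 0) (q' := 2) _ (by norm_num) (by norm_num) (zero_add 1)
    (by norm_num) (by norm_num), c'.d_i, c.d_p, c'.d_j, c.d_q, sg_zero, one_smul,
    C.assoc (add_zero 0) (zero_add 1) (zero_add 1) (zero_add 1)]
  simp

theorem compare_comp_i (c : C.ConeData φ K) (c' : C.ConeData φ K') :
    C.comp (add_zero 0) (c.compare c') c.i = c'.i := by
  unfold compare
  rw [map_add, LinearMap.add_apply,
    C.assoc (add_zero 0) (add_zero 0) (add_zero 0) (add_zero 0), c.p_i, C.comp_id,
    C.assoc (show (-1 : ℤ) + 1 = 0 by norm_num) (add_zero 0) (add_zero 1)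
      (show (-1 : ℤ) + 1 = 0 by norm_num), c.q_i, map_zero, add_zero]

theorem compare_comp_j (c : C.ConeData φ K) (c' : C.ConeData φ K') :
    C.comp (zero_add (-1)) (c.compare c') c.j = c'.j := by
  unfold compare
  rw [map_add, LinearMap.add_apply,
    C.assoc (add_zero 0) (zero_add (-1)) (zero_add (-1)) (zero_add (-1)), c.p_j, map_zero,
    C.assoc (show (-1 : ℤ) + 1 = 0 by norm_num) (zero_add (-1))
      (show (1 : ℤ) + -1 = 0 by norm_num) (add_zero (-1)), c.q_j, C.comp_id, zero_add]

/-- Compatibility of the comparison with the projections to `M[1]`; it yields the third square in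
the comparison of cone triangles. -/
theorem q_comp_compare (c : C.ConeData φ K) (c' : C.ConeData φ K') :
    C.comp (add_zero 1) c'.q (c.compare c') = c.q := by
  unfold compare
  rw [map_add, ← C.assoc (add_zero 1) (add_zero 1) (add_zero 0) (add_zero 1), c'.q_i, map_zero,
    LinearMap.zero_apply, ← C.assoc (show (1 : ℤ) + -1 = 0 by norm_num) (zero_add 1)
      (show (-1 : ℤ) + 1 = 0 by norm_num) (add_zero 1), c'.q_j, C.id_comp, zero_add]

theorem compare_compare (c : C.ConeData φ K) (c' : C.ConeData φ K') :
    C.comp₀ (c'.compare c) (c.compare c') = C.id K := by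
  unfold comp₀
  -- Only the inner comparison is expanded. The outer one carries `i`, `j` of `c'` to those of `c`,
  -- which leaves the decomposition of the identity of `K`.
  conv_lhs => enter [2]; unfold compare
  rw [map_add, ← C.assoc (add_zero 0) (add_zero 0) (add_zero 0) (add_zero 0), compare_comp_i,
    ← C.assoc (zero_add (-1)) (show (-1 : ℤ) + 1 = 0 by norm_num)
      (show (-1 : ℤ) + 1 = 0 by norm_num) (add_zero 0), compare_comp_j, c.sum]

/-- Two cones of the same morphism are isomorphic in the homotopy category. -/
def iso (c : C.ConeData φ K) (c' : C.ConeData φ K') : (⟨K⟩ : C.H0) ≅ ⟨K'⟩ where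
  hom := H0.cl (c.compare c') (c.closed_compare c')
  inv := H0.cl (c'.compare c) (c'.closed_compare c)
  hom_inv_id := H0.cl_congr _ _ (c.compare_compare c')
  inv_hom_id := H0.cl_congr _ _ (c'.compare_compare c)

end DGCat.ConeData

/-! ### Standard cones and shifts inside the dg-category of modules. -/

namespace RMod

variable {k : Type u} [CommRing k] {T : DGCat.{u, u} k}

section Cone

variable {M N : RMod T} (φ : homSub M N 0) (hφ : (cat T).IsClosed₀ φ)

/-- The inclusion `M → cone φ` of degree `-1`. -/
def coneInr : (cat T).Hom M (cone φ hφ) (-1) :=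
  ⟨fun a s => LinearMap.prod 0 (M.cst (show s.1.1 = s.1.2 + 1 by have := s.2; omega)), by
    intro a b i j q r s h h₁ h₂ h₃ x f
    refine Prod.ext ?_ (M.cst_act (show r = s + 1 by omega) (show i = j + 1 by omega) _ _ x f)
    change (0 : N.X a s) = N.act _ 0 f
    simp⟩

/-- The standard cone is a cone in the dg-category of right dg-modules. -/
def coneData : (cat T).ConeData φ (cone φ hφ) where
  i := coneIn φ hφ
  j := coneInr φ hφ
  p := coneFst φ hφ
  q := (cat T).comp (add_zero 1) M.unshift (conePr φ hφ)
  d_i := closed_coneIn φ hφ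
  d_j := by
    refine hom_ext fun a i j hj x => ?_
    obtain rfl : i = j := by omega
    rw [homD_apply _ _ _ _ a i i (i + 1) (i - 1) hj rfl (by omega) (by omega) (by omega),
      homComp_apply _ _ _ _ _ _ a i i i hj (by omega) (by omega), sg_neg_one]
    refine Prod.ext ?_ ?_
    · change N.d (i - 1) i _ 0 + app φ a (i - 1 + 1) i _ (M.cst _ x) - (-1 : k) • 0 =
        app φ a i i _ x
      -- The degree `i - 1 + 1` equals `i` only propositionally; replacing it by a variable allows
      -- the transport to be eliminated by substitution.
      have e : ∀ (j : ℤ) (h : i = j) (h' : 0 + j = i), app φ a j i h' (M.cst h x) =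
          app φ a i i (zero_add i) x := by
        intro j h h'
        subst h
        rfl
      rw [e]
      simp
    · change -M.d (i - 1 + 1) (i + 1) _ (M.cst _ x) - (-1 : k) • M.cst _ (M.d i (i + 1) _ x) = 0
      rw [M.d_cst _ (rfl : i + 1 = i + 1) rfl]
      simp [cst_rfl]
  d_p := d_coneFst φ hφ
  d_q := by
    have h := closed_conePr φ hφ
    unfold DGCat.IsClosed₀ at h
    rw [(cat T).d_comp (add_zero 1) (p' := 2) (q' := 1) (by norm_num) (zero_add 1) (by norm_num)
      (by norm_num) (by norm_num), d_unshift, h]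
    simp
  p_i := coneFst_coneIn φ hφ
  p_j := by
    refine hom_ext fun a i j hj x => ?_
    rw [homComp_apply _ _ _ _ _ _ a i j j hj (by omega) (by omega)]
    rfl
  q_i := by
    have h := conePr_coneIn φ hφ
    unfold DGCat.comp₀ at h
    rw [(cat T).assoc (add_zero 1) (add_zero 1) (add_zero 0) (add_zero 1), h, map_zero]
  q_j := by
    refine hom_ext fun a i j hj x => ?_
    obtain rfl : i = j := by omega
    rw [homComp_apply _ _ _ _ _ _ a i i (i - 1) hj (by omega) (by omega),
      homComp_apply _ _ _ _ _ _ a (i - 1) i (i - 1) (by omega) (by omega) (by omega)]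
    change M.cst (show i - 1 + 1 = i by omega) (M.cst (show i = i - 1 + 1 by omega) x) = x
    have e : ∀ (j : ℤ) (h : i = j) (h' : j = i), M.cst h' (M.cst h x) = x := by
      intro j h h'
      subst h
      rfl
    exact e _ _ _
  sum := by
    refine hom_ext fun a i j hj x => ?_
    obtain rfl : i = j := by omega
    rw [app_add, homComp_apply _ _ _ _ _ _ a i i i hj (by omega) (by omega),
      homComp_apply _ _ _ _ _ _ a i i (i + 1) hj (by omega) (by omega),
      homComp_apply _ _ _ _ _ _ a i (i + 1) i (by omega) (by omega) (by omega)]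
    refine Prod.ext ?_ ?_
    · change x.1 + 0 = x.1
      rw [add_zero]
    · change 0 + x.2 = x.2
      rw [zero_add]

end Cone

theorem unshift_toShift (M : RMod T) :
    (cat T).comp (show (1 : ℤ) + -1 = 0 by norm_num) M.unshift M.toShift = (cat T).id M := by
  refine hom_ext fun a i j hj x => ?_
  obtain rfl : i = j := by omega
  rw [homComp_apply _ _ _ _ _ _ a i i (i - 1) hj (by omega) (by omega)]
  change M.cst (show i - 1 + 1 = i by omega) (M.cst (show i = i - 1 + 1 by omega) x) = x
  have e : ∀ (j : ℤ) (h : i = j) (h' : j = i), M.cst h' (M.cst h x) = x := by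
    intro j h h'
    subst h
    rfl
  exact e _ _ _

/-- The shift of a morphism of degree `0`. -/
def shiftMap {M N : RMod T} (φ : (cat T).Hom M N 0) : (cat T).Hom M.shift N.shift 0 :=
  (shiftFunctor T).map φ

/-- The shift of `φ` carries the sign `(-1)^|φ|`, which is trivial in degree `0`, so `unshift` is
strictly natural here. -/
theorem unshift_shiftMap {M N : RMod T} (φ : (cat T).Hom M N 0) :
    (cat T).comp (add_zero 1) N.unshift (shiftMap φ) =
      (cat T).comp (zero_add 1) φ M.unshift := by
  refine hom_ext fun a i j hj x => ?_
  obtain rfl : j = i + 1 := by omega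
  rw [homComp_apply _ _ _ _ _ _ a i (i + 1) i hj (by omega) (by omega),
    homComp_apply _ _ _ _ _ _ a i (i + 1) (i + 1) hj (by omega) (by omega)]
  change sg k 0 • app φ a (i + 1) (i + 1) _ x = app φ a (i + 1) (i + 1) _ x
  rw [sg_zero, one_smul]

/-! ### Dg-functors between categories of modules are exact -/

section Exact

variable (F : DGFunctor (cat T) (cat T))

/-- The canonical morphism `F(M[1]) → F(M)[1]`. -/
def shiftComparison (M : RMod T) : (cat T).Hom (F.obj M.shift) (F.obj M).shift 0 :=
  (cat T).comp (show (-1 : ℤ) + 1 = 0 by norm_num) (F.obj M).toShift (F.map M.unshift)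

/-- The inverse of the canonical morphism `F(M[1]) → F(M)[1]`. -/
def shiftComparisonInv (M : RMod T) : (cat T).Hom (F.obj M).shift (F.obj M.shift) 0 :=
  (cat T).comp (show (-1 : ℤ) + 1 = 0 by norm_num) (F.map M.toShift) (F.obj M).unshift

theorem closed_shiftComparison (M : RMod T) : (cat T).IsClosed₀ (shiftComparison F M) := by
  unfold DGCat.IsClosed₀ shiftComparison
  rw [(cat T).d_comp _ (p' := 0) (q' := 2) (by norm_num) (by norm_num) (zero_add 1)
    (by norm_num) (by norm_num), d_toShift, ← F.map_d, d_unshift]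
  simp

theorem closed_shiftComparisonInv (M : RMod T) :
    (cat T).IsClosed₀ (shiftComparisonInv F M) := by
  unfold DGCat.IsClosed₀ shiftComparisonInv
  rw [(cat T).d_comp _ (p' := 0) (q' := 2) (by norm_num) (by norm_num) (zero_add 1)
    (by norm_num) (by norm_num), d_unshift, ← F.map_d, d_toShift]
  simp

/-- This characterises the comparison, because `unshift` is invertible. With `unshift_cancel` it
reduces identities about the comparison to identities about `F.map M.unshift`. -/
theorem unshift_shiftComparison (M : RMod T) :
    (cat T).comp (add_zero 1) (F.obj M).unshift (shiftComparison F M) = F.map M.unshift := by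
  unfold shiftComparison
  rw [← (cat T).assoc (show (1 : ℤ) + -1 = 0 by norm_num) (zero_add 1) _ (add_zero 1),
    unshift_toShift, (cat T).id_comp]

theorem shiftComparison_inv (M : RMod T) :
    (cat T).comp₀ (shiftComparison F M) (shiftComparisonInv F M) = (cat T).id _ := by
  unfold DGCat.comp₀ shiftComparison shiftComparisonInv
  rw [(cat T).assoc _ (add_zero 0) (add_zero 1) (show (-1 : ℤ) + 1 = 0 by norm_num),
    ← (cat T).assoc (show (1 : ℤ) + -1 = 0 by norm_num) (zero_add 1) _ (add_zero 1),
    ← F.map_comp, unshift_toShift, F.map_id, (cat T).id_comp, toShift_unshift]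

theorem shiftComparisonInv_hom (M : RMod T) :
    (cat T).comp₀ (shiftComparisonInv F M) (shiftComparison F M) = (cat T).id _ := by
  unfold DGCat.comp₀ shiftComparisonInv
  rw [(cat T).assoc _ (add_zero 0) (add_zero 1) (show (-1 : ℤ) + 1 = 0 by norm_num),
    unshift_shiftComparison, ← F.map_comp, toShift_unshift, F.map_id]

/-- A morphism to `M[1]` is determined by its composite with `M[1] → M`. -/
theorem unshift_cancel {M N : RMod T} {f g : (cat T).Hom N M.shift 0}
    (h : (cat T).comp (add_zero 1) M.unshift f = (cat T).comp (add_zero 1) M.unshift g) :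
    f = g := by
  have h' := congrArg
    ((cat T).comp (show (-1 : ℤ) + 1 = 0 by norm_num) M.toShift) h
  rwa [← (cat T).assoc (show (-1 : ℤ) + 1 = 0 by norm_num) (zero_add 0) _ _,
    ← (cat T).assoc (show (-1 : ℤ) + 1 = 0 by norm_num) (zero_add 0) _ _,
    toShift_unshift, (cat T).id_comp, (cat T).id_comp] at h'

/-- After composition with `unshift`, both sides become the image under `F` of the composite `M[1] →
M → N`. -/
theorem shiftComparison_nat {M N : RMod T} (φ : (cat T).Hom M N 0) :
    (cat T).comp₀ (shiftComparison F N) (F.map (shiftMap φ)) =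
      (cat T).comp₀ (shiftMap (F.map φ)) (shiftComparison F M) := by
  unfold DGCat.comp₀
  refine unshift_cancel ?_
  rw [← (cat T).assoc (add_zero 1) (add_zero 1) (add_zero 0) (add_zero 1),
    ← (cat T).assoc (add_zero 1) (add_zero 1) (add_zero 0) (add_zero 1),
    unshift_shiftComparison, unshift_shiftMap,
    (cat T).assoc (zero_add 1) (add_zero 1) (add_zero 1) (zero_add 1), unshift_shiftComparison,
    ← F.map_comp, ← F.map_comp, unshift_shiftMap]

theorem shiftComparison_comp {Z A M : RMod T} (x : (cat T).Hom A M 0)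
    (h : (cat T).Hom Z A.shift 0) :
    (cat T).comp₀ (shiftMap (F.map x)) ((cat T).comp₀ (shiftComparison F A) (F.map h)) =
      (cat T).comp₀ (shiftComparison F M) (F.map ((cat T).comp₀ (shiftMap x) h)) := by
  have e := shiftComparison_nat F x
  unfold DGCat.comp₀ at e ⊢
  rw [← (cat T).assoc (add_zero 0) (add_zero 0) (add_zero 0) (add_zero 0), ← e, F.map_comp,
    (cat T).assoc (add_zero 0) (add_zero 0) (add_zero 0) (add_zero 0)]

variable (hF : ∀ M : RMod T, M.IsPerfect → (F.obj M).IsPerfect)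

/-- The functor on `H⁰(T̂_pe)` induced by a dg-functor which preserves perfect modules. -/
abbrev peFunctor : (pe T).H0 ⥤ (pe T).H0 := (F.restrict IsPerfect IsPerfect hF).mapH0

/-- A dg-functor on right dg-modules commutes with the shifts. -/
def shiftIso : shiftPe T ⋙ peFunctor F hF ≅ peFunctor F hF ⋙ shiftPe T :=
  NatIso.ofComponents
    (fun X =>
      { hom := DGCat.H0.cl (C := pe T) (shiftComparison F X.of.1) (closed_shiftComparison F _)
        inv := DGCat.H0.cl (C := pe T) (shiftComparisonInv F X.of.1)
          (closed_shiftComparisonInv F _)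
        hom_inv_id := DGCat.H0.cl_congr (C := pe T) _ _ (shiftComparisonInv_hom F X.of.1)
        inv_hom_id := DGCat.H0.cl_congr (C := pe T) _ _ (shiftComparison_inv F X.of.1) })
    (by
      intro X Y x
      obtain ⟨x, hx, rfl⟩ := DGCat.H0.cl_surj (C := pe T) x
      exact DGCat.H0.cl_congr (C := pe T) _ _ (shiftComparison_nat F x))

/-- The isomorphism between `F(cone φ)` and `cone F(φ)` respects the projections to the shifts, up
to `F(M[1]) ≅ F(M)[1]`. Composing with `unshift` reduces this to `q_comp_compare`. -/
theorem conePr_compare {M N : RMod T} (φ : homSub M N 0) (hφ : (cat T).IsClosed₀ φ) :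
    (cat T).comp₀ (conePr (F.map φ) (F.closed_map hφ))
        (((coneData φ hφ).map F).compare (coneData (F.map φ) (F.closed_map hφ))) =
      (cat T).comp₀ (shiftComparison F M) (F.map (conePr φ hφ)) := by
  unfold DGCat.comp₀
  refine unshift_cancel ?_
  rw [← (cat T).assoc (add_zero 1) (add_zero 1) (add_zero 0) (add_zero 1),
    ← (cat T).assoc (add_zero 1) (add_zero 1) (add_zero 0) (add_zero 1),
    unshift_shiftComparison, ← F.map_comp]
  exact ((coneData φ hφ).map F).q_comp_compare (coneData (F.map φ) (F.closed_map hφ))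

/-- This prepares the third square of the image triangle. The module `M` of the model triangle need
not be perfect, so the shift isomorphism on perfect modules has to be exchanged for the comparison
at `M` in the homotopy category of all modules. -/
theorem incl_map_shiftIso {X Z : (pe T).H0} {M : RMod T} (h : Z ⟶ (shiftPe T).obj X)
    (x : (⟨X.of.1⟩ : (cat T).H0) ⟶ ⟨M⟩) :
    (incl T).map ((peFunctor F hF).map h ≫ (shiftIso F hF).hom.app X) ≫
      (shiftFunctor T).mapH0.map (F.mapH0.map x) =
    F.mapH0.map ((incl T).map h ≫ (shiftFunctor T).mapH0.map x) ≫
      (DGCat.H0.cl (shiftComparison F M) (closed_shiftComparison F M) :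
        F.mapH0.obj ⟨M.shift⟩ ⟶ ⟨(F.obj M).shift⟩) := by
  obtain ⟨x, hx, rfl⟩ := DGCat.H0.cl_surj x
  obtain ⟨h, hh, rfl⟩ := DGCat.H0.cl_surj (C := pe T) h
  exact DGCat.H0.cl_congr _ _ (shiftComparison_comp F x h)

set_option maxHeartbeats 1000000 in
/-- A dg-functor on right dg-modules preserves the distinguished triangles. -/
theorem isExact_peFunctor : IsExact (peFunctor F hF) := by
  refine ⟨shiftIso F hF, ?_⟩
  rintro X Y Z f g h ⟨M, N, φ, hφ, a, b, c, h₁, h₂, h₃⟩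
  have e : ∀ {X Y : (pe T).H0} (f : X ⟶ Y),
      (incl T).map ((peFunctor F hF).map f) = F.mapH0.map ((incl T).map f) := by
    intro X Y f
    obtain ⟨f, hf, rfl⟩ := DGCat.H0.cl_surj f
    rfl
  -- The diagram chases for arbitrary arrows: `s₁` applies `F` to a square, `s₂` extends a square by
  -- the comparison of cones, and `s₃` inserts both comparisons, of cones and of shifts, in the last
  -- square.
  have s₁ : ∀ {A B A' B' : (cat T).H0} {f : A ⟶ B} {b : B ⟶ B'} {a : A ⟶ A'} {φ : A' ⟶ B'},
      f ≫ b = a ≫ φ →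
        F.mapH0.map f ≫ F.mapH0.map b = F.mapH0.map a ≫ F.mapH0.map φ := by
    intro A B A' B' f b a φ h
    rw [← F.mapH0.map_comp, h, F.mapH0.map_comp]
  have s₂ : ∀ {A B A' B' B'' : (cat T).H0} {f : A ⟶ B} {b : B ⟶ B'} {a : A ⟶ A'} {φ : A' ⟶ B'}
      {κ : B' ⟶ B''} {ψ : A' ⟶ B''}, f ≫ b = a ≫ φ → φ ≫ κ = ψ → f ≫ b ≫ κ = a ≫ ψ := by
    intro A B A' B' B'' f b a φ κ ψ h h'
    rw [← Category.assoc, h, Category.assoc, h']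
  have s₃ : ∀ {A A' B' : (cat T).H0} {A'' C' : (cat T).H0} {c : A ⟶ A'} {φ : A' ⟶ B'}
      {ξ : F.mapH0.obj B' ⟶ C'} {κ : F.mapH0.obj A' ⟶ A''} {ψ : A'' ⟶ C'},
      κ ≫ ψ = F.mapH0.map φ ≫ ξ →
        F.mapH0.map (c ≫ φ) ≫ ξ = (F.mapH0.map c ≫ κ) ≫ ψ := by
    intro A A' B' A'' C' c φ ξ κ ψ h
    rw [F.mapH0.map_comp, Category.assoc, Category.assoc, h]
  refine ⟨F.obj M, F.obj N, F.map φ, F.closed_map hφ, F.mapH0.mapIso a, F.mapH0.mapIso b,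
    F.mapH0.mapIso c ≪≫ ((coneData φ hφ).map F).iso (coneData (F.map φ) (F.closed_map hφ)),
    ?_, ?_, ?_⟩
  · rw [e]
    exact s₁ h₁
  · rw [e]
    exact s₂ (s₁ h₂) (DGCat.H0.cl_congr _ _ (DGCat.ConeData.compare_comp_i _ _))
  · refine (incl_map_shiftIso F hF h a.hom).trans ?_
    rw [h₃]
    let κ := ((coneData φ hφ).map F).iso (coneData (F.map φ) (F.closed_map hφ))
    have t : κ.hom ≫
        DGCat.H0.cl (conePr (F.map φ) (F.closed_map hφ)) (closed_conePr _ _) =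
        F.mapH0.map (DGCat.H0.cl (conePr φ hφ) (closed_conePr φ hφ) :
          (⟨cone φ hφ⟩ : (cat T).H0) ⟶ ⟨M.shift⟩) ≫
          (DGCat.H0.cl (shiftComparison F M) (closed_shiftComparison F M) :
            F.mapH0.obj ⟨M.shift⟩ ⟶ ⟨(F.obj M).shift⟩) :=
      DGCat.H0.cl_congr _ _ (conePr_compare F φ hφ)
    exact s₃ (c := c.hom) (φ := DGCat.H0.cl (conePr φ hφ) (closed_conePr φ hφ)) (κ := κ.hom) t

end Exact

end RMod

/-! ### Characters with values in an injective cogenerator -/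

section Character

variable {k : Type u} [CommRing k]

/-- Linear forms with values in the character module of `k` separate points from submodules. -/
theorem exists_character_separating {M : Type u} [AddCommGroup M] [Module k M]
    (S : Submodule k M) {m : M} (hm : m ∉ S) :
    ∃ f : M →ₗ[k] CharacterModule k, (∀ s ∈ S, f s = 0) ∧ f m ≠ 0 := by
  have hm' : S.mkQ m ≠ 0 := fun h => hm ((Submodule.Quotient.mk_eq_zero S).mp h)
  obtain ⟨c, hc⟩ := CharacterModule.exists_character_apply_ne_zero_of_ne_zero hm'
  -- A `k`-linear map to the character module of `k` is an additive character of `(M ⧸ S) ⊗ k ≅ M ⧸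
  -- S`, curried; evaluating it at `1` recovers `c`.
  refine ⟨CharacterModule.curry (CharacterModule.dual (TensorProduct.rid k (M ⧸ S)).toLinearMap c)
    ∘ₗ S.mkQ, fun s hs => ?_, fun h => hc ?_⟩
  · have : S.mkQ s = 0 := (Submodule.Quotient.mk_eq_zero S).mpr hs
    rw [LinearMap.comp_apply, this, map_zero]
  · have h' := DFunLike.congr_fun h (1 : k)
    change c (TensorProduct.rid k (M ⧸ S) (S.mkQ m ⊗ₜ[k] (1 : k))) = 0 at h'
    rwa [TensorProduct.rid_tmul, one_smul] at h'

/-- A linear form which vanishes on the kernel of a linear map factors through it. -/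
theorem exists_character_factor {A B : Type u} [AddCommGroup A] [Module k A] [AddCommGroup B]
    [Module k B] (g : A →ₗ[k] B) (f : A →ₗ[k] CharacterModule k)
    (h : ∀ a, g a = 0 → f a = 0) : ∃ f' : B →ₗ[k] CharacterModule k, ∀ a, f' (g a) = f a := by
  -- Since `k` is flat over itself, its character module is injective. The form `f` descends to `A ⧸
  -- ker g`, which embeds in `B`, and extends from there.
  have hE : Module.Baer k (CharacterModule k) := Module.Flat.iff_characterModule_baer.mp inferInstance
  obtain ⟨f', hf'⟩ := hE.extension_property ((LinearMap.ker g).liftQ g le_rfl)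
    (LinearMap.ker_eq_bot.mp (Submodule.ker_liftQ_eq_bot _ _ _ le_rfl))
    ((LinearMap.ker g).liftQ f fun a ha => h a ha)
  exact ⟨f', fun a => LinearMap.congr_fun hf' (Submodule.Quotient.mk a)⟩

end Character

namespace RMod

variable {k : Type u} [CommRing k] {T : DGCat.{u, u} k}

/-! ### h-projective modules are h-flat -/

/-- The right dg-module of characters `a ↦ Hom(C(a)(z), E)`. -/
@[reducible] noncomputable def charMod (C : DGBimod T) (z : T.Obj) : RMod T where
  X a n := (C.obj a).X z (-n) →ₗ[k] CharacterModule k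
  -- The Hom-complex differential `ν ↦ -(-1)^|ν| ν ∘ d` for a target concentrated in degree `0`;
  -- forms of degree `n` live on elements of degree `-n`.
  d {a} n m h := -sg k n •
    LinearMap.lcomp k (CharacterModule k) ((C.obj a).d (-m) (-n) (by omega))
  d_d n m l h h' ν := by
    ext1 γ
    simp [(C.obj _).d_d]
  act {a b p q r} h := LinearMap.mk₂ k
    (fun ν f => ν ∘ₗ app (C.map f) z (-r) (-p) (by omega))
    (by intros; ext1; simp) (by intros; ext1; simp)
    (by intros; ext1; simp [app_add]) (by intros; ext1; simp [app_smul])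
  act_id {a n} h ν := by
    ext1 γ
    simp [C.map_id, homId_apply]
  act_comp {a b c p q r pq qr s} h₁ h₂ h₃ h₄ ν g f := by
    ext1 γ
    simp only [LinearMap.mk₂_apply, LinearMap.comp_apply]
    rw [C.map_comp]
    exact congrArg ν (homComp_apply _ _ _ h₃ _ _ z (-s) (-p) (-pq) _ _ _ γ).symm
  d_act {a b p q r p' q' r'} h hp hq hr h₁ h₂ ν f := by
    ext1 γ
    have e := app_map_d C hq f z (-r') (-r) (-p') (-p) (by omega) (by omega) (by omega)
      (by omega) (by omega) γ
    have hs : sg k r = sg k p * sg k q := by rw [← sg_add, h]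
    simp only [LinearMap.mk₂_apply, LinearMap.comp_apply, LinearMap.smul_apply,
      LinearMap.lcomp_apply, LinearMap.add_apply, hs]
    rw [e, map_add, map_smul]
    module

/-- A closed form vanishes on boundaries, hence, by exactness of `C(a)(z)`, on the kernel of `d`. It
therefore factors through `d`, by injectivity of the character module. -/
theorem charMod_acyclic {C : DGBimod T} (hC : ∀ a, (C.obj a).IsAcyclic) (z : T.Obj) :
    (charMod C z).IsAcyclic := by
  intro a n m l h h' ν hν
  have hν' : ∀ γ, ν ((C.obj a).d (-l) (-m) (by omega) γ) = 0 := by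
    intro γ
    have e := LinearMap.congr_fun hν γ
    change -sg k m • ν ((C.obj a).d (-l) (-m) _ γ) = 0 at e
    have e' := congrArg (fun x => -sg k m • x) e
    simpa [smul_smul, sg_mul_self] using e'
  obtain ⟨ν', h₁⟩ := exists_character_factor ((C.obj a).d (-m) (-n) (by omega)) ν (by
    intro γ hγ
    obtain ⟨y, rfl⟩ := hC a z (-l) (-m) (-n) (by omega) (by omega) γ hγ
    exact hν' y)
  -- The scalar squares to `1` and so cancels the sign in the differential of `charMod`.
  refine ⟨-sg k n • ν', ?_⟩
  ext1 γ
  change -sg k n • (-sg k n • ν') ((C.obj a).d (-m) (-n) _ γ) = ν γ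
  rw [LinearMap.smul_apply, h₁, smul_smul, neg_mul_neg, sg_mul_self, one_smul]

end RMod

/-! ### Duality between `X ⊗ C` and the module of characters. -/

namespace RMod

variable {k : Type u} [CommRing k] {T : DGCat.{u, u} k}

theorem app_cst {M N : RMod T} {n : ℤ} (φ : homSub M N n) (a : T.Obj) {i i' j j' : ℤ}
    (hi : i = i') (hj : j = j') (h : n + i = j) (h' : n + i' = j') (x : M.X a i) :
    app φ a i' j' h' (M.cst hi x) = N.cst hj (app φ a i j h x) := by
  subst hi hj
  rfl

/-- The morphism `X → Hom(C(-)(z), E)` adjoint to a linear form on `(X ⊗ C)(z)`. -/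
noncomputable def charCurry (X : RMod T) (C : DGBimod T) (z : T.Obj) {m n : ℤ} (hm : n + m = 0)
    (χ : (tens X C).X z m →ₗ[k] CharacterModule k) : homSub X (charMod C z) n :=
  ⟨fun a s => (LinearMap.lcomp k (CharacterModule k) LinearMap.id).comp
      ((el X C (z := z) a s.1.1 (-s.1.2) (by have := s.2; omega)).compr₂ χ), by
    intro a b i j q r s h h₁ h₂ h₃ x f
    ext1 γ
    exact congrArg χ (el_act X C h₁ (show q + -s = -j by omega) (show r + -s = m by omega)
      (show i + -j = m by omega) x f γ)⟩

theorem charCurry_apply (X : RMod T) (C : DGBimod T) (z : T.Obj) {m n : ℤ} (hm : n + m = 0)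
    (χ : (tens X C).X z m →ₗ[k] CharacterModule k) (a : T.Obj) (i j : ℤ) (hij : n + i = j)
    (x : X.X a i) (γ : (C.obj a).X z (-j)) :
    (app (charCurry X C z hm χ) a i j hij x : (C.obj a).X z (-j) →ₗ[k] CharacterModule k) γ =
      χ (el X C a i (-j) (by omega) x γ) := rfl

theorem charCurry_injective (X : RMod T) (C : DGBimod T) (z : T.Obj) {m n : ℤ}
    (hm : n + m = 0) {χ χ' : (tens X C).X z m →ₗ[k] CharacterModule k}
    (h : charCurry X C z hm χ = charCurry X C z hm χ') : χ = χ' := by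
  refine LinearMap.ext fun v => el_ind _ _ v fun t i j hij x γ => ?_
  -- The curried morphism takes values in forms on elements of degree `-p`; every degree is of this
  -- shape.
  obtain ⟨p, rfl⟩ : ∃ p, j = -p := ⟨-j, by omega⟩
  have e := congrArg (fun u => (app u t i p (by omega) x :
    (C.obj t).X z (-p) →ₗ[k] CharacterModule k) γ) h
  exact e

/-- The linear form on `(X ⊗ C)(z)` adjoint to a morphism `X → Hom(C(-)(z), E)`. -/
theorem exists_charUncurry (X : RMod T) (C : DGBimod T) (z : T.Obj) {m n : ℤ} (hm : n + m = 0)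
    (ψ : homSub X (charMod C z) n) :
    ∃ χ : (tens X C).X z m →ₗ[k] CharacterModule k, charCurry X C z hm χ = ψ := by
  -- A form of degree `-j` is defined on elements of degree `- -j`, so an element of degree `j` must
  -- be transported before evaluation. The value does not depend on how the degree is written.
  have hc : ∀ (a : T.Obj) (i j j' : ℤ) (h : n + i = j) (h' : n + i = j') (x : X.X a i) (l : ℤ)
      (hl : l = -j) (hl' : l = -j') (γ : (C.obj a).X z l),
      (app ψ a i j h x : (C.obj a).X z (-j) →ₗ[k] CharacterModule k) ((C.obj a).cst hl γ) =
      (app ψ a i j' h' x : (C.obj a).X z (-j') →ₗ[k] CharacterModule k)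
        ((C.obj a).cst hl' γ) := by
    intro a i j j' h h' x l hl hl' γ
    obtain rfl : j = j' := by omega
    rfl
  refine ⟨tensLift X C (fun t i j hij => LinearMap.compl₂
    (M := X.X t i) (N := (C.obj t).X z (- -j)) (P := CharacterModule k)
    (app ψ t i (-j) (by omega)) ((C.obj t).cst (show j = - -j by omega))) ?_, ?_⟩
  · intro a b i q j r l h₁ h₂ h₃ h₄ x f γ
    have e := app_act ψ a b i (-l) q r (-j) (by omega) h₁ (by omega) (by omega) x f
    have e' := LinearMap.congr_fun e ((C.obj a).cst (show j = - -j by omega) γ)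
    refine e'.trans ?_
    exact congrArg (app ψ b i (-l) _ x : (C.obj b).X z (- -l) →ₗ[k] CharacterModule k)
      (app_cst (C.map f) z _ (show l = - -l by omega) h₂ _ γ)
  · refine hom_ext fun a i j hj x => ?_
    ext1 γ
    refine (charCurry_apply X C z hm _ a i j hj x γ).trans ?_
    refine (tensLift_tmk X C _ _ a i (-j) (by omega) x γ).trans ?_
    exact hc a i _ j _ hj x (-j) (by omega) rfl γ

/-- Currying is compatible with differentials. In `d(x ⊗ γ) = dx ⊗ γ + (-1)^|x| x ⊗ dγ`, the first
term matches precomposition with the differential of `X`, the second the differential of the forms.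
-/
theorem homD_charCurry (X : RMod T) (C : DGBimod T) (z : T.Obj) {m m' n n' : ℤ}
    (hm : n + m = 0) (hm' : n' + m' = 0) (hn : n + 1 = n') (hmm : m' + 1 = m)
    (χ : (tens X C).X z m →ₗ[k] CharacterModule k) :
    homD X (charMod C z) n n' hn (charCurry X C z hm χ) =
      charCurry X C z hm' (-sg k n • χ ∘ₗ (tens X C).d m' m hmm) := by
  refine hom_ext fun a i j hj x => ?_
  rw [homD_apply _ _ hn _ a i j (i + 1) (n + i) hj rfl rfl (by omega) (by omega)]
  ext1 γ
  refine Eq.trans ?_ (congrArg (fun w => -sg k n • χ w)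
    (d_el X C hmm a i (-j) (i + 1) (-j + 1) (by omega) rfl rfl (by omega) (by omega) x γ)).symm
  change -sg k (n + i) • χ (el X C a i (-(n + i)) _ x ((C.obj a).d (-j) (-(n + i)) _ γ)) -
    sg k n • χ (el X C a (i + 1) (-j) _ (X.d i (i + 1) rfl x) γ) = -sg k n • χ _
  -- Needed for `l = -(n + i)`, which agrees with `-j + 1` only propositionally.
  have e : ∀ (l : ℤ) (h : -j + 1 = l) (h' : i + l = m),
      χ (el X C a i l h' x ((C.obj a).d (-j) l h γ)) =
      χ (el X C a i (-j + 1) (by omega) x ((C.obj a).d (-j) (-j + 1) rfl γ)) := by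
    intro l h h'
    subst h
    rfl
  rw [e, map_add, map_smul, sg_add]
  module

/-- The tensor product of an h-projective module with an acyclic bimodule is acyclic. -/
theorem IsHProj.tens_acyclic {X : RMod T} (hX : X.IsHProj) {C : DGBimod T}
    (hC : ∀ a, (C.obj a).IsAcyclic) : (tens X C).IsAcyclic := by
  intro z n m l h h' w hw
  by_contra hn
  -- If the cocycle `w` were not a boundary, some character would vanish on all boundaries but not
  -- at `w`.
  obtain ⟨χ, hχ, hχw⟩ := exists_character_separating (LinearMap.range ((tens X C).d n m h))
    (m := w) hn
  -- A form on the degree `m` part curries to a morphism of degree `-m`, closed because the form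
  -- kills boundaries; h-projectivity of `X` then gives a primitive of degree `-m - 1`.
  obtain ⟨ψ, hψ⟩ := hX _ (charMod_acyclic hC z) (-m - 1) (-m) (-m + 1) (by omega) (by omega)
    (charCurry X C z (by omega) χ) (by
      refine (homD_charCurry X C z (m' := n) (by omega) (by omega) rfl h χ).trans ?_
      have : χ ∘ₗ (tens X C).d n m h = 0 := by
        exact LinearMap.ext fun y => hχ _ ⟨y, rfl⟩
      rw [this, smul_zero]
      rfl)
  -- The primitive uncurries to `χ'` with `χ = ± χ' ∘ d`; since `dw = 0`, this forces `χ w = 0`.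
  obtain ⟨χ', rfl⟩ := exists_charUncurry X C z (m := l) (n := -m - 1) (by omega) ψ
  refine hχw ?_
  have e := (homD_charCurry X C z (m' := m) _ (by omega) (by omega) h' χ').symm.trans hψ
  have e' : -sg k (-m - 1) • χ' ∘ₗ (tens X C).d m l h' = χ := by
    exact charCurry_injective X C z _ e
  rw [← e', LinearMap.smul_apply, LinearMap.comp_apply, hw, map_zero, smul_zero]

end RMod

/-! ### Quasi-isomorphisms detected by acyclic cones. -/

namespace RMod

variable {k : Type u} [CommRing k] {T : DGCat.{u, u} k}

/-- A closed morphism with an acyclic cone is a quasi-isomorphism. -/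
theorem isQuasiIso_of_acyclic {M N K : RMod T} {φ : homSub M N 0} (c : (cat T).ConeData φ K)
    (hK : K.IsAcyclic) : IsQuasiIso φ := by
  -- The identities of the cone data, read on elements.
  have di : ∀ (a : T.Obj) (n m : ℤ) (h : n + 1 = m) (y : N.X a n),
      K.d n m h (app c.i a n n (by omega) y) = app c.i a m m (by omega) (N.d n m h y) :=
    fun a n m h y => app_d₀ c.d_i a n m h y
  have dj : ∀ (a : T.Obj) (n m l : ℤ) (h : n + 1 = m) (h' : m + 1 = l) (x : M.X a m),
      K.d n m h (app c.j a m n (by omega) x) =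
        app c.i a m m (by omega) (app φ a m m (by omega) x) -
          app c.j a l m (by omega) (M.d m l h' x) := by
    intro a n m l h h' x
    have e := app_d (show (-1 : ℤ) + 1 = 0 by norm_num) c.j a m l n m h' (by omega) h (by omega)
      (by omega) x
    have e' : homD M K (-1) 0 (by norm_num) c.j = homComp M N K (add_zero 0) c.i φ := c.d_j
    rw [e, e', homComp_apply _ _ _ _ _ _ a m m m (by omega) (by omega) (by omega), sg_neg_one,
      neg_one_smul, sub_eq_add_neg]
  have dq : ∀ (a : T.Obj) (n m l : ℤ) (h : n + 1 = m) (h' : m + 1 = l) (w : K.X a n),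
      app c.q a m l (by omega) (K.d n m h w) = -M.d m l h' (app c.q a n m (by omega) w) := by
    intro a n m l h h' w
    have e := app_d (show (1 : ℤ) + 1 = 2 by norm_num) c.q a n m m l h (by omega) h' (by omega)
      (by omega) w
    have e' : homD K M 1 2 (by norm_num) c.q = 0 := c.d_q
    rw [e, e', app_zero, sg_one, zero_add, neg_one_smul, neg_neg]
  have dp : ∀ (a : T.Obj) (n m : ℤ) (h : n + 1 = m) (w : K.X a n),
      app c.p a m m (by omega) (K.d n m h w) = N.d n m h (app c.p a n n (by omega) w) +
        app φ a m m (by omega) (app c.q a n m (by omega) w) := by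
    intro a n m h w
    have e := app_d (zero_add 1) c.p a n m n m h (by omega) h (by omega) (by omega) w
    have e' : homD K N 0 1 (zero_add 1) c.p = (-1 : k) • homComp K M N (zero_add 1) φ c.q :=
      c.d_p.trans (neg_one_smul k _).symm
    rw [e, e', app_smul, homComp_apply _ _ _ _ _ _ a n m m (by omega) (by omega) (by omega),
      sg_zero, neg_one_smul, one_smul]
    abel
  have pi : ∀ (a : T.Obj) (n : ℤ) (y : N.X a n),
      app c.p a n n (by omega) (app c.i a n n (by omega) y) = y := by
    intro a n y
    have e := congrArg (fun f => app f a n n (by omega) y) c.p_i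
    exact (homComp_apply _ _ _ (add_zero 0) _ _ a n n n _ _ _ y).symm.trans e
  have qi : ∀ (a : T.Obj) (n m : ℤ) (h : 1 + n = m) (y : N.X a n),
      app c.q a n m h (app c.i a n n (by omega) y) = 0 := by
    intro a n m h y
    have e := congrArg (fun f => app f a n m h y) c.q_i
    exact (homComp_apply _ _ _ (add_zero 1) _ _ a n m n _ _ _ y).symm.trans e
  have qj : ∀ (a : T.Obj) (n m : ℤ) (h : 1 + n = m) (x : M.X a m),
      app c.q a n m h (app c.j a m n (by omega) x) = x := by
    intro a n m h x
    have e := congrArg (fun f => app f a m m (by omega) x) c.q_j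
    exact (homComp_apply _ _ _ (show (1 : ℤ) + -1 = 0 by norm_num) _ _ a m m n _ _ _ x).symm.trans e
  intro a n m l h h'
  constructor
  · rintro x hx ⟨y, hy⟩
    -- When `dx = 0` and `φ x = dy`, the element `j x - i y` is a cocycle of `K`. If it equals `dw`,
    -- applying `q` shows that `-q w` is a primitive of `x`.
    obtain ⟨w, hw⟩ := hK a (n - 1) n m (by omega) h
      (app c.j a m n (by omega) x - app c.i a n n (by omega) y) (by
        rw [map_sub, dj a n m l h h', di, hx, hy, map_zero, sub_zero, sub_self])
    refine ⟨-app c.q a (n - 1) n (by omega) w, ?_⟩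
    rw [map_neg, ← dq a (n - 1) n m (by omega) h, hw, map_sub, qj, qi, sub_zero]
  · intro y hy
    -- For a cocycle `y`, write `i y = dw`. Applying `q` shows that `q w` is closed, and applying
    -- `p` gives `y = φ(q w) + d(p w)`.
    obtain ⟨w, hw⟩ := hK a n m l h h' (app c.i a m m (by omega) y) (by
      rw [di a m l h', hy, map_zero])
    refine ⟨app c.q a n m (by omega) w, app c.p a n n (by omega) w, ?_, ?_⟩
    · rw [← neg_eq_zero, ← dq a n m l h h', hw, qi]
    · rw [add_comm, ← dp, hw, pi]

/-! ### The cone of a morphism of bimodules -/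

section ConeBimod

variable {Φ Ψ : DGBimod T} {θ : ∀ a, (cat T).Hom (Φ.obj a) (Ψ.obj a) 0} (hθ : Φ.IsNat Ψ 0 θ)
  (hc : ∀ a, (cat T).IsClosed₀ (θ a))

theorem app_nat₀ {Φ Ψ : DGBimod T} {θ : ∀ a, (cat T).Hom (Φ.obj a) (Ψ.obj a) 0}
    (hθ : Φ.IsNat Ψ 0 θ) {a b : T.Obj} {n : ℤ} (f : T.Hom a b n) (z : T.Obj) (i j : ℤ) (h : n + i = j)
    (x : (Φ.obj a).X z i) : app (θ b) z j j (zero_add j) (app (Φ.map f) z i j h x) =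
      app (Ψ.map f) z i j h (app (θ a) z i i (zero_add i) x) := by
  have e := congrArg (fun u => app u z i j h x) (hθ (zero_add n) (add_zero n) f)
  rw [zero_mul, sg_zero, one_smul] at e
  exact ((homComp_apply _ _ _ (zero_add n) _ _ z i j j h h _ x).symm.trans e).trans
    (homComp_apply _ _ _ (add_zero n) _ _ z i j i h _ h x)

/-- The action of a morphism on the cone of a morphism of bimodules. -/
def coneBimodMap {a b : T.Obj} {n : ℤ} (f : T.Hom a b n) :
    homSub (cone (θ a) (hc a)) (cone (θ b) (hc b)) n :=
  -- The sign `(-1)^|f|` on the shifted summand is that of the shift functor.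
  ⟨fun z s => LinearMap.prodMap (app (Ψ.map f) z s.1.1 s.1.2 s.2)
      (sg k n • app (Φ.map f) z (s.1.1 + 1) (s.1.2 + 1) (by have := s.2; omega)), by
    intro c e i j q r s h h₁ h₂ h₃ x g
    refine Prod.ext (app_act (Ψ.map f) c e i j q r s h h₁ h₂ h₃ x.1 g) ?_
    have := app_act (Φ.map f) c e (i + 1) (j + 1) q (r + 1) (s + 1) (by omega) (by omega)
      (by omega) (by omega) x.2 g
    refine (congrArg (fun y => sg k n • y) this).trans ?_
    change _ = (Φ.obj b).act _ (sg k n • app (Φ.map f) e (i + 1) (j + 1) _ x.2) g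
    rw [map_smul, LinearMap.smul_apply]⟩

/-- The cone of a closed morphism of bimodules. -/
def coneBimod : DGBimod T where
  obj a := cone (θ a) (hc a)
  map {a b n} :=
    { toFun := fun f => coneBimodMap hc f
      map_add' := fun f g => by
        refine hom_ext fun z i j hj x => Prod.ext ?_ ?_
        · change app (Ψ.map (f + g)) z i j hj x.1 = _
          rw [map_add]
          rfl
        · change sg k n • app (Φ.map (f + g)) z (i + 1) (j + 1) _ x.2 = _
          rw [map_add]
          exact smul_add (sg k n) _ _
      map_smul' := fun c f => by
        refine hom_ext fun z i j hj x => Prod.ext ?_ ?_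
        · change app (Ψ.map (c • f)) z i j hj x.1 = _
          rw [map_smul]
          rfl
        · change sg k n • app (Φ.map (c • f)) z (i + 1) (j + 1) _ x.2 = _
          rw [map_smul]
          exact smul_comm (sg k n) c (app (Φ.map f) z (i + 1) (j + 1) _ x.2) }
  map_id a := by
    refine hom_ext fun z i j hj x => ?_
    obtain rfl : i = j := by omega
    refine Prod.ext ?_ ?_
    · change app (Ψ.map (T.id a)) z i i hj x.1 = x.1
      rw [Ψ.map_id]
      rfl
    · change sg k 0 • app (Φ.map (T.id a)) z (i + 1) (i + 1) _ x.2 = x.2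
      rw [Φ.map_id, sg_zero, one_smul]
      rfl
  map_comp {a b c p q r} h g f := by
    refine hom_ext fun z i j hj x => ?_
    rw [homComp_apply _ _ _ h _ _ z i j (q + i) hj rfl (by omega)]
    refine Prod.ext ?_ ?_
    · change app (Ψ.map _) z i j hj x.1 = app (Ψ.map g) z (q + i) j _ (app (Ψ.map f) z i _ _ x.1)
      rw [Ψ.map_comp]
      exact homComp_apply _ _ _ h _ _ z i j (q + i) hj rfl _ x.1
    · change sg k r • app (Φ.map _) z (i + 1) (j + 1) _ x.2 = sg k p • app (Φ.map g) z (q + i + 1)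
        (j + 1) _ (sg k q • app (Φ.map f) z (i + 1) (q + i + 1) _ x.2)
      rw [Φ.map_comp, homComp_apply _ _ _ h _ _ z (i + 1) (j + 1) (q + i + 1) (by omega)
        (by omega) (by omega), map_smul, smul_smul, ← sg_add, h]
  map_d {a b} n m h f := by
    refine hom_ext fun z i j hj x => ?_
    obtain rfl : n + i + 1 = j := by omega
    rw [homD_apply _ _ h _ z i (n + i + 1) (i + 1) (n + i) hj rfl rfl rfl (by omega)]
    have e₁ := app_map_d Ψ h f z i (i + 1) (n + i) (n + i + 1) rfl rfl rfl (by omega) hj x.1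
    have e₂ := app_map_d Φ h f z (i + 1) (i + 1 + 1) (n + i + 1) (n + i + 1 + 1) rfl (by omega)
      rfl (by omega) (by omega) x.2
    -- Naturality of `θ` makes the cross terms of the twisted differential cancel.
    have e₃ := app_nat₀ hθ f z (i + 1) (n + i + 1) (by omega) x.2
    have hs : sg k m = -sg k n := by rw [← h, sg_add, sg_one]; ring
    refine Prod.ext ?_ ?_
    · change app (Ψ.map (T.d n m h f)) z i (n + i + 1) hj x.1 =
        ((Ψ.obj b).d (n + i) (n + i + 1) _ (app (Ψ.map f) z i (n + i) _ x.1) +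
          app (θ b) z (n + i + 1) (n + i + 1) _
            (sg k n • app (Φ.map f) z (i + 1) (n + i + 1) _ x.2)) -
        sg k n • app (Ψ.map f) z (i + 1) (n + i + 1) _ ((Ψ.obj a).d i (i + 1) _ x.1 +
          app (θ a) z (i + 1) (i + 1) _ x.2)
      rw [e₁, map_smul, e₃, map_add]
      module
    · change sg k m • app (Φ.map (T.d n m h f)) z (i + 1) (n + i + 1 + 1) _ x.2 =
        -(Φ.obj b).d (n + i + 1) (n + i + 1 + 1) _
          (sg k n • app (Φ.map f) z (i + 1) (n + i + 1) _ x.2) -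
        sg k n • sg k n • app (Φ.map f) z (i + 1 + 1) (n + i + 1 + 1) _
          (-(Φ.obj a).d (i + 1) (i + 1 + 1) _ x.2)
      rw [map_smul, e₂, map_neg, hs]
      module

theorem isNat_coneIn : Ψ.IsNat (coneBimod hθ hc) 0 fun a => coneIn (θ a) (hc a) := by
  intro a b p r h h' f
  obtain rfl : p = r := by omega
  rw [zero_mul, sg_zero, one_smul]
  refine hom_ext fun z i j hj x => ?_
  refine (homComp_apply _ _ _ h _ _ z i j j hj hj (by omega) x).trans ?_
  refine Eq.trans ?_ (homComp_apply _ _ _ h' _ _ z i j i hj (by omega) hj x).symm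
  refine Prod.ext rfl ?_
  change 0 = sg k p • app (Φ.map f) z (i + 1) (j + 1) _ 0
  rw [map_zero, smul_zero]

theorem isNat_coneFst : (coneBimod hθ hc).IsNat Ψ 0 fun a => coneFst (θ a) (hc a) := by
  intro a b p r h h' f
  obtain rfl : p = r := by omega
  rw [zero_mul, sg_zero, one_smul]
  refine hom_ext fun z i j hj x => ?_
  refine (homComp_apply _ _ _ h _ _ z i j j hj hj (by omega) x).trans ?_
  refine Eq.trans ?_ (homComp_apply _ _ _ h' _ _ z i j i hj (by omega) hj x).symm
  rfl

/-- The sign `(-1)^|f|` in the action on the shifted summand is exactly the Koszul sign of a family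
of degree `-1`; the same sign serves the projection of degree `1`. -/
theorem isNat_coneInr : Φ.IsNat (coneBimod hθ hc) (-1) fun a => coneInr (θ a) (hc a) := by
  intro a b p r h h' f
  refine hom_ext fun z i j hj x => ?_
  obtain ⟨i, rfl⟩ : ∃ l, i = l + 1 := ⟨i - 1, by omega⟩
  obtain rfl : j = p + i := by omega
  refine (homComp_apply _ _ _ h _ _ z (i + 1) (p + i) (p + i + 1) hj (by omega) (by omega)
    x).trans ?_
  rw [app_smul]
  refine Eq.trans ?_ (congrArg (sg k (-1 * p) • ·)
    (homComp_apply _ _ _ h' _ _ z (i + 1) (p + i) i hj (by omega) (by omega) x).symm)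
  refine Prod.ext ?_ ?_
  · change 0 = sg k (-1 * p) • app (Ψ.map f) z i (p + i) _ 0
    rw [map_zero, smul_zero]
  · change app (Φ.map f) z (i + 1) (p + i + 1) _ x =
      sg k (-1 * p) • sg k p • app (Φ.map f) z (i + 1) (p + i + 1) _ x
    rw [smul_smul, ← sg_add, neg_one_mul, neg_add_cancel, sg_zero, one_smul]

theorem isNat_coneSnd : (coneBimod hθ hc).IsNat Φ 1 fun a =>
    (cat T).comp (add_zero 1) (Φ.obj a).unshift (conePr (θ a) (hc a)) := by
  intro a b p r h h' f
  refine hom_ext fun z i j hj x => ?_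
  obtain rfl : j = p + i + 1 := by omega
  refine (homComp_apply _ _ _ h _ _ z i (p + i + 1) (p + i) hj (by omega) (by omega) x).trans ?_
  rw [app_smul]
  refine Eq.trans ?_ (congrArg (sg k (1 * p) • ·)
    (homComp_apply _ _ _ h' _ _ z i (p + i + 1) (i + 1) hj (by omega) (by omega) x).symm)
  refine (homComp_apply _ _ _ (add_zero 1) _ _ z (p + i) (p + i + 1) (p + i) _ (by omega)
    (by omega) _).trans ?_
  refine Eq.trans ?_ (congrArg (fun y => sg k (1 * p) • app (Φ.map f) z (i + 1) (p + i + 1) _ y)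
    (homComp_apply _ _ _ (add_zero 1) _ _ z i (i + 1) i _ (by omega) (by omega) x).symm)
  change sg k p • app (Φ.map f) z (i + 1) (p + i + 1) _ x.2 =
    sg k (1 * p) • app (Φ.map f) z (i + 1) (p + i + 1) _ x.2
  rw [one_mul]

end ConeBimod

end RMod

/-! ### Operations on dg-natural families. -/

theorem DGFunctor.IsNat.comp {k : Type u} [CommRing k] {A : DGCat.{v₁, u} k}
    {B : DGCat.{v₂, u} k} {F G H : DGFunctor A B} {m n l : ℤ} (hl : m + n = l)
    {θ' : ∀ a, B.Hom (G.obj a) (H.obj a) m} {θ : ∀ a, B.Hom (F.obj a) (G.obj a) n}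
    (hθ' : G.IsNat H m θ') (hθ : F.IsNat G n θ) :
    F.IsNat H l fun a => B.comp hl (θ' a) (θ a) := by
  subst hl
  intro a b p r h h' f
  rw [B.assoc rfl h (show n + p = p + n by omega) (by omega), hθ (by omega) rfl f, map_smul,
    ← B.assoc (show m + p = p + m by omega) (show p + m + n = r by omega) rfl (by omega),
    hθ' (by omega) rfl f, map_smul, LinearMap.smul_apply, smul_smul, ← sg_add,
    B.assoc rfl (by omega) rfl h', show n * p + m * p = (m + n) * p by ring]

theorem DGFunctor.IsNat.smul {k : Type u} [CommRing k] {A : DGCat.{v₁, u} k}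
    {B : DGCat.{v₂, u} k} {F G : DGFunctor A B} {n : ℤ} (c : k)
    {θ : ∀ a, B.Hom (F.obj a) (G.obj a) n} (hθ : F.IsNat G n θ) :
    F.IsNat G n fun a => c • θ a := by
  intro a b p r h h' f
  rw [map_smul, map_smul, LinearMap.smul_apply, hθ h h' f, smul_comm]

theorem DGFunctor.isNat_zero {k : Type u} [CommRing k] {A : DGCat.{v₁, u} k}
    {B : DGCat.{v₂, u} k} (F G : DGFunctor A B) (n : ℤ) :
    F.IsNat G n fun _ => 0 := by
  intro a b p r h h' f
  simp

theorem DGFunctor.isNat_id {k : Type u} [CommRing k] {A : DGCat.{v₁, u} k}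
    {B : DGCat.{v₂, u} k} (F : DGFunctor A B) : F.IsNat F 0 fun a => B.id (F.obj a) := by
  intro a b p r h h' f
  obtain rfl : p = r := by omega
  rw [zero_mul, sg_zero, one_smul, B.id_comp, B.comp_id]

/-! ### Tensoring with quasi-isomorphisms of bimodules. -/

namespace RMod

variable {k : Type u} [CommRing k] {T : DGCat.{u, u} k}

theorem tensMapR_zero (X : RMod T) {Φ Ψ : DGBimod T} {n : ℤ}
    (κ : ∀ a, (cat T).Hom (Φ.obj a) (Ψ.obj a) n) (hκ : Φ.IsNat Ψ n κ)
    (H : ∀ a, κ a = 0) : tensMapR X κ hκ = 0 := by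
  have e := tensMapR_smul X (0 : k) κ κ hκ hκ fun a => by rw [H a, smul_zero]
  rw [e, zero_smul]

section

variable {Φ Ψ : DGBimod T} {θ : ∀ a, (cat T).Hom (Φ.obj a) (Ψ.obj a) 0} (hθ : Φ.IsNat Ψ 0 θ)

theorem tensMapR_comp_eq (X : RMod T) {Φ Ψ Ω : DGBimod T} {p q r : ℤ} (h : p + q = r)
    {θ' : ∀ a, (cat T).Hom (Ψ.obj a) (Ω.obj a) p} (hθ' : Ψ.IsNat Ω p θ')
    {θ : ∀ a, (cat T).Hom (Φ.obj a) (Ψ.obj a) q} (hθ : Φ.IsNat Ψ q θ) :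
    (cat T).comp h (tensMapR X θ' hθ') (tensMapR X θ hθ) =
      tensMapR X _ (DGFunctor.IsNat.comp h hθ' hθ) :=
  (tensMapR_comp X h θ' hθ' θ hθ _ _ fun _ => rfl).symm

/-- Tensoring with a right module sends the cone of a morphism of bimodules to a cone. -/
noncomputable def tensConeData (X : RMod T) {C : DGBimod T}
    (c : ∀ a, (cat T).ConeData (θ a) (C.obj a)) (hi : Ψ.IsNat C 0 fun a => (c a).i)
    (hj : Φ.IsNat C (-1) fun a => (c a).j) (hp : C.IsNat Ψ 0 fun a => (c a).p)
    (hq : C.IsNat Φ 1 fun a => (c a).q) :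
    (cat T).ConeData (tensMapR X θ hθ) (tens X C) where
  -- The operation `X ⊗ -` on dg-natural families respects differentials, composites, sums and
  -- scalars, so each identity is the image of the identities at the objects of `T`.
  i := tensMapR X _ hi
  j := tensMapR X _ hj
  p := tensMapR X _ hp
  q := tensMapR X _ hq
  d_i := (tensMapR_d X (zero_add 1) _ hi (fun _ => 0) (DGFunctor.isNat_zero _ _ _)
    fun a => (c a).d_i.symm).symm.trans (tensMapR_zero X _ _ fun _ => rfl)
  d_j := by
    rw [tensMapR_comp_eq]
    exact (tensMapR_d X (show (-1 : ℤ) + 1 = 0 by norm_num) _ hj _ (hi.comp (add_zero 0) hθ)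
      fun a => (c a).d_j.symm).symm
  d_p := by
    rw [tensMapR_comp_eq, ← neg_one_smul k]
    have hn := hθ.comp (zero_add 1) hq
    exact (tensMapR_d X (zero_add 1) _ hp _ (hn.smul (-1 : k)) fun a =>
      (neg_one_smul k _).trans (c a).d_p.symm).symm.trans
      (tensMapR_smul X (-1 : k) _ _ hn _ fun a => rfl)
  d_q := (tensMapR_d X (show (1 : ℤ) + 1 = 2 by norm_num) _ hq (fun _ => 0)
    (DGFunctor.isNat_zero _ _ _) fun a => (c a).d_q.symm).symm.trans
    (tensMapR_zero X _ _ fun _ => rfl)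
  p_i := (tensMapR_comp_eq X _ _ _).trans (tensMapR_id X _ _ _ fun a => (c a).p_i)
  p_j := (tensMapR_comp_eq X _ _ _).trans (tensMapR_zero X _ _ fun a => (c a).p_j)
  q_i := (tensMapR_comp_eq X _ _ _).trans (tensMapR_zero X _ _ fun a => (c a).q_i)
  q_j := (tensMapR_comp_eq X _ _ _).trans (tensMapR_id X _ _ _ fun a => (c a).q_j)
  sum := by
    rw [tensMapR_comp_eq, tensMapR_comp_eq]
    refine (tensMapR_add X _ _ _ _ _ (DGFunctor.isNat_id C)
      fun a => (c a).sum.symm).symm.trans ?_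
    exact tensMapR_id X _ _ _ fun a => rfl

/-- Tensoring an h-projective module with a quasi-isomorphism of bimodules gives a
quasi-isomorphism. -/
theorem IsHProj.isQuasiIso_tensMapR {X : RMod T} (hX : X.IsHProj)
    (hc : ∀ a, (cat T).IsClosed₀ (θ a))
    (hq : ∀ a, IsQuasiIso (θ a)) : IsQuasiIso (tensMapR X θ hθ) :=
  isQuasiIso_of_acyclic (tensConeData hθ X (C := coneBimod hθ hc)
    (fun a => coneData (θ a) (hc a)) (isNat_coneIn hθ hc) (isNat_coneInr hθ hc)
    (isNat_coneFst hθ hc) (isNat_coneSnd hθ hc))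
    (hX.tens_acyclic (C := coneBimod hθ hc) fun a => (hq a).acyclic_cone (hc a))

end

end RMod

/-! ### Comparison morphisms that are bijective in each degree. -/

namespace RMod

variable {k : Type u} [CommRing k] {T : DGCat.{u, u} k}

/-- A closed morphism with bijective components is a quasi-isomorphism. -/
theorem isQuasiIso_of_bijective {M N : RMod T} {φ : homSub M N 0} (hφ : (cat T).IsClosed₀ φ)
    (ψ : ∀ a n, N.X a n → M.X a n)
    (h₁ : ∀ a n x, ψ a n (app φ a n n (zero_add n) x) = x)
    (h₂ : ∀ a n y, app φ a n n (zero_add n) (ψ a n y) = y) : IsQuasiIso φ := by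
  have inj : ∀ a n, Function.Injective (app φ a n n (zero_add n)) :=
    fun a n => Function.LeftInverse.injective (h₁ a n)
  intro a n m l h h'
  refine ⟨?_, fun y hy => ⟨ψ a m y, 0, inj a l ?_, ?_⟩⟩
  · rintro x - ⟨y, hy⟩
    refine ⟨ψ a n y, inj a m ?_⟩
    rw [← app_d₀ hφ, h₂, hy]
  · rw [← app_d₀ hφ, h₂, hy, map_zero]
  · rw [h₂, map_zero, add_zero]

/-! ### The identity bimodule is a unit -/

/-- The right action, with values in the identity bimodule. -/
def oneAct (X : RMod T) {t z : T.Obj} {i j n : ℤ} (h : i + j = n) :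
    X.X t i →ₗ[k] ((DGBimod.one T).obj t).X z j →ₗ[k] X.X z n := X.act h

/-- The components of `x ⊗ f ↦ x · f`. -/
noncomputable def tensOneX (X : RMod T) (z : T.Obj) (n : ℤ) :
    TensX X (DGBimod.one T) z n →ₗ[k] X.X z n :=
  tensLift X (DGBimod.one T) (fun _ _ _ h => X.oneAct h)
    fun _ _ _ _ _ _ _ h₁ h₂ h₃ h₄ x f γ => X.act_comp h₁ h₃ h₂ h₄ x f γ

theorem tensOneX_tmk (X : RMod T) (z : T.Obj) (n : ℤ) (t : T.Obj) (i j : ℤ) (h : i + j = n)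
    (x : X.X t i) (f : ((DGBimod.one T).obj t).X z j) :
    tensOneX X z n (tmk X (DGBimod.one T) t i j h x f) = X.oneAct h x f :=
  tensLift_tmk _ _ _ _ _ _ _ _ _ _

/-- The morphism `x ⊗ f ↦ x · f` from the tensor product with the identity bimodule. -/
noncomputable def tensOne (X : RMod T) : homSub (tens X (DGBimod.one T)) X 0 :=
  ⟨fun z s => tensOneX X z s.1.2 ∘ₗ (tens X (DGBimod.one T)).cst
      (show s.1.1 = s.1.2 by have := s.2; omega), by
    intro a b i j q r s h h₁ h₂ h₃ w g
    obtain rfl : i = j := by omega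
    obtain rfl : r = s := by omega
    refine tens_ind (tensOneX X a r ∘ₗ (tensAct X (DGBimod.one T) h₁).flip g)
      ((X.act h₃).flip g ∘ₗ tensOneX X b i) w fun t i' j' hij x γ => ?_
    simp only [LinearMap.comp_apply, LinearMap.flip_apply]
    rw [tensAct_tmk X _ h₁ t i' j' (j' + q) hij rfl (by omega), tensOneX_tmk, tensOneX_tmk]
    exact (X.act_comp hij h₃ rfl (by omega) x γ g).symm⟩

theorem app_tensOne (X : RMod T) (z : T.Obj) (n : ℤ) (h : 0 + n = n) (t : T.Obj) (i j : ℤ)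
    (hij : i + j = n) (x : X.X t i) (f : ((DGBimod.one T).obj t).X z j) :
    app (tensOne X) z n n h (el X (DGBimod.one T) t i j hij x f) = X.oneAct hij x f :=
  tensOneX_tmk X z n t i j hij x f

theorem closed_tensOne (X : RMod T) : (cat T).IsClosed₀ (tensOne X) := by
  refine tens_hom_ext fun z p q h t i j hij x γ => ?_
  obtain rfl : p + 1 = q := by omega
  rw [homD_apply _ _ _ _ z p (p + 1) (p + 1) p h rfl (by omega) rfl (by omega),
    d_el X (DGBimod.one T) rfl t i j (i + 1) (j + 1) hij rfl rfl (by omega) (by omega), map_add,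
    map_smul, app_tensOne, app_tensOne, app_tensOne, sg_zero, one_smul]
  exact sub_eq_zero.mpr (X.d_act hij rfl (q' := j + 1) rfl rfl (by omega) (by omega) x γ)

theorem isNat_tensOne : (tensFunctor (DGBimod.one T)).IsNat (DGFunctor.idf (cat T)) 0 tensOne := by
  intro X Y p r h h' φ
  obtain rfl : p = r := by omega
  rw [zero_mul, sg_zero, one_smul]
  refine tens_hom_ext fun z m n hmn t i j hij x γ => ?_
  refine (homComp_apply _ _ _ h _ _ z m n n hmn hmn (by omega) _).trans ?_
  refine Eq.trans ?_ (homComp_apply _ _ _ h' _ _ z m n m hmn (by omega) hmn _).symm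
  refine (congrArg _ (app_tensMapL (DGBimod.one T) φ z m n hmn t i j (p + i) hij rfl (by omega)
    x γ)).trans ?_
  refine (app_tensOne Y z n _ t (p + i) j (by omega) _ γ).trans ?_
  refine Eq.trans ?_ (congrArg _ (app_tensOne X z m _ t i j hij x γ)).symm
  exact (app_act φ z t i (p + i) j m n rfl hij hmn (by omega) x γ).symm

/-- The degreewise inverse is `x ↦ x ⊗ id`, because `x ⊗ f = x · f ⊗ id` over `T`. -/
theorem isQuasiIso_tensOne (X : RMod T) : IsQuasiIso (tensOne X) := by
  let e : ∀ a : T.Obj, ((DGBimod.one T).obj a).X a 0 := fun a => T.id a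
  refine isQuasiIso_of_bijective (closed_tensOne X)
    (fun a n x => el X (DGBimod.one T) a n 0 (add_zero n) x (e a)) (fun a n w => ?_)
    fun a n x => ?_
  · refine el_ind (((el X (DGBimod.one T) a n 0 (add_zero n)).flip (e a)) ∘ₗ
      app (tensOne X) a n n (zero_add n)) LinearMap.id w fun t i j hij x γ => ?_
    rw [LinearMap.comp_apply, app_tensOne, LinearMap.flip_apply]
    refine (el_act X (DGBimod.one T) hij (add_zero j) (add_zero n) hij x γ (e a)).trans ?_
    exact congrArg (el X (DGBimod.one T) t i j hij x) (T.comp_id _ γ)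
  · rw [app_tensOne]
    exact X.act_id _ x

/-! ### Associativity of the tensor product -/

/-- The morphism `γ ↦ x ⊗ γ`. -/
noncomputable def elHom (X : RMod T) (Φ : DGBimod T) (t : T.Obj) (i : ℤ) :
    X.X t i →ₗ[k] homSub (Φ.obj t) (tens X Φ) i where
  toFun x := ⟨fun z s => el X Φ (z := z) t i s.1.1 s.2 x,
    fun a b p q r s s' h h₁ h₂ h₃ γ f => (act_el X Φ h₃ t i p s h h₁ h₂ x γ f).symm⟩
  map_add' x y := by
    refine hom_ext fun z p q h γ => ?_
    change el X Φ t i p h (x + y) γ = el X Φ t i p h x γ + el X Φ t i p h y γ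
    rw [map_add, LinearMap.add_apply]
  map_smul' c x := by
    refine hom_ext fun z p q h γ => ?_
    change el X Φ t i p h (c • x) γ = c • el X Φ t i p h x γ
    rw [map_smul, LinearMap.smul_apply]

theorem app_elHom (X : RMod T) (Φ : DGBimod T) (t : T.Obj) (i : ℤ) (x : X.X t i) (z : T.Obj)
    (p q : ℤ) (h : i + p = q) (γ : (Φ.obj t).X z p) :
    app (elHom X Φ t i x) z p q h γ = el X Φ t i p h x γ := rfl

/-- Together with `elHom_act`, this makes `x ↦ (γ ↦ x ⊗ γ)` a morphism of dg-modules `X → Hom(Φ, X ⊗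
Φ)`, the unit of the tensor-hom adjunction. The associativity map arises by applying `- ⊗ Ψ` to it,
so its properties come from functoriality. -/
theorem homD_elHom (X : RMod T) (Φ : DGBimod T) (t : T.Obj) (i j : ℤ) (h : i + 1 = j)
    (x : X.X t i) : homD _ _ i j h (elHom X Φ t i x) = elHom X Φ t j (X.d i j h x) := by
  refine hom_ext fun z p q hq γ => ?_
  rw [homD_apply _ _ h _ z p q (p + 1) (i + p) hq rfl rfl (by omega) (by omega), app_elHom,
    app_elHom, app_elHom,
    d_el X Φ (by omega) t i p j (p + 1) rfl h rfl hq (by omega), add_sub_cancel_right]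

theorem elHom_act (X : RMod T) (Φ : DGBimod T) {a b : T.Obj} {i q r : ℤ} (h : i + q = r)
    (x : X.X b i) (f : T.Hom a b q) :
    elHom X Φ a r (X.act h x f) = homComp _ _ _ h (elHom X Φ b i x) (Φ.map f) := by
  refine hom_ext fun z j n hj γ => ?_
  rw [homComp_apply _ _ _ h _ _ z j n (q + j) hj rfl (by omega), app_elHom, app_elHom,
    el_act X Φ h rfl hj]

theorem tensMapL_elHom {X Y : RMod T} (Φ : DGBimod T) {n i j : ℤ} (h : n + i = j)
    (φ : homSub X Y n) (t : T.Obj) (x : X.X t i) :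
    homComp _ _ _ h (tensMapL Φ φ) (elHom X Φ t i x) = elHom Y Φ t j (app φ t i j h x) := by
  refine hom_ext fun z p q hq γ => ?_
  rw [homComp_apply _ _ _ h _ _ z p q (i + p) hq rfl (by omega), app_elHom, app_elHom,
    app_tensMapL Φ φ z (i + p) q (by omega) t i p j rfl h hq]

/-- The balancing condition that lets the associativity map descend to the tensor product: `- ⊗ Ψ`
applied to `elHom_act`. -/
theorem tensMapL_elHom_act (X : RMod T) (Φ Ψ : DGBimod T) {a b : T.Obj} {i q r j l n : ℤ}
    (h₁ : i + q = r) (h₂ : q + j = l) (h₃ : r + j = n) (h₄ : i + l = n) {z : T.Obj}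
    (x : X.X b i) (f : T.Hom a b q) (w : (tens (Φ.obj a) Ψ).X z j) :
    app (tensMapL Ψ (elHom X Φ a r (X.act h₁ x f))) z j n h₃ w =
      app (tensMapL Ψ (elHom X Φ b i x)) z l n h₄ (app (tensMapL Ψ (Φ.map f)) z j l h₂ w) := by
  rw [elHom_act]
  have e := (tensFunctor Ψ).map_comp h₁ (elHom X Φ b i x) (Φ.map f)
  refine (congrArg (fun u => app u z j n h₃ w) e).trans ?_
  exact homComp_apply _ _ _ h₁ _ _ z j n l h₃ h₂ h₄ w

/-- The bilinear map `(x, γ ⊗ δ) ↦ (x ⊗ γ) ⊗ δ`. -/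
noncomputable def assocEl (X : RMod T) (Φ Ψ : DGBimod T) {z : T.Obj} {n : ℤ} (t : T.Obj)
    (i j : ℤ) (h : i + j = n) :
    X.X t i →ₗ[k] ((Φ.tensor Ψ).obj t).X z j →ₗ[k] (tens (tens X Φ) Ψ).X z n where
  toFun x := app (tensMapL Ψ (elHom X Φ t i x)) z j n h
  map_add' x y := by rw [map_add, map_add]; rfl
  map_smul' c x := by rw [map_smul, map_smul]; rfl

/-- The components of `x ⊗ (γ ⊗ δ) ↦ (x ⊗ γ) ⊗ δ`. -/
noncomputable def tensAssocX (X : RMod T) (Φ Ψ : DGBimod T) (z : T.Obj) (n : ℤ) :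
    TensX X (Φ.tensor Ψ) z n →ₗ[k] (tens (tens X Φ) Ψ).X z n :=
  tensLift X (Φ.tensor Ψ) (fun t i j h => assocEl X Φ Ψ t i j h)
    fun _ _ _ _ _ _ _ h₁ h₂ h₃ h₄ x f w => tensMapL_elHom_act X Φ Ψ h₁ h₂ h₃ h₄ x f w

theorem tensAssocX_tmk (X : RMod T) (Φ Ψ : DGBimod T) (z : T.Obj) (n : ℤ) (t : T.Obj) (i j : ℤ)
    (h : i + j = n) (x : X.X t i) (w : ((Φ.tensor Ψ).obj t).X z j) :
    tensAssocX X Φ Ψ z n (tmk X (Φ.tensor Ψ) t i j h x w) = assocEl X Φ Ψ t i j h x w :=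
  tensLift_tmk X (Φ.tensor Ψ) _ _ t i j h x w

/-- The morphism `x ⊗ (γ ⊗ δ) ↦ (x ⊗ γ) ⊗ δ`. -/
noncomputable def tensAssoc (X : RMod T) (Φ Ψ : DGBimod T) :
    homSub (tens X (Φ.tensor Ψ)) (tens (tens X Φ) Ψ) 0 :=
  ⟨fun z s => tensAssocX X Φ Ψ z s.1.2 ∘ₗ (tens X (Φ.tensor Ψ)).cst
      (show s.1.1 = s.1.2 by have := s.2; omega), by
    intro a b i j q r s h h₁ h₂ h₃ w g
    obtain rfl : i = j := by omega
    obtain rfl : r = s := by omega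
    refine tens_ind (tensAssocX X Φ Ψ a r ∘ₗ (tensAct X (Φ.tensor Ψ) h₁).flip g)
      (((tens (tens X Φ) Ψ).act h₃).flip g ∘ₗ tensAssocX X Φ Ψ b i) w fun t i' j' hij x γ => ?_
    simp only [LinearMap.comp_apply, LinearMap.flip_apply]
    rw [tensAct_tmk X _ h₁ t i' j' (j' + q) hij rfl (by omega), tensAssocX_tmk, tensAssocX_tmk]
    exact app_act (tensMapL Ψ (elHom X Φ t i' x)) a b j' i q (j' + q) r hij rfl (by omega) h₃ γ g⟩

theorem app_tensAssoc (X : RMod T) (Φ Ψ : DGBimod T) (z : T.Obj) (n : ℤ) (h : 0 + n = n)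
    (t : T.Obj) (i j : ℤ) (hij : i + j = n) (x : X.X t i) (w : ((Φ.tensor Ψ).obj t).X z j) :
    app (tensAssoc X Φ Ψ) z n n h (el X (Φ.tensor Ψ) t i j hij x w) =
      assocEl X Φ Ψ t i j hij x w :=
  tensAssocX_tmk X Φ Ψ z n t i j hij x w

/-- This Leibniz rule is the formula for the differential of the morphism `elHom X Φ t i x ⊗ Ψ`,
rearranged, since `- ⊗ Ψ` commutes with differentials. -/
theorem d_assocEl (X : RMod T) (Φ Ψ : DGBimod T) {z : T.Obj} {n m : ℤ} (h : n + 1 = m)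
    (t : T.Obj) (i j i' j' : ℤ) (hij : i + j = n) (hi : i + 1 = i') (hj : j + 1 = j')
    (h₁ : i' + j = m) (h₂ : i + j' = m) (x : X.X t i) (w : ((Φ.tensor Ψ).obj t).X z j) :
    (tens (tens X Φ) Ψ).d n m h (assocEl X Φ Ψ t i j hij x w) =
      assocEl X Φ Ψ t i' j h₁ (X.d i i' hi x) w +
        sg k i • assocEl X Φ Ψ t i j' h₂ x (((Φ.tensor Ψ).obj t).d j j' hj w) := by
  have e : tensMapL Ψ (elHom X Φ t i' (X.d i i' hi x)) =
      homD _ _ i i' hi (tensMapL Ψ (elHom X Φ t i x)) := by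
    rw [← homD_elHom]
    exact (tensFunctor Ψ).map_d i i' hi (elHom X Φ t i x)
  have e' := congrArg (fun u => app u z j m h₁ w) e
  have e'' := homD_apply _ _ hi (tensMapL Ψ (elHom X Φ t i x)) z j m j' n h₁ hj hij h h₂ w
  exact (sub_eq_iff_eq_add.mp (e'.trans e'').symm)

theorem closed_tensAssoc (X : RMod T) (Φ Ψ : DGBimod T) :
    (cat T).IsClosed₀ (tensAssoc X Φ Ψ) := by
  refine tens_hom_ext fun z p q h t i j hij x w => ?_
  obtain rfl : p + 1 = q := by omega
  rw [homD_apply _ _ _ _ z p (p + 1) (p + 1) p h rfl (by omega) rfl (by omega),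
    d_el X (Φ.tensor Ψ) rfl t i j (i + 1) (j + 1) hij rfl rfl (by omega) (by omega), map_add,
    map_smul, app_tensAssoc, app_tensAssoc, app_tensAssoc, sg_zero, one_smul]
  exact sub_eq_zero.mpr (d_assocEl X Φ Ψ rfl t i j (i + 1) (j + 1) hij rfl rfl (by omega)
    (by omega) x w)

theorem isNat_tensAssoc (Φ Ψ : DGBimod T) : (tensFunctor (Φ.tensor Ψ)).IsNat
    ((tensFunctor Φ).comp (tensFunctor Ψ)) 0 fun X => tensAssoc X Φ Ψ := by
  intro X Y p r h h' φ
  obtain rfl : p = r := by omega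
  rw [zero_mul, sg_zero, one_smul]
  refine tens_hom_ext fun z m n hmn t i j hij x w => ?_
  refine (homComp_apply _ _ _ h _ _ z m n n hmn hmn (by omega) _).trans ?_
  refine Eq.trans ?_ (homComp_apply _ _ _ h' _ _ z m n m hmn (by omega) hmn _).symm
  refine (congrArg _ (app_tensMapL (Φ.tensor Ψ) φ z m n hmn t i j (p + i) hij rfl (by omega)
    x w)).trans ?_
  refine (app_tensAssoc Y Φ Ψ z n _ t (p + i) j (by omega) _ w).trans ?_
  refine Eq.trans ?_ (congrArg _ (app_tensAssoc X Φ Ψ z m _ t i j hij x w)).symm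
  have e := (tensFunctor Ψ).map_comp rfl (tensMapL Φ φ) (elHom X Φ t i x)
  rw [tensMapL_elHom Φ rfl φ t x] at e
  refine (congrArg (fun u => app u z j n (show p + i + j = n by omega) w) e).trans ?_
  exact homComp_apply _ _ _ rfl _ _ z j n m _ hij hmn w

/-- The elements `γ ⊗ δ` of the tensor product of bimodules. -/
noncomputable def elTensor (Φ Ψ : DGBimod T) (s : T.Obj) {z : T.Obj} {l : ℤ} (t : T.Obj)
    (q j : ℤ) (h : q + j = l) :
    (Φ.obj s).X t q →ₗ[k] (Ψ.obj t).X z j →ₗ[k] ((Φ.tensor Ψ).obj s).X z l :=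
  el (Φ.obj s) Ψ t q j h

theorem elTensor_act (Φ Ψ : DGBimod T) (s : T.Obj) {z : T.Obj} {l : ℤ} {a b : T.Obj}
    {i q j r l' : ℤ} (h₁ : i + q = r) (h₂ : q + j = l') (h₃ : r + j = l) (h₄ : i + l' = l)
    (γ : (Φ.obj s).X b i) (f : T.Hom a b q) (δ : (Ψ.obj a).X z j) :
    elTensor Φ Ψ s a r j h₃ ((Φ.obj s).act h₁ γ f) δ =
      elTensor Φ Ψ s b i l' h₄ γ (app (Ψ.map f) z j l' h₂ δ) :=
  el_act (Φ.obj s) Ψ h₁ h₂ h₃ h₄ γ f δ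

theorem map_elTensor (Φ Ψ : DGBimod T) {a b z t : T.Obj} {q p j r l l' : ℤ} (f : T.Hom a b q)
    (h : p + j = l) (h₁ : q + p = r) (h₂ : q + l = l') (h₃ : r + j = l')
    (γ : (Φ.obj a).X t p) (δ : (Ψ.obj t).X z j) :
    app ((Φ.tensor Ψ).map f) z l l' h₂ (elTensor Φ Ψ a t p j h γ δ) =
      elTensor Φ Ψ b t r j h₃ (app (Φ.map f) t p r h₁ γ) δ :=
  app_tensMapL Ψ (Φ.map f) z l l' h₂ t p j r h h₁ h₃ γ δ

theorem assocEl_elTensor (X : RMod T) (Φ Ψ : DGBimod T) {z : T.Obj} {n : ℤ}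
    (t s : T.Obj) (i j p q l : ℤ) (h : i + j = n) (hpq : p + q = i) (hl : q + j = l)
    (hl' : p + l = n) (x : X.X s p) (γ : (Φ.obj s).X t q) (δ : (Ψ.obj t).X z j) :
    assocEl X Φ Ψ s p l hl' x (elTensor Φ Ψ s t q j hl γ δ) =
      el (tens X Φ) Ψ t i j h (el X Φ s p q hpq x γ) δ :=
  app_tensMapL Ψ (elHom X Φ s p x) z l n hl' t q j i hl hpq h γ δ

/-- The trilinear map `(x, γ, δ) ↦ x ⊗ (γ ⊗ δ)`. -/
noncomputable def elEl (X : RMod T) (Φ Ψ : DGBimod T) {z : T.Obj} {n : ℤ} (t s : T.Obj)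
    (j p q l : ℤ) (hl : q + j = l) (h : p + l = n) :
    X.X s p →ₗ[k] (Φ.obj s).X t q →ₗ[k] (Ψ.obj t).X z j →ₗ[k] (tens X (Φ.tensor Ψ)).X z n :=
  LinearMap.mk₂ k
    (fun x γ => el X (Φ.tensor Ψ) s p l h x ∘ₗ elTensor Φ Ψ s t q j hl γ)
    (by intros; ext1; simp) (by intros; ext1; simp) (by intros; ext1; simp)
    (by intros; ext1; simp)

theorem elEl_apply (X : RMod T) (Φ Ψ : DGBimod T) {z : T.Obj} {n : ℤ} (t s : T.Obj)
    (j p q l : ℤ) (hl : q + j = l) (h : p + l = n) (x : X.X s p) (γ : (Φ.obj s).X t q)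
    (δ : (Ψ.obj t).X z j) :
    elEl X Φ Ψ t s j p q l hl h x γ δ =
      el X (Φ.tensor Ψ) s p l h x (elTensor Φ Ψ s t q j hl γ δ) := rfl

/-- The map `(x ⊗ γ, δ) ↦ x ⊗ (γ ⊗ δ)`. -/
noncomputable def assocInvEl (X : RMod T) (Φ Ψ : DGBimod T) {z : T.Obj} {n : ℤ} (t : T.Obj)
    (i j : ℤ) (h : i + j = n) :
    (tens X Φ).X t i →ₗ[k] (Ψ.obj t).X z j →ₗ[k] (tens X (Φ.tensor Ψ)).X z n :=
  tensLift X Φ (W := (Ψ.obj t).X z j →ₗ[k] (tens X (Φ.tensor Ψ)).X z n)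
    (fun s p q hpq => elEl X Φ Ψ t s j p q (q + j) rfl (by omega))
    (by
      intro a b p s q r l h₁ h₂ h₃ h₄ x f γ
      ext1 δ
      rw [elEl_apply, elEl_apply]
      refine (el_act X (Φ.tensor Ψ) h₁ (show s + (q + j) = l + j by omega) (by omega) (by omega)
        x f _).trans ?_
      exact congrArg _ (map_elTensor Φ Ψ f rfl h₂ _ rfl γ δ))

theorem assocInvEl_el (X : RMod T) (Φ Ψ : DGBimod T) {z : T.Obj} {n : ℤ} (t s : T.Obj)
    (i j p q l : ℤ) (h : i + j = n) (hpq : p + q = i) (hl : q + j = l) (hl' : p + l = n)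
    (x : X.X s p) (γ : (Φ.obj s).X t q) (δ : (Ψ.obj t).X z j) :
    assocInvEl X Φ Ψ t i j h (el X Φ s p q hpq x γ) δ =
      el X (Φ.tensor Ψ) s p l hl' x (elTensor Φ Ψ s t q j hl γ δ) := by
  subst hl
  exact LinearMap.congr_fun (tensLift_tmk X Φ _ _ s p q hpq x γ) δ

/-- The components of `(x ⊗ γ) ⊗ δ ↦ x ⊗ (γ ⊗ δ)`. -/
noncomputable def tensAssocInvX (X : RMod T) (Φ Ψ : DGBimod T) (z : T.Obj) (n : ℤ) :
    (tens (tens X Φ) Ψ).X z n →ₗ[k] (tens X (Φ.tensor Ψ)).X z n :=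
  tensLift (tens X Φ) Ψ (fun t i j h => assocInvEl X Φ Ψ t i j h)
    (by
      intro a b i q j r l h₁ h₂ h₃ h₄ w f δ
      refine el_ind (X := X) (Φ := Φ) ((assocInvEl X Φ Ψ a r j h₃).flip δ ∘ₗ
        ((tens X Φ).act h₁).flip f) ((assocInvEl X Φ Ψ b i l h₄).flip (app (Ψ.map f) z j l h₂ δ))
        w fun s p p' hp x γ => ?_
      rw [LinearMap.comp_apply, LinearMap.flip_apply, LinearMap.flip_apply, LinearMap.flip_apply,
        act_el X Φ h₁ s p p' (p' + q) hp rfl (by omega),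
        assocInvEl_el X Φ Ψ a s r j p (p' + q) (p' + q + j) h₃ (by omega) rfl (by omega),
        assocInvEl_el X Φ Ψ b s i l p p' (p' + q + j) h₄ hp (by omega) (by omega)]
      exact congrArg _ (elTensor_act Φ Ψ s rfl h₂ rfl (by omega) γ f δ))

theorem tensAssocInvX_el (X : RMod T) (Φ Ψ : DGBimod T) (z : T.Obj) (n : ℤ) (t : T.Obj)
    (i j : ℤ) (h : i + j = n) (w : (tens X Φ).X t i) (δ : (Ψ.obj t).X z j) :
    tensAssocInvX X Φ Ψ z n (el (tens X Φ) Ψ t i j h w δ) = assocInvEl X Φ Ψ t i j h w δ :=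
  tensLift_tmk (tens X Φ) Ψ _ _ t i j h w δ

/-- The form of `el_ind` for the values of `Φ.tensor Ψ`, which are tensor products only after
unfolding. -/
theorem elTensor_ind {Φ Ψ : DGBimod T} {s z : T.Obj} {n : ℤ} {W : Type*} [AddCommGroup W]
    [Module k W] (f g : ((Φ.tensor Ψ).obj s).X z n →ₗ[k] W) (w : ((Φ.tensor Ψ).obj s).X z n)
    (h : ∀ (t : T.Obj) (i j : ℤ) (hij : i + j = n) (x : (Φ.obj s).X t i) (γ : (Ψ.obj t).X z j),
      f (elTensor Φ Ψ s t i j hij x γ) = g (elTensor Φ Ψ s t i j hij x γ)) : f w = g w :=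
  el_ind (X := Φ.obj s) (Φ := Ψ) f g w h

/-- The two maps exchange `x ⊗ (γ ⊗ δ)` and `(x ⊗ γ) ⊗ δ`. A degreewise inverse suffices, so its
compatibility with differentials and actions is not needed. -/
theorem isQuasiIso_tensAssoc (X : RMod T) (Φ Ψ : DGBimod T) :
    IsQuasiIso (tensAssoc X Φ Ψ) := by
  refine isQuasiIso_of_bijective (closed_tensAssoc X Φ Ψ)
    (fun z n w => tensAssocInvX X Φ Ψ z n w) (fun z n w => ?_) fun z n w => ?_
  · refine el_ind (tensAssocInvX X Φ Ψ z n ∘ₗ app (tensAssoc X Φ Ψ) z n n (zero_add n))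
      LinearMap.id w fun s p l hl' x v => ?_
    refine elTensor_ind (tensAssocInvX X Φ Ψ z n ∘ₗ
      app (tensAssoc X Φ Ψ) z n n (zero_add n) ∘ₗ el X (Φ.tensor Ψ) s p l hl' x)
      (el X (Φ.tensor Ψ) s p l hl' x) v fun t q j hl γ δ => ?_
    rw [LinearMap.comp_apply, LinearMap.comp_apply, app_tensAssoc,
      assocEl_elTensor X Φ Ψ t s (p + q) j p q l (by omega) rfl hl hl', tensAssocInvX_el,
      assocInvEl_el X Φ Ψ t s (p + q) j p q l (by omega) rfl hl hl']
  · refine el_ind (app (tensAssoc X Φ Ψ) z n n (zero_add n) ∘ₗ tensAssocInvX X Φ Ψ z n)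
      LinearMap.id w fun t i j hij v δ => ?_
    refine el_ind (app (tensAssoc X Φ Ψ) z n n (zero_add n) ∘ₗ tensAssocInvX X Φ Ψ z n ∘ₗ
      (el (tens X Φ) Ψ t i j hij).flip δ) ((el (tens X Φ) Ψ t i j hij).flip δ) v
      fun s p q hpq x γ => ?_
    rw [LinearMap.comp_apply, LinearMap.comp_apply, LinearMap.flip_apply, tensAssocInvX_el,
      assocInvEl_el X Φ Ψ t s i j p q (q + j) hij hpq rfl (by omega), app_tensAssoc,
      assocEl_elTensor X Φ Ψ t s i j p q (q + j) hij hpq rfl (by omega)]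

end RMod

namespace RMod

variable {k : Type u} [CommRing k] {T : DGCat.{u, u} k}

/-! ### Morphisms out of h-projective modules -/

/-- Composition with a closed morphism whose cone is acyclic is surjective on homotopy classes of
morphisms out of an h-projective module. -/
theorem IsHProj.exists_lift {P M N K : RMod T} (hP : P.IsHProj) (hK : K.IsAcyclic)
    {φ : (cat T).Hom M N 0} (c : (cat T).ConeData φ K) (f : (cat T).Hom P N 0)
    (hf : (cat T).IsClosed₀ f) :
    ∃ g : (cat T).Hom P M 0, (cat T).IsClosed₀ g ∧
      ∃ s, (cat T).comp₀ φ g - f = (cat T).bd s := by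
  have hif : (cat T).d 0 1 (zero_add 1) ((cat T).comp (add_zero 0) c.i f) = 0 :=
    DGCat.H0.closed_comp c.d_i hf
  -- With `i f = dη`, the component `q η` is the lift, and `-p η` is the homotopy, since `d(p η) = f
  -- - φ q η`.
  obtain ⟨η, hη⟩ := hP K hK (-1) 0 1 (by norm_num) (zero_add 1) _ hif
  refine ⟨(cat T).comp (show (1 : ℤ) + -1 = 0 by norm_num) c.q η, ?_,
    -(cat T).comp (zero_add (-1)) c.p η, ?_⟩
  · unfold DGCat.IsClosed₀
    rw [(cat T).d_comp _ (p' := 2) (q' := 0) (by norm_num) (by norm_num) (zero_add 1)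
      (by norm_num) (add_zero 1), c.d_q, hη,
      ← (cat T).assoc (add_zero 1) (add_zero 1) (add_zero 0) (add_zero 1), c.q_i]
    simp
  · unfold DGCat.bd DGCat.comp₀
    rw [map_neg, (cat T).d_comp (zero_add (-1)) (p' := 1) (q' := 0) (zero_add 1) (by norm_num)
      (by norm_num) (by norm_num) (add_zero 0), hη, c.d_p, sg_zero, one_smul,
      ← (cat T).assoc (add_zero 0) (add_zero 0) (add_zero 0) (add_zero 0), c.p_i,
      (cat T).id_comp, map_neg, LinearMap.neg_apply,
      (cat T).assoc (zero_add 1) (show (1 : ℤ) + -1 = 0 by norm_num)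
        (show (1 : ℤ) + -1 = 0 by norm_num) (add_zero 0)]
    abel

/-- Composition with a closed morphism whose cone is acyclic is injective on homotopy classes of
morphisms out of an h-projective module. -/
theorem IsHProj.exists_bd {P M N K : RMod T} (hP : P.IsHProj) (hK : K.IsAcyclic)
    {φ : (cat T).Hom M N 0} (c : (cat T).ConeData φ K) (g : (cat T).Hom P M 0)
    (hg : (cat T).IsClosed₀ g) (s : (cat T).Hom P N (-1))
    (hs : (cat T).comp₀ φ g = (cat T).bd s) : ∃ t, g = (cat T).bd t := by
  unfold DGCat.comp₀ DGCat.bd at *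
  unfold DGCat.IsClosed₀ at hg
  -- Both `j g` and `i s` have differential `i φ g`. As `q` sends `j g - i s` to `g`, a primitive
  -- `η` of this cocycle gives the primitive `-q η` of `g`.
  have hz : (cat T).d (-1) 0 (by norm_num) ((cat T).comp (add_zero (-1)) c.j g -
      (cat T).comp (zero_add (-1)) c.i s) = 0 := by
    rw [map_sub, (cat T).d_comp (add_zero (-1)) (p' := 0) (by norm_num) (zero_add 1) (by norm_num)
      (add_zero 0) (by norm_num), (cat T).d_comp (zero_add (-1)) (q' := 0) (zero_add 1)
      (by norm_num) (by norm_num) (by norm_num) (add_zero 0), c.d_j, hg, c.d_i, sg_zero, one_smul,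
      ← hs, (cat T).assoc (add_zero 0) (add_zero 0) (add_zero 0) (add_zero 0)]
    simp
  obtain ⟨η, hη⟩ := hP K hK (-2) (-1) 0 (by norm_num) (by norm_num) _ hz
  refine ⟨-(cat T).comp (show (1 : ℤ) + -2 = -1 by norm_num) c.q η, ?_⟩
  rw [map_neg, (cat T).d_comp _ (p' := 2) (q' := -1) (by norm_num) (by norm_num) (by norm_num)
    (by norm_num) (show (1 : ℤ) + -1 = 0 by norm_num), c.d_q, hη, sg_one, map_sub,
    ← (cat T).assoc (show (1 : ℤ) + -1 = 0 by norm_num) (add_zero 0) (add_zero (-1))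
      (show (1 : ℤ) + -1 = 0 by norm_num), c.q_j, (cat T).id_comp,
    ← (cat T).assoc (add_zero 1) (show (1 : ℤ) + -1 = 0 by norm_num) (zero_add (-1))
      (show (1 : ℤ) + -1 = 0 by norm_num), c.q_i]
  simp

/-- Composition with a closed quasi-isomorphism is bijective on homotopy classes of morphisms out
of an h-projective module. -/
theorem IsHProj.bijective_comp_cl {P M N : RMod T} (hP : P.IsHProj) {φ : (cat T).Hom M N 0}
    (hφ : (cat T).IsClosed₀ φ) (H : IsQuasiIso φ) :
    Function.Bijective fun x : (⟨P⟩ : (cat T).H0) ⟶ ⟨M⟩ =>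
      x ≫ (DGCat.H0.cl φ hφ : (⟨M⟩ : (cat T).H0) ⟶ ⟨N⟩) := by
  constructor
  · intro x y hxy
    obtain ⟨x, hx, rfl⟩ := DGCat.H0.cl_surj x
    obtain ⟨y, hy, rfl⟩ := DGCat.H0.cl_surj y
    obtain ⟨s, hs⟩ := (DGCat.H0.cl_eq_iff (DGCat.H0.closed_comp hφ hx)
      (DGCat.H0.closed_comp hφ hy)).mp hxy
    have hxy' : (cat T).IsClosed₀ (x - y) := by
      unfold DGCat.IsClosed₀ at *
      rw [map_sub, hx, hy, sub_zero]
    exact (DGCat.H0.cl_eq_iff hx hy).mpr (hP.exists_bd (H.acyclic_cone hφ) (coneData φ hφ) _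
      hxy' s ((map_sub _ _ _).trans hs))
  · intro f
    obtain ⟨f, hf, rfl⟩ := DGCat.H0.cl_surj f
    obtain ⟨g, hg, h⟩ := hP.exists_lift (H.acyclic_cone hφ) (coneData φ hφ) f hf
    exact ⟨DGCat.H0.cl g hg, (DGCat.H0.cl_eq_iff (DGCat.H0.closed_comp hφ hg) hf).mpr h⟩

/-! ### Modules as functors on the perfect modules -/

/-- The functor which a dg-module represents on the perfect modules. -/
def restrictedYoneda (T : DGCat.{u, u} k) : (cat T).H0 ⥤ (pe T).H0ᵒᵖ ⥤ Type u :=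
  yoneda ⋙ (Functor.whiskeringLeft _ _ _).obj (incl T).op

/-- A quasi-isomorphism need not be invertible in the homotopy category of all modules, but perfect
modules are h-projective and cannot detect the difference. -/
theorem isIso_restrictedYoneda {M N : RMod T} {φ : (cat T).Hom M N 0}
    (hφ : (cat T).IsClosed₀ φ) (H : IsQuasiIso φ) :
    IsIso ((restrictedYoneda T).map (DGCat.H0.cl φ hφ : (⟨M⟩ : (cat T).H0) ⟶ ⟨N⟩)) := by
  rw [NatTrans.isIso_iff_isIso_app]
  intro P
  exact (isIso_iff_bijective _).mpr (P.unop.of.2.1.bijective_comp_cl hφ H)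

/-- The inclusion of the perfect modules is fully faithful. -/
def fullyFaithfulIncl (T : DGCat.{u, u} k) : (incl T).FullyFaithful where
  -- A full dg-subcategory keeps the complexes of morphisms, so the two types of morphisms agree by
  -- definition.
  preimage {X Y} f := (show X ⟶ Y from f)
  map_preimage {X Y} f := by
    obtain ⟨f, hf, rfl⟩ := DGCat.H0.cl_surj f
    rfl
  preimage_map {X Y} f := by
    obtain ⟨f, hf, rfl⟩ := DGCat.H0.cl_surj f
    rfl

/-- On perfect modules, the restricted Yoneda embedding is the Yoneda embedding. -/
def inclRestrictedYoneda (T : DGCat.{u, u} k) : yoneda ≅ incl T ⋙ restrictedYoneda T :=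
  NatIso.ofComponents
    (fun X => NatIso.ofComponents (fun P => ((fullyFaithfulIncl T).homEquiv (X := P.unop)).toIso)
      fun f => by
        ext x
        exact (incl T).map_comp f.unop x)
    fun f => by
      ext P x
      exact (incl T).map_comp x f

/-- Functors between perfect modules are isomorphic if they represent the same functors. -/
theorem nonempty_iso_of_restrictedYoneda {A B : (pe T).H0 ⥤ (pe T).H0}
    (h : Nonempty (A ⋙ incl T ⋙ restrictedYoneda T ≅ B ⋙ incl T ⋙ restrictedYoneda T)) :
    Nonempty (A ≅ B) := by
  obtain ⟨e⟩ := h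
  exact ⟨Functor.fullyFaithfulCancelRight yoneda
    (Functor.isoWhiskerLeft A (inclRestrictedYoneda T) ≪≫ e ≪≫
      Functor.isoWhiskerLeft B (inclRestrictedYoneda T).symm)⟩

/-- The functors on perfect modules represented by the values of `F` at perfect modules. -/
def represented (F : DGFunctor (cat T) (cat T)) : (pe T).H0 ⥤ (pe T).H0ᵒᵖ ⥤ Type u :=
  incl T ⋙ F.mapH0 ⋙ restrictedYoneda T

/-- A closed dg-natural family of quasi-isomorphisms does not change the represented functors. -/
theorem nonempty_represented_iso {F G : DGFunctor (cat T) (cat T)}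
    {θ : ∀ X, (cat T).Hom (F.obj X) (G.obj X) 0} (hθ : F.IsNat G 0 θ)
    (hc : ∀ X, (cat T).IsClosed₀ (θ X)) (hq : ∀ X : RMod T, X.IsHProj → IsQuasiIso (θ X)) :
    Nonempty (represented F ≅ represented G) := by
  let t : represented F ⟶ represented G :=
    Functor.whiskerLeft (incl T) (Functor.whiskerRight (DGFunctor.natH0 hθ hc) (restrictedYoneda T))
  have : ∀ X, IsIso (t.app X) := fun X =>
    isIso_restrictedYoneda (hc X.of.1) (hq X.of.1 X.of.2.1)
  have : IsIso t := (NatTrans.isIso_iff_isIso_app t).mpr this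
  exact ⟨asIso t⟩

/-- This rests on h-flatness of h-projective modules. Neither bimodule is assumed to preserve
perfect modules, which is what makes it applicable to the inner terms of a zigzag. -/
theorem nonempty_represented_iso_of_hasQuasiIso {Φ Ψ : DGBimod T} (h : Φ.HasQuasiIso Ψ) :
    Nonempty (represented (tensFunctor Φ) ≅ represented (tensFunctor Ψ)) := by
  obtain ⟨θ, hθ, hcq⟩ := h
  refine nonempty_represented_iso (θ := fun X => tensMapR X θ hθ) ?_ (fun X => ?_) fun X hX =>
    IsHProj.isQuasiIso_tensMapR hθ hX (fun a => (hcq a).1) fun a => (hcq a).2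
  · intro X Y p r h h' φ
    -- Naturality in `X` is the exchange law for the two variables of the tensor product; its Koszul
    -- sign is trivial as `θ` has degree `0`.
    have e := tensMapL_tensMapR h' h φ θ hθ
    rw [mul_zero, sg_zero, one_smul] at e
    rw [zero_mul, sg_zero, one_smul]
    exact e.symm
  · refine (tensMapR_d X (zero_add 1) θ hθ (fun _ => 0) (DGFunctor.isNat_zero _ _ _) fun a =>
      (hcq a).1.symm).symm.trans ?_
    exact tensMapR_zero X (Φ := Φ) (Ψ := Ψ) (fun _ => 0) (DGFunctor.isNat_zero _ _ _) fun _ => rfl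

/-- On represented functors every arrow of the zigzag is an isomorphism, so arrows pointing
backwards can be inverted. -/
theorem nonempty_represented_iso_of_eqvGen {Φ Ψ : DGBimod T}
    (h : Relation.EqvGen DGBimod.HasQuasiIso Φ Ψ) :
    Nonempty (represented (tensFunctor Φ) ≅ represented (tensFunctor Ψ)) := by
  induction h with
  | rel _ _ h => exact nonempty_represented_iso_of_hasQuasiIso h
  | refl _ => exact ⟨Iso.refl _⟩
  | symm _ _ _ ih => exact ih.map Iso.symm
  | trans _ _ _ _ _ ih₁ ih₂ => exact ih₁.elim fun e₁ => ih₂.map fun e₂ => e₁ ≪≫ e₂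

theorem incl_map_peFunctor_comp {F G : DGFunctor (cat T) (cat T)}
    (hF : ∀ X : RMod T, X.IsPerfect → (F.obj X).IsPerfect)
    (hG : ∀ X : RMod T, X.IsPerfect → (G.obj X).IsPerfect) {X Y : (pe T).H0} (x : X ⟶ Y) :
    (incl T).map ((peFunctor G hG).map ((peFunctor F hF).map x)) =
      (F.comp G).mapH0.map ((incl T).map x) := by
  obtain ⟨x, hx, rfl⟩ := DGCat.H0.cl_surj x
  rfl

/-- On perfect modules, a composite of dg-functors induces the composite functor. -/
def peFunctorCompIncl {F G : DGFunctor (cat T) (cat T)}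
    (hF : ∀ X : RMod T, X.IsPerfect → (F.obj X).IsPerfect)
    (hG : ∀ X : RMod T, X.IsPerfect → (G.obj X).IsPerfect) :
    (peFunctor F hF ⋙ peFunctor G hG) ⋙ incl T ≅ incl T ⋙ (F.comp G).mapH0 :=
  NatIso.ofComponents (fun _ => Iso.refl _) fun x =>
    (Category.comp_id _).trans
      ((incl_map_peFunctor_comp hF hG x).trans (Category.id_comp _).symm)

/-- The identity dg-functor induces the identity functor. -/
def inclCompIdf : incl T ⋙ (DGFunctor.idf (cat T)).mapH0 ≅ 𝟭 _ ⋙ incl T :=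
  NatIso.ofComponents (fun _ => Iso.refl _) fun {a b} x => by
    obtain ⟨x, hx, rfl⟩ := DGCat.H0.cl_surj x
    exact (Category.comp_id _).trans (Category.id_comp _).symm

/-- The functors represented by a composite. -/
def representedComp {F G : DGFunctor (cat T) (cat T)}
    (hF : ∀ X : RMod T, X.IsPerfect → (F.obj X).IsPerfect)
    (hG : ∀ X : RMod T, X.IsPerfect → (G.obj X).IsPerfect) :
    (peFunctor F hF ⋙ peFunctor G hG) ⋙ incl T ⋙ restrictedYoneda T ≅ represented (F.comp G) :=
  Functor.isoWhiskerRight (peFunctorCompIncl hF hG) (restrictedYoneda T)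

/-- The functors represented by the identity. -/
def representedIdf : represented (DGFunctor.idf (cat T)) ≅ 𝟭 _ ⋙ incl T ⋙ restrictedYoneda T :=
  Functor.isoWhiskerRight inclCompIdf (restrictedYoneda T)

/-- If `Φ ⊗ Ψ` is connected to the identity bimodule by quasi-isomorphisms, then `- ⊗ Φ ⊗ Ψ` is
isomorphic to the identity on perfect modules. -/
theorem nonempty_peFunctor_comp_iso {Φ Ψ : DGBimod T}
    (hΦ : ∀ X : RMod T, X.IsPerfect → (tens X Φ).IsPerfect)
    (hΨ : ∀ X : RMod T, X.IsPerfect → (tens X Ψ).IsPerfect)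
    (h : Relation.EqvGen DGBimod.HasQuasiIso (Φ.tensor Ψ) (DGBimod.one T)) :
    Nonempty (peFunctor (tensFunctor Φ) hΦ ⋙ peFunctor (tensFunctor Ψ) hΨ ≅ 𝟭 _) := by
  refine nonempty_iso_of_restrictedYoneda ?_
  -- The chain links `(X ⊗ Φ) ⊗ Ψ`, `X ⊗ (Φ ⊗ Ψ)`, `X ⊗ T` and `X`; only the two ends are required
  -- to be perfect.
  obtain ⟨e₁⟩ := nonempty_represented_iso (isNat_tensAssoc Φ Ψ)
    (fun X => closed_tensAssoc X Φ Ψ) fun X _ => isQuasiIso_tensAssoc X Φ Ψ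
  obtain ⟨e₂⟩ := nonempty_represented_iso_of_eqvGen h
  obtain ⟨e₃⟩ := nonempty_represented_iso (isNat_tensOne (T := T))
    closed_tensOne fun X _ => isQuasiIso_tensOne X
  exact ⟨representedComp hΦ hΨ ≪≫ e₁.symm ≪≫ e₂ ≪≫ e₃ ≪≫ representedIdf⟩

end RMod

/-! ### Inverting a braided monoidal equivalence. -/

namespace CategoryTheory.Equivalence

open MonoidalCategory Functor.LaxMonoidal Functor.OplaxMonoidal

/-- The inverse of a braided monoidal equivalence is braided. -/
theorem nonempty_inverse_braided {C : Type v₁} {D : Type v₂} [Category.{v} C] [Category.{v₃} D]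
    [MonoidalCategory C] [MonoidalCategory D] [BraidedCategory C] [BraidedCategory D]
    (e : C ≌ D) [e.functor.Braided] : Nonempty e.inverse.Braided := by
  let := e.toAdjunction.rightAdjointLaxMonoidal
  let M : e.inverse.Monoidal := e.inverseMonoidal
  refine ⟨{ M with braided := fun X Y => ?_ }⟩
  -- The structure maps of the inverse are adjoint to those of the functor, so the identity can be
  -- checked across the adjunction, where the functor preserves the braiding.
  change e.toAdjunction.rightAdjointLaxMonoidal.μ X Y ≫ _ =
    _ ≫ e.toAdjunction.rightAdjointLaxMonoidal.μ Y X
  rw [Adjunction.rightAdjointLaxMonoidal_μ, Adjunction.rightAdjointLaxMonoidal_μ,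
    ← Adjunction.homEquiv_naturality_right, ← Adjunction.homEquiv_naturality_left]
  congr 1
  rw [Functor.map_braiding]
  simp
  
end CategoryTheory.Equivalence

/-! ### The symmetric monoidal functor on homotopy categories. -/

namespace TensorFunctorData

open DGCat TensorData

variable {k : Type u} [CommRing k] {C : DGCat.{v, u} k} {E E' : DGBifunctor C C C}
  {D : TensorData E} {D' : TensorData E'} {F : DGFunctor C C} (A : TensorFunctorData D D' F)
  {P : C.Obj → Prop} {S : D.IsStable P} {S' : D'.IsStable P}
  (hF : ∀ X, P X → P (F.obj X))

variable (S S') in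
/-- The functor on homotopy categories induced by a dg-functor which preserves `P`. -/
def functor : TT D' S' ⥤ TT D S :=
  (F.restrict P P hF).mapH0

/-- The class of `u`. -/
def clu : (un : TT D S) ⟶ (functor S S' hF).obj un :=
  H0.cl (C := C.full P) A.u A.u_closed

/-- The class of `f`. -/
def clf (X Y : TT D' S') :
    ten ((functor S S' hF).obj X) ((functor S S' hF).obj Y) ⟶ (functor S S' hF).obj (ten X Y) :=
  H0.cl (C := C.full P) (A.f X.of.1 Y.of.1) (A.f_closed _ _)

theorem clf_nat₁ {X X' : TT D' S'} (g : X ⟶ X') (Y : TT D' S') :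
    whR ((functor S S' hF).map g) ((functor S S' hF).obj Y) ≫ A.clf hF X' Y =
      A.clf hF X Y ≫ (functor S S' hF).map (whR g Y) := by
  obtain ⟨g, hg, rfl⟩ := H0.cl_surj (C := C.full P) g
  exact H0.cl_congr (C := C.full P) _ _ ((A.f_nat₁ Y.of.1).comp₀_eq g)

theorem clf_nat₂ (X : TT D' S') {Y Y' : TT D' S'} (g : Y ⟶ Y') :
    whL ((functor S S' hF).obj X) ((functor S S' hF).map g) ≫ A.clf hF X Y' =
      A.clf hF X Y ≫ (functor S S' hF).map (whL X g) := by
  obtain ⟨g, hg, rfl⟩ := H0.cl_surj (C := C.full P) g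
  exact H0.cl_congr (C := C.full P) _ _ ((A.f_nat₂ X.of.1).comp₀_eq g)

/-- The boundary of `w` vanishes in `H⁰`; `e` and `a` play the same role in `cl_symm` and
`cl_assoc`. -/
theorem cl_unit (X : TT D' S') :
    (whR (A.clu hF) ((functor S S' hF).obj X) ≫ A.clf hF un X) ≫
      (functor S S' hF).map (clℓ X) = clℓ ((functor S S' hF).obj X) :=
  H0.cl_eq_of (C := C.full P) _ _ _ (A.unit X.of.1)

theorem cl_symm (X Y : TT D' S') :
    A.clf hF X Y ≫ (functor S S' hF).map (clc X Y) =
      clc ((functor S S' hF).obj X) ((functor S S' hF).obj Y) ≫ A.clf hF Y X :=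
  H0.cl_eq_of (C := C.full P) _ _ _ (A.symmetry X.of.1 Y.of.1)

theorem cl_assoc (X Y Z : TT D' S') :
    (clα ((functor S S' hF).obj X) ((functor S S' hF).obj Y) ((functor S S' hF).obj Z) ≫
        whR (A.clf hF X Y) ((functor S S' hF).obj Z)) ≫ A.clf hF (ten X Y) Z =
      (whL ((functor S S' hF).obj X) (A.clf hF Y Z) ≫ A.clf hF X (ten Y Z)) ≫
        (functor S S' hF).map (clα X Y Z) :=
  H0.cl_eq_of (C := C.full P) _ _ _ (A.assoc X.of.1 Y.of.1 Z.of.1)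

theorem cl_unit_symmetry (X : TT D S) : clc X un ≫ clℓ X = clr X :=
  H0.cl_eq_of (C := C.full P) _ _ _ (D.unit_symmetry X.of.1)

/-- Since `r = ℓ ∘ c` up to homotopy in both structures, and `f` respects the symmetries, right
unitality is left unitality conjugated by the symmetry. -/
theorem cl_unit_right (X : TT D' S') :
    whL ((functor S S' hF).obj X) (A.clu hF) ≫ A.clf hF X un ≫
      (functor S S' hF).map (clr X) = clr ((functor S S' hF).obj X) := by
  rw [← cl_unit_symmetry X, Functor.map_comp, reassoc_of% (A.cl_symm hF X un),
    reassoc_of% (clc_nat₂ ((functor S S' hF).obj X) (A.clu hF)), ← Category.assoc (whR _ _),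
    A.cl_unit hF, cl_unit_symmetry]

/-- The associators of both categories are inverses of the classes of `α`, so the coherence has to
be rewritten with both of these classes inverted. -/
theorem cl_assoc_inv (X Y Z : TT D' S') :
    whR (A.clf hF X Y) ((functor S S' hF).obj Z) ≫ A.clf hF (ten X Y) Z ≫
      (functor S S' hF).map (inv (clα X Y Z)) =
      inv (clα ((functor S S' hF).obj X) ((functor S S' hF).obj Y) ((functor S S' hF).obj Z)) ≫
        whL ((functor S S' hF).obj X) (A.clf hF Y Z) ≫ A.clf hF X (ten Y Z) := by
  have h := A.cl_assoc (S := S) hF X Y Z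
  refine (IsIso.eq_inv_comp _).mpr ?_
  have h' : (functor S S' hF).map (clα X Y Z) ≫ (functor S S' hF).map (inv (clα X Y Z)) = 𝟙 _ := by
    rw [← Functor.map_comp, IsIso.hom_inv_id, CategoryTheory.Functor.map_id]
  rw [← Category.assoc, ← Category.assoc, h, Category.assoc, h']
  exact Category.comp_id _

/-- The monoidal structure on the functor induced on the homotopy categories. -/
noncomputable def coreMonoidal (hu : IsIso (A.clu (S := S) (S' := S') hF))
    (hf : ∀ X Y : TT D' S', IsIso (A.clf (S := S) hF X Y)) :
    (functor S S' hF).CoreMonoidal where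
  εIso := asIso (A.clu hF)
  μIso X Y := asIso (A.clf hF X Y)
  μIso_hom_natural_left g Y := A.clf_nat₁ hF g Y
  μIso_hom_natural_right X g := A.clf_nat₂ hF X g
  associativity X Y Z := A.cl_assoc_inv hF X Y Z
  left_unitality X := ((Category.assoc _ _ _).symm.trans (A.cl_unit hF X)).symm
  right_unitality X := (A.cl_unit_right hF X).symm

/-- The functor induced on the homotopy categories is symmetric monoidal. -/
theorem nonempty_braided (hu : IsIso (A.clu (S := S) (S' := S') hF))
    (hf : ∀ X Y : TT D' S', IsIso (A.clf (S := S) hF X Y)) :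
    Nonempty (functor S S' hF).Braided := by
  let M : (functor S S' hF).Monoidal := (A.coreMonoidal hF hu hf).toMonoidal
  exact ⟨{ M with braided := fun X Y => A.cl_symm (S := S) hF X Y }⟩

end TensorFunctorData

/-! ### The tensor triangulated equivalence. -/

namespace PseudoDGTensorFunctor

variable {k : Type u} [CommRing k] {T : DGCat.{u, u} k} {G L : PseudoDGTensor T}
  (hG : G.IsPerfect) (hL : L.IsPerfect) (Φ : PseudoDGTensorFunctor G L)

/-- The functor `X ↦ X ⊗ Φ` is symmetric monoidal on the homotopy categories. -/
theorem nonempty_braided :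
    Nonempty (TensorFunctorData.functor hG.isStable hL.isStable
      (F := RMod.tensFunctor Φ.bimod) Φ.perfect).Braided :=
  Φ.str.nonempty_braided Φ.perfect
    -- The sources and targets of `u` and `f` are perfect, hence h-projective, so these
    -- quasi-isomorphisms are homotopy equivalences.
    (DGCat.H0.isIso_cl (C := RMod.pe T) _ _ (Φ.u_qis.exists_inv Φ.str.u_closed hG.unit.1
      (Φ.perfect _ hL.unit).1))
    fun X Y => DGCat.H0.isIso_cl (C := RMod.pe T) _ _
      ((Φ.f_qis X.of.1 Y.of.1 X.of.2 Y.of.2).exists_inv (Φ.str.f_closed _ _)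
        (hG.tensor _ _ (Φ.perfect _ X.of.2) (Φ.perfect _ Y.of.2)).1
        (Φ.perfect _ (hL.tensor _ _ X.of.2 Y.of.2)).1)

end PseudoDGTensorFunctor

theorem mainTheorem6 {k : Type u} [CommRing k] (T : DGCat.{u, u} k) (G L : PseudoDGTensor T)
    (hG : G.IsPerfect) (hL : L.IsPerfect) (Φ : PseudoDGTensorFunctor G L)
    (hΦ : Φ.bimod.IsInvertible) :
    PseudoDGTensor.TensorTriangulatedEquivalent G L hG hL := by
  obtain ⟨Ψ, hΨ, h₁, h₂⟩ := hΦ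
  obtain ⟨e₁⟩ := RMod.nonempty_peFunctor_comp_iso Φ.perfect hΨ h₁
  obtain ⟨e₂⟩ := RMod.nonempty_peFunctor_comp_iso hΨ Φ.perfect h₂
  obtain ⟨B⟩ := Φ.nonempty_braided hG hL
  -- `Equivalence.mk` corrects the unit so that the triangle identity holds; no compatibility
  -- between `e₁` and `e₂` is needed.
  let e : PseudoDGTensor.TTCat L hL ≌ PseudoDGTensor.TTCat G hG :=
    CategoryTheory.Equivalence.mk
      (TensorFunctorData.functor hG.isStable hL.isStable (F := RMod.tensFunctor Φ.bimod) Φ.perfect)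
      (TensorFunctorData.functor hL.isStable hG.isStable (F := RMod.tensFunctor Ψ) hΨ)
      e₁.symm e₂
  have : e.functor.Braided := B
  -- The functor from `Γ` to `Λ` is the inverse, tensoring with `Ψ`. Being itself induced by a
  -- dg-functor, it is linear and exact without any transport along `e`; only the braiding is
  -- transported.
  exact ⟨e.inverse, inferInstance, DGFunctor.mapH0_additive _, DGFunctor.mapH0_linear _,
    RMod.isExact_peFunctor (RMod.tensFunctor Ψ) hΨ, e.nonempty_inverse_braided⟩
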